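/- **Conventions.** All objects are complex vector spaces, $\otimes=\otimes_{\mathbb C}$. Coproducts are written $h_1\otimes h_2$, coactions of a $\times$-Hopf coalgebra $m_{(0)}\otimes m_{(1)}$ or $m_{(-1)}\otimes m_{(0)}$, coactions of the base coalgebra $m_{0}\otimes m_{1}$ or $m_{-1}\otimes m_{0}$. For a right $C$-comodule $X$ and a left $C$-comodule $Y$, $X\square_C Y=\{x\otimes y:\ x_0\otimes x_1\otimes y=x\otimes y_{-1}\otimes y_0\}$ (finite sums suppressed). An identity between expressions built from maps defined only on cotensor products includes the assertion that the expressions are defined. **Bicoalgebroids.** Let $H,C$ be coalgebras, $\alpha:H\to C$ and $\beta:H\to C_{\rm cop}$ coalgebra maps with $\alpha(h_1)\otimes\beta(h_2)=\alpha(h_2)\otimes\beta(h_1)$. In the *left* case $H$ is a $C$-bicomodule by $\alpha(h_1)\otimes h_2$ and $h_2\otimes\beta(h_1)$; in the *right* case by $\beta(h_2)\otimes h_1$ and $h_1\otimes\alpha(h_2)$. $H$ is a left (right) bicoalgebroid over $C$ if it has $C$-bicomodule maps $\mu:H\square_CH\to H$, $g\otimes h\mapsto gh$, and $\eta:C\to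 H$, associative and unital, such that $\Delta(gh)=g_1h_1\otimes g_2h_2$, $\varepsilon(gh)=\varepsilon(g)\varepsilon(h)$ for $g\otimes h\in H\square_C H$, $\varepsilon(\eta(c))=\varepsilon(c)$, and: in the left case $gh_1\otimes\alpha(h_2)=g_1h\otimes\beta(g_2)$ and $\Delta(\eta(c))=\eta(c)_1\otimes\eta(\alpha(\eta(c)_2))=\eta(c)_1\otimes\eta(\beta(\eta(c)_2))$; in the right case $gh_2\otimes\beta(h_1)=g_2h\otimes\alpha(g_1)$ and $\Delta(\eta(c))=\eta(\alpha(\eta(c)_1))\otimes\eta(c)_2=\eta(\beta(\eta(c)_1))\otimes\eta(c)_2$. Let $H\square_{C_{\rm cop}}H$ be the cotensor product for the coactions $h\mapsto h_1\otimes\beta(h_2)$ and $h\mapsto\beta(h_1)\otimes h_2$. A left (right) $\times_C$-Hopf coalgebra is a left (right) bicoalgebroid for which $\nu:H\square_CH\to H\square_{C_{\rm cop}}H$, $\nu(k\otimes k')=kk'_1\otimes k'_2$ (respectively $\nu(b\otimes b')=b_1\otimes b_2b'$), is bijective; write $\nu^{-1}=\nu^-\otimes\nu^+$. **Modules.** A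 left module over a left bicoalgebroid $\mathcal K$ is a left $C$-comodule $M$ with an associative, unital, left $C$-colinear action $\mathcal K\square_CM\to M$, where $\mathcal K\square_C M$ has the coaction $\alpha(k_1)\otimes k_2\otimes m$. A right module over a right bicoalgebroid $\mathcal B$ is a right $C$-comodule $M$ with an associative, unital, right $C$-colinear action $M\square_C\mathcal B\to M$, where $M\square_C\mathcal B$ has the coaction $m\otimes b_1\otimes\alpha(b_2)$. Comodules over $\mathcal K$ or $\mathcal B$ are comodules over the underlying coalgebra. **SAYD modules.** A left-right SAYD module over a left $\times_C$-Hopf coalgebra $\mathcal K$ is a left module and right comodule $M$ over $\mathcal K$ such that * $m_{(0)}\otimes\alpha(m_{(1)})=\eta(m_{-1})_1\triangleright m_0\otimes\alpha(\eta(m_{-1})_2)$ and $\beta(m_{(1)})\otimes m_{(0)}=m_{-1}\otimes m_0$; * $(k\triangleright m)_{(0)}\otimes(k\triangleright m)_{(1)}=\nu^+(m_{(1)},k_1)\triangleright m_{(0)}\otimes k_2\,\nu^-(m_{(1)},k_1)$ for $k\otimes m\in\mathcal K\square_CM$; * $m_{(1)}\triangleright m_{(0)}=m$. A right-left SAYD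 module over a right $\times_C$-Hopf coalgebra $\mathcal B$ is a right module and left comodule $M$ over $\mathcal B$ such that * $\alpha(m_{(-1)})\otimes m_{(0)}=\alpha(\eta(m_1)_1)\otimes m_0\triangleleft\eta(m_1)_2$ and $m_{(0)}\otimes\beta(m_{(-1)})=m_0\otimes m_1$; * $(m\triangleleft b)_{(-1)}\otimes(m\triangleleft b)_{(0)}=\nu^+(b_2,m_{(-1)})\,b_1\otimes m_{(0)}\triangleleft\nu^-(b_2,m_{(-1)})$ for $m\otimes b\in M\square_C\mathcal B$; * $m_{(0)}\triangleleft m_{(-1)}=m$. **Coextensions.** Let $C$ be a coalgebra, $\mathcal B$ a right $\times_C$-Hopf coalgebra and $T$ a right $\mathcal B$-module coalgebra, that is, a coalgebra, right $\mathcal B$-module and $C$-bicomodule (with the right coaction of the module) such that $t_{1,0}\otimes t_{1,1}\otimes t_2=t_1\otimes t_{2,-1}\otimes t_{2,0}$, $\varepsilon(t\triangleleft b)=\varepsilon(t)\varepsilon(b)$ and $\Delta(t\triangleleft b)=t_1\triangleleft b_1\otimes t_2\triangleleft b_2$ for $t\otimes b\in T\square_C\mathcal B$. Let $S=T_{\mathcal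 B}=T/I$ with the coideal $I=\{t\triangleleft b-\varepsilon(b)t:\ t\otimes b\in T\square_C\mathcal B\}$, and $\pi:T\to S$ the quotient map. Let $\mathcal K$ be a left $\times_S$-Hopf coalgebra and $T$ a left $\mathcal K$-comodule coalgebra, that is, a left $\mathcal K$-comodule with $t_{(-1)}\varepsilon(t_{(0)})=\eta(\alpha(t_{(-1)}))\varepsilon(t_{(0)})$, $t_{(-1)}\otimes t_{(0)1}\otimes t_{(0)2}=t_{1(-1)}t_{2(-1)}\otimes t_{1(0)}\otimes t_{2(0)}$ and $\beta(t_{1(-1)})\otimes t_{1(0)}\otimes t_2=\alpha(t_{2(-1)})\otimes t_1\otimes t_{2(0)}$. Then $T$ is a *$\mathcal K$-equivariant $\mathcal B$-Galois coextension* ${}^{\mathcal K}T(S)_{\mathcal B}$ if * the $S$-bicomodule structure of $T$ induced by the $\mathcal K$-coaction is the one given by $\pi$: $\alpha(t_{(-1)})\otimes t_{(0)}=\pi(t_1)\otimes t_2$ and $t_{(0)}\otimes\beta(t_{(-1)})=t_1\otimes\pi(t_2)$; * ${\rm can}:T\square_C\mathcal B\to T\square_ST$, $t\otimes b\mapsto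 t_1\otimes t_2\triangleleft b$, is bijective; * $(t\triangleleft b)_{(-1)}\otimes(t\triangleleft b)_{(0)}=t_{(-1)}\otimes t_{(0)}\triangleleft b$ for $t\otimes b\in T\square_C\mathcal B$. Put $\kappa=(\varepsilon\otimes{\rm Id}_{\mathcal B})\circ{\rm can}^{-1}:T\square_ST\to\mathcal B$. **Theorem.** Let ${}^{\mathcal K}T(S)_{\mathcal B}$ be a $\mathcal K$-equivariant $\mathcal B$-Galois coextension and $M$ a left-right SAYD module over $\mathcal K$. Then $\widetilde M:=M\square_{\mathcal K}T$ is a right-left SAYD module over $\mathcal B$ with the right $C$-coaction $m\otimes t\mapsto m\otimes t_0\otimes t_1$, the action $$(m\otimes t)\triangleleft b=m\otimes(t\triangleleft b)\qquad\big((m\otimes t)\otimes b\in\widetilde M\square_C\mathcal B\big)$$ and the coaction $$m\otimes t\longmapsto\kappa\big((t_{2(0)})_2\otimes t_1\big)\otimes t_{2(-1)}\triangleright m\otimes(t_{2(0)})_1 ,$$ all these expressions being well defined and, for the action and the coaction, with values in $\widetilde M$ and $\mathcal B\otimes\widetilde M$. -/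

import Mathlib

open scoped TensorProduct

namespace CrossHopf

open Coalgebra

/-! ### Partially defined operations on tensor products -/

section Partial

variable {V W : Type*} [AddCommGroup V] [Module ℂ V] [AddCommGroup W] [Module ℂ W]

/-- `x` lies in the domain `p` of `f`, and `f x = y`. -/
def App {p : Submodule ℂ V} (f : p →ₗ[ℂ] W) (x : V) (y : W) : Prop :=
  ∃ h : x ∈ p, f ⟨x, h⟩ = y

variable {A : Type*} [AddCommGroup A] [Module ℂ A]

/-- `x ∈ V ⊗ A` lies in the subspace `p ⊗ A`, and `(f ⊗ id_A) x = y`. Here `p ⊗ A → V ⊗ A` is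
injective since all objects are vector spaces, so `y` is determined by `x`. -/
def AppL {p : Submodule ℂ V} (f : p →ₗ[ℂ] W) (x : V ⊗[ℂ] A) (y : W ⊗[ℂ] A) : Prop :=
  ∃ z : p ⊗[ℂ] A, p.subtype.rTensor A z = x ∧ f.rTensor A z = y

/-- `x ∈ A ⊗ V` lies in the subspace `A ⊗ p`, and `(id_A ⊗ f) x = y`. -/
def AppR {p : Submodule ℂ V} (f : p →ₗ[ℂ] W) (x : A ⊗[ℂ] V) (y : A ⊗[ℂ] W) : Prop :=
  ∃ z : A ⊗[ℂ] p, p.subtype.lTensor A z = x ∧ f.lTensor A z = y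

end Partial

section Shuffles

variable {V₁ V₂ V₃ V₄ : Type*}
  [AddCommGroup V₁] [Module ℂ V₁] [AddCommGroup V₂] [Module ℂ V₂]
  [AddCommGroup V₃] [Module ℂ V₃] [AddCommGroup V₄] [Module ℂ V₄]

/-- `(a ⊗ b) ⊗ (c ⊗ d) ↦ (b ⊗ c) ⊗ (d ⊗ a)`. -/
noncomputable def cyc :
    (V₁ ⊗[ℂ] V₂) ⊗[ℂ] (V₃ ⊗[ℂ] V₄) →ₗ[ℂ] (V₂ ⊗[ℂ] V₃) ⊗[ℂ] (V₄ ⊗[ℂ] V₁) :=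
  (TensorProduct.comm ℂ V₁ V₄).toLinearMap.lTensor (V₂ ⊗[ℂ] V₃)
    ∘ₗ (TensorProduct.tensorTensorTensorComm ℂ V₂ V₁ V₃ V₄).toLinearMap
    ∘ₗ (TensorProduct.comm ℂ V₁ V₂).toLinearMap.rTensor (V₃ ⊗[ℂ] V₄)

theorem cyc_tmul (a : V₁) (b : V₂) (c : V₃) (d : V₄) :
    cyc ((a ⊗ₜ[ℂ] b) ⊗ₜ[ℂ] (c ⊗ₜ[ℂ] d)) = (b ⊗ₜ[ℂ] c) ⊗ₜ[ℂ] (d ⊗ₜ[ℂ] a) := rfl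

/-- `(a ⊗ b) ⊗ (c ⊗ d) ↦ (d ⊗ b) ⊗ (a ⊗ c)`. -/
noncomputable def shuf :
    (V₁ ⊗[ℂ] V₂) ⊗[ℂ] (V₃ ⊗[ℂ] V₄) →ₗ[ℂ] (V₄ ⊗[ℂ] V₂) ⊗[ℂ] (V₁ ⊗[ℂ] V₃) :=
  (TensorProduct.comm ℂ V₂ V₄).toLinearMap.rTensor (V₁ ⊗[ℂ] V₃)
    ∘ₗ (TensorProduct.comm ℂ (V₁ ⊗[ℂ] V₃) (V₂ ⊗[ℂ] V₄)).toLinearMap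
    ∘ₗ (TensorProduct.tensorTensorTensorComm ℂ V₁ V₂ V₃ V₄).toLinearMap

theorem shuf_tmul (a : V₁) (b : V₂) (c : V₃) (d : V₄) :
    shuf ((a ⊗ₜ[ℂ] b) ⊗ₜ[ℂ] (c ⊗ₜ[ℂ] d)) = (d ⊗ₜ[ℂ] b) ⊗ₜ[ℂ] (a ⊗ₜ[ℂ] c) := rfl

end Shuffles

/-! ### Comodules over coalgebras and cotensor products -/

/-- Right comodules over a coalgebra. -/
structure RightComodule (C M : Type*) [AddCommGroup C] [Module ℂ C] [Coalgebra ℂ C]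
    [AddCommGroup M] [Module ℂ M] where
  coact : M →ₗ[ℂ] M ⊗[ℂ] C
  coassoc : ∀ m, TensorProduct.assoc ℂ M C C (coact.rTensor C (coact m)) =
    (comul (R := ℂ) (A := C)).lTensor M (coact m)
  counit_coact : ∀ m, TensorProduct.rid ℂ M ((counit (R := ℂ) (A := C)).lTensor M (coact m)) = m

/-- Left comodules over a coalgebra. -/
structure LeftComodule (C M : Type*) [AddCommGroup C] [Module ℂ C] [Coalgebra ℂ C]
    [AddCommGroup M] [Module ℂ M] where
  coact : M →ₗ[ℂ] C ⊗[ℂ] M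
  coassoc : ∀ m, TensorProduct.assoc ℂ C C M ((comul (R := ℂ) (A := C)).rTensor M (coact m)) =
    coact.lTensor C (coact m)
  counit_coact : ∀ m, TensorProduct.lid ℂ M ((counit (R := ℂ) (A := C)).rTensor M (coact m)) = m

/-- The cotensor product `X □_C Y ⊆ X ⊗ Y` of a right coaction `ρ` and a left coaction `l`. -/
noncomputable def cotensor {X C Y : Type*} [AddCommGroup X] [Module ℂ X] [AddCommGroup C]
    [Module ℂ C] [AddCommGroup Y] [Module ℂ Y]
    (ρ : X →ₗ[ℂ] X ⊗[ℂ] C) (l : Y →ₗ[ℂ] C ⊗[ℂ] Y) : Submodule ℂ (X ⊗[ℂ] Y) :=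
  LinearMap.eqLocus ((TensorProduct.assoc ℂ X C Y).toLinearMap ∘ₗ ρ.rTensor Y) (l.lTensor X)

/-! ### Bicoalgebroids and `×`-Hopf coalgebras -/

section Bicoalgebroids

variable (H C : Type*) [AddCommGroup H] [Module ℂ H] [Coalgebra ℂ H]
  [AddCommGroup C] [Module ℂ C] [Coalgebra ℂ C]

/-- Coalgebra maps `α : H → C` and `β : H → C_cop` whose images cocommute. -/
structure SourceTarget where
  α : H →ₗc[ℂ] C
  β : H →ₗ[ℂ] C
  comul_β : ∀ h, comul (R := ℂ) (β h) =
    TensorProduct.map β β (TensorProduct.comm ℂ H H (comul (R := ℂ) h))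
  counit_β : ∀ h, counit (R := ℂ) (β h) = counit (R := ℂ) h
  cocomm : ∀ h, TensorProduct.map α.toLinearMap β (comul (R := ℂ) h) =
    TensorProduct.map α.toLinearMap β (TensorProduct.comm ℂ H H (comul (R := ℂ) h))

variable {H C}

namespace SourceTarget

variable (s : SourceTarget H C)

/-- `h ↦ α(h₁) ⊗ h₂`, the left `C`-coaction on a left bicoalgebroid. -/
noncomputable def leftL : H →ₗ[ℂ] C ⊗[ℂ] H :=
  s.α.toLinearMap.rTensor H ∘ₗ comul (R := ℂ)

/-- `h ↦ h₂ ⊗ β(h₁)`, the right `C`-coaction on a left bicoalgebroid. -/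
noncomputable def rightL : H →ₗ[ℂ] H ⊗[ℂ] C :=
  s.β.lTensor H ∘ₗ (TensorProduct.comm ℂ H H).toLinearMap ∘ₗ comul (R := ℂ)

/-- `h ↦ β(h₂) ⊗ h₁`, the left `C`-coaction on a right bicoalgebroid. -/
noncomputable def leftR : H →ₗ[ℂ] C ⊗[ℂ] H :=
  s.β.rTensor H ∘ₗ (TensorProduct.comm ℂ H H).toLinearMap ∘ₗ comul (R := ℂ)

/-- `h ↦ h₁ ⊗ α(h₂)`, the right `C`-coaction on a right bicoalgebroid. -/
noncomputable def rightR : H →ₗ[ℂ] H ⊗[ℂ] C :=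
  s.α.toLinearMap.lTensor H ∘ₗ comul (R := ℂ)

/-- `h ↦ β(h₁) ⊗ h₂`, the left `C_cop`-coaction. -/
noncomputable def leftCop : H →ₗ[ℂ] C ⊗[ℂ] H :=
  s.β.rTensor H ∘ₗ comul (R := ℂ)

/-- `h ↦ h₁ ⊗ β(h₂)`, the right `C_cop`-coaction. -/
noncomputable def rightCop : H →ₗ[ℂ] H ⊗[ℂ] C :=
  s.β.lTensor H ∘ₗ comul (R := ℂ)

end SourceTarget

variable (H C)

/-- Left bicoalgebroids over `C`. -/
structure LeftBicoalgebroid extends SourceTarget H C where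
  mul : cotensor toSourceTarget.rightL toSourceTarget.leftL →ₗ[ℂ] H
  unit : C →ₗ[ℂ] H
  /-- multiplication and unit are `C`-bicomodule maps -/
  mul_left : ∀ x : cotensor toSourceTarget.rightL toSourceTarget.leftL,
    AppR mul (TensorProduct.assoc ℂ C H H (toSourceTarget.leftL.rTensor H x.1))
      (toSourceTarget.leftL (mul x))
  mul_right : ∀ x : cotensor toSourceTarget.rightL toSourceTarget.leftL,
    AppL mul ((TensorProduct.assoc ℂ H H C).symm (toSourceTarget.rightL.lTensor H x.1))
      (toSourceTarget.rightL (mul x))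
  unit_left : ∀ c, toSourceTarget.leftL (unit c) = unit.lTensor C (comul (R := ℂ) c)
  unit_right : ∀ c, toSourceTarget.rightL (unit c) = unit.rTensor C (comul (R := ℂ) c)
  /-- associativity on `H □_C H □_C H` -/
  mul_assoc : ∀ (u : cotensor toSourceTarget.rightL toSourceTarget.leftL ⊗[ℂ] H)
    (v : H ⊗[ℂ] cotensor toSourceTarget.rightL toSourceTarget.leftL),
    TensorProduct.assoc ℂ H H H ((Submodule.subtype _).rTensor H u) =
      (Submodule.subtype _).lTensor H v →
    ∃ y, App mul (mul.rTensor H u) y ∧ App mul (mul.lTensor H v) y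
  /-- unitality -/
  unit_mul : ∀ h, App mul (unit.rTensor H (toSourceTarget.leftL h)) h
  mul_unit : ∀ h, App mul (unit.lTensor H (toSourceTarget.rightL h)) h
  /-- `g h₁ ⊗ α(h₂) = g₁ h ⊗ β(g₂)` -/
  takeuchi : ∀ x : cotensor toSourceTarget.rightL toSourceTarget.leftL, ∃ y y' : H ⊗[ℂ] H,
    AppL mul ((TensorProduct.assoc ℂ H H H).symm ((comul (R := ℂ)).lTensor H x.1)) y ∧
    AppL mul (TensorProduct.rightComm ℂ H H H ((comul (R := ℂ)).rTensor H x.1)) y' ∧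
    α.toLinearMap.lTensor H y = β.lTensor H y'
  /-- `Δ(g h) = g₁ h₁ ⊗ g₂ h₂` -/
  comul_mul : ∀ x : cotensor toSourceTarget.rightL toSourceTarget.leftL,
    ∃ y : H ⊗[ℂ] (H ⊗[ℂ] H),
    AppL mul (TensorProduct.tensorTensorTensorComm ℂ H H H H
      (TensorProduct.map (comul (R := ℂ)) (comul (R := ℂ)) x.1)) y ∧
    AppR mul y (comul (R := ℂ) (mul x))
  counit_mul : ∀ x : cotensor toSourceTarget.rightL toSourceTarget.leftL,
    counit (R := ℂ) (mul x) =
      TensorProduct.lid ℂ ℂ (TensorProduct.map (counit (R := ℂ)) (counit (R := ℂ)) x.1)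
  /-- `Δ(η c) = η(c)₁ ⊗ η(α(η(c)₂)) = η(c)₁ ⊗ η(β(η(c)₂))` -/
  comul_unit_α : ∀ c, comul (R := ℂ) (unit c) =
    (unit ∘ₗ α.toLinearMap).lTensor H (comul (R := ℂ) (unit c))
  comul_unit_β : ∀ c, comul (R := ℂ) (unit c) = (unit ∘ₗ β).lTensor H (comul (R := ℂ) (unit c))
  counit_unit : ∀ c, counit (R := ℂ) (unit c) = counit (R := ℂ) c

/-- Left `×_C`-Hopf coalgebras: the map `k ⊗ k' ↦ k k'₁ ⊗ k'₂` is a well-defined bijection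
from `H □_C H` onto `H □_{C_cop} H`. -/
structure LeftHopfCoalgebra extends LeftBicoalgebroid H C where
  nu : cotensor toSourceTarget.rightL toSourceTarget.leftL ≃ₗ[ℂ]
    cotensor toSourceTarget.rightCop toSourceTarget.leftCop
  nu_spec : ∀ x : cotensor toSourceTarget.rightL toSourceTarget.leftL,
    AppL mul ((TensorProduct.assoc ℂ H H H).symm ((comul (R := ℂ)).lTensor H x.1)) (nu x).1

/-- Right bicoalgebroids over `C`. -/
structure RightBicoalgebroid extends SourceTarget H C where
  mul : cotensor toSourceTarget.rightR toSourceTarget.leftR →ₗ[ℂ] H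
  unit : C →ₗ[ℂ] H
  /-- multiplication and unit are `C`-bicomodule maps -/
  mul_left : ∀ x : cotensor toSourceTarget.rightR toSourceTarget.leftR,
    AppR mul (TensorProduct.assoc ℂ C H H (toSourceTarget.leftR.rTensor H x.1))
      (toSourceTarget.leftR (mul x))
  mul_right : ∀ x : cotensor toSourceTarget.rightR toSourceTarget.leftR,
    AppL mul ((TensorProduct.assoc ℂ H H C).symm (toSourceTarget.rightR.lTensor H x.1))
      (toSourceTarget.rightR (mul x))
  unit_left : ∀ c, toSourceTarget.leftR (unit c) = unit.lTensor C (comul (R := ℂ) c)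
  unit_right : ∀ c, toSourceTarget.rightR (unit c) = unit.rTensor C (comul (R := ℂ) c)
  /-- associativity on `H □_C H □_C H` -/
  mul_assoc : ∀ (u : cotensor toSourceTarget.rightR toSourceTarget.leftR ⊗[ℂ] H)
    (v : H ⊗[ℂ] cotensor toSourceTarget.rightR toSourceTarget.leftR),
    TensorProduct.assoc ℂ H H H ((Submodule.subtype _).rTensor H u) =
      (Submodule.subtype _).lTensor H v →
    ∃ y, App mul (mul.rTensor H u) y ∧ App mul (mul.lTensor H v) y
  /-- unitality -/
  unit_mul : ∀ h, App mul (unit.rTensor H (toSourceTarget.leftR h)) h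
  mul_unit : ∀ h, App mul (unit.lTensor H (toSourceTarget.rightR h)) h
  /-- `b b'₂ ⊗ β(b'₁) = b₂ b' ⊗ α(b₁)` -/
  takeuchi : ∀ x : cotensor toSourceTarget.rightR toSourceTarget.leftR, ∃ y y' : H ⊗[ℂ] H,
    AppL mul ((TensorProduct.assoc ℂ H H H).symm (((TensorProduct.comm ℂ H H).toLinearMap ∘ₗ
      comul (R := ℂ)).lTensor H x.1)) y ∧
    AppL mul (TensorProduct.rightComm ℂ H H H (((TensorProduct.comm ℂ H H).toLinearMap ∘ₗ
      comul (R := ℂ)).rTensor H x.1)) y' ∧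
    β.lTensor H y = α.toLinearMap.lTensor H y'
  /-- `Δ(b b') = b₁ b'₁ ⊗ b₂ b'₂` -/
  comul_mul : ∀ x : cotensor toSourceTarget.rightR toSourceTarget.leftR,
    ∃ y : (H ⊗[ℂ] H) ⊗[ℂ] H,
    AppR mul (TensorProduct.tensorTensorTensorComm ℂ H H H H
      (TensorProduct.map (comul (R := ℂ)) (comul (R := ℂ)) x.1)) y ∧
    AppL mul y (comul (R := ℂ) (mul x))
  counit_mul : ∀ x : cotensor toSourceTarget.rightR toSourceTarget.leftR,
    counit (R := ℂ) (mul x) =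
      TensorProduct.lid ℂ ℂ (TensorProduct.map (counit (R := ℂ)) (counit (R := ℂ)) x.1)
  /-- `Δ(η c) = η(α(η(c)₁)) ⊗ η(c)₂ = η(β(η(c)₁)) ⊗ η(c)₂` -/
  comul_unit_α : ∀ c, comul (R := ℂ) (unit c) =
    (unit ∘ₗ α.toLinearMap).rTensor H (comul (R := ℂ) (unit c))
  comul_unit_β : ∀ c, comul (R := ℂ) (unit c) = (unit ∘ₗ β).rTensor H (comul (R := ℂ) (unit c))
  counit_unit : ∀ c, counit (R := ℂ) (unit c) = counit (R := ℂ) c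

/-- Right `×_C`-Hopf coalgebras: the map `b ⊗ b' ↦ b₁ ⊗ b₂ b'` is a well-defined bijection
from `H □_C H` onto `H □_{C_cop} H`. -/
structure RightHopfCoalgebra extends RightBicoalgebroid H C where
  nu : cotensor toSourceTarget.rightR toSourceTarget.leftR ≃ₗ[ℂ]
    cotensor toSourceTarget.rightCop toSourceTarget.leftCop
  nu_spec : ∀ x : cotensor toSourceTarget.rightR toSourceTarget.leftR,
    AppR mul (TensorProduct.assoc ℂ H H H ((comul (R := ℂ)).rTensor H x.1)) (nu x).1

variable {H C}

/-- `ν⁻¹(k ⊗ k') = ν⁻(k,k') ⊗ ν⁺(k,k')` as an element of `H ⊗ H`. -/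
noncomputable def LeftHopfCoalgebra.nuInv (𝓚 : LeftHopfCoalgebra H C) :
    cotensor 𝓚.rightCop 𝓚.leftCop →ₗ[ℂ] H ⊗[ℂ] H :=
  Submodule.subtype _ ∘ₗ 𝓚.nu.symm.toLinearMap

/-- `ν⁻¹(b ⊗ b') = ν⁻(b,b') ⊗ ν⁺(b,b')` as an element of `H ⊗ H`. -/
noncomputable def RightHopfCoalgebra.nuInv (𝓑 : RightHopfCoalgebra H C) :
    cotensor 𝓑.rightCop 𝓑.leftCop →ₗ[ℂ] H ⊗[ℂ] H :=
  Submodule.subtype _ ∘ₗ 𝓑.nu.symm.toLinearMap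

end Bicoalgebroids

/-! ### Modules and stable anti-Yetter-Drinfeld modules -/

section Modules

variable {H C : Type*} [AddCommGroup H] [Module ℂ H] [Coalgebra ℂ H]
  [AddCommGroup C] [Module ℂ C] [Coalgebra ℂ C]

/-- Left modules over a left bicoalgebroid: a left `C`-comodule with an associative unital action
`H □_C M → M` that is left `C`-colinear. -/
structure LeftModule (𝓚 : LeftBicoalgebroid H C) (M : Type*) [AddCommGroup M] [Module ℂ M]
    extends LeftComodule C M where
  act : cotensor 𝓚.rightL coact →ₗ[ℂ] M
  act_left : ∀ x : cotensor 𝓚.rightL coact,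
    AppR act (TensorProduct.assoc ℂ C H M (𝓚.leftL.rTensor M x.1)) (coact (act x))
  act_assoc : ∀ (u : cotensor 𝓚.rightL 𝓚.leftL ⊗[ℂ] M) (v : H ⊗[ℂ] cotensor 𝓚.rightL coact),
    TensorProduct.assoc ℂ H H M ((Submodule.subtype _).rTensor M u) =
      (Submodule.subtype _).lTensor H v →
    ∃ y, App act (𝓚.mul.rTensor M u) y ∧ App act (act.lTensor H v) y
  unit_act : ∀ m, App act (𝓚.unit.rTensor M (coact m)) m

/-- Right modules over a right bicoalgebroid: a right `C`-comodule with an associative unital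
action `M □_C H → M` that is right `C`-colinear. -/
structure RightModule (𝓑 : RightBicoalgebroid H C) (M : Type*) [AddCommGroup M] [Module ℂ M]
    extends RightComodule C M where
  act : cotensor coact 𝓑.leftR →ₗ[ℂ] M
  act_right : ∀ x : cotensor coact 𝓑.leftR,
    AppL act ((TensorProduct.assoc ℂ M H C).symm (𝓑.rightR.lTensor M x.1)) (coact (act x))
  act_assoc : ∀ (u : cotensor coact 𝓑.leftR ⊗[ℂ] H) (v : M ⊗[ℂ] cotensor 𝓑.rightR 𝓑.leftR),
    TensorProduct.assoc ℂ M H H ((Submodule.subtype _).rTensor H u) =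
      (Submodule.subtype _).lTensor M v →
    ∃ y, App act (act.rTensor H u) y ∧ App act (𝓑.mul.lTensor M v) y
  act_unit : ∀ m, App act (𝓑.unit.lTensor M (coact m)) m

/-- Left-right stable anti-Yetter-Drinfeld modules over a left `×_C`-Hopf coalgebra. -/
structure LeftRightSAYD (𝓚 : LeftHopfCoalgebra H C) (M : Type*) [AddCommGroup M] [Module ℂ M] where
  module : LeftModule 𝓚.toLeftBicoalgebroid M
  comodule : RightComodule H M
  /-- The two `C`-bicomodule structures agree. On the right, `m₍₀₎ ⊗ α(m₍₁₎)` equals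
  `η(m₋₁)₁ ▷ m₀ ⊗ α(η(m₋₁)₂)`, the subscripts `-1, 0` referring to the left `C`-coaction. -/
  right_coact : ∀ m, AppL module.act
    (TensorProduct.rightComm ℂ H C M
      ((𝓚.α.toLinearMap.lTensor H ∘ₗ comul (R := ℂ) ∘ₗ 𝓚.unit).rTensor M (module.coact m)))
    (𝓚.α.toLinearMap.lTensor M (comodule.coact m))
  /-- On the left, the `C`-coaction of the module `M` is `β(m₍₁₎) ⊗ m₍₀₎`; only then is the right
  side of `ayd` defined. -/
  left_coact : ∀ m, module.coact m =
    TensorProduct.comm ℂ M C (𝓚.β.lTensor M (comodule.coact m))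
  /-- `(k ▷ m)₍₀₎ ⊗ (k ▷ m)₍₁₎ = ν⁺(m₍₁₎, k₁) ▷ m₍₀₎ ⊗ k₂ ν⁻(m₍₁₎, k₁)` -/
  ayd : ∀ x : cotensor 𝓚.rightL module.coact,
    ∃ (y : (H ⊗[ℂ] M) ⊗[ℂ] (H ⊗[ℂ] H)) (z : M ⊗[ℂ] (H ⊗[ℂ] H)),
    AppR 𝓚.nuInv (cyc (TensorProduct.map (comul (R := ℂ)) comodule.coact x.1)) y ∧
    AppL module.act (shuf y) z ∧
    AppR 𝓚.mul z (comodule.coact (module.act x))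
  /-- `m₍₁₎ ▷ m₍₀₎ = m` -/
  stable : ∀ m, App module.act (TensorProduct.comm ℂ M H (comodule.coact m)) m

/-- Right-left stable anti-Yetter-Drinfeld modules over a right `×_C`-Hopf coalgebra. -/
structure RightLeftSAYD (𝓑 : RightHopfCoalgebra H C) (M : Type*) [AddCommGroup M] [Module ℂ M] where
  module : RightModule 𝓑.toRightBicoalgebroid M
  comodule : LeftComodule H M
  /-- The two `C`-bicomodule structures agree. On the left, `α(m₍₋₁₎) ⊗ m₍₀₎` equals
  `α(η(m₁)₁) ⊗ m₀ ◁ η(m₁)₂`, the subscripts `0, 1` referring to the right `C`-coaction. -/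
  left_coact : ∀ m, AppR module.act
    (TensorProduct.leftComm ℂ M C H
      ((𝓑.α.toLinearMap.rTensor H ∘ₗ comul (R := ℂ) ∘ₗ 𝓑.unit).lTensor M (module.coact m)))
    (𝓑.α.toLinearMap.rTensor M (comodule.coact m))
  /-- On the right, the `C`-coaction of the module `M` is `m₍₀₎ ⊗ β(m₍₋₁₎)`. -/
  right_coact : ∀ m, module.coact m =
    TensorProduct.comm ℂ C M (𝓑.β.rTensor M (comodule.coact m))
  /-- `(m ◁ b)₍₋₁₎ ⊗ (m ◁ b)₍₀₎ = ν⁺(b₂, m₍₋₁₎) b₁ ⊗ m₍₀₎ ◁ ν⁻(b₂, m₍₋₁₎)` -/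
  ayd : ∀ x : cotensor module.coact 𝓑.leftR,
    ∃ (y : (M ⊗[ℂ] H) ⊗[ℂ] (H ⊗[ℂ] H)) (z : (H ⊗[ℂ] H) ⊗[ℂ] M),
    AppR 𝓑.nuInv (cyc (TensorProduct.map comodule.coact (comul (R := ℂ)) x.1)) y ∧
    AppR module.act (shuf y) z ∧
    AppL 𝓑.mul z (comodule.coact (module.act x))
  /-- `m₍₀₎ ◁ m₍₋₁₎ = m` -/
  stable : ∀ m, App module.act (TensorProduct.comm ℂ H M (comodule.coact m)) m

end Modules

/-! ### Module coalgebras, comodule coalgebras and equivariant Galois coextensions -/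

section CounitAux

variable {B T : Type*} [AddCommGroup B] [Module ℂ B] [Coalgebra ℂ B] [AddCommGroup T] [Module ℂ T]

/-- `t ⊗ b ↦ ε(b) t`. -/
noncomputable def epsR (T B : Type*) [AddCommGroup B] [Module ℂ B] [Coalgebra ℂ B]
    [AddCommGroup T] [Module ℂ T] : T ⊗[ℂ] B →ₗ[ℂ] T :=
  (TensorProduct.rid ℂ T).toLinearMap ∘ₗ (counit (R := ℂ) (A := B)).lTensor T

theorem epsR_tmul (t : T) (b : B) : epsR T B (t ⊗ₜ[ℂ] b) = counit (R := ℂ) b • t := by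
  simp [epsR]

theorem lid_counit_comul (b : B) :
    TensorProduct.lid ℂ ℂ (TensorProduct.map (counit (R := ℂ)) (counit (R := ℂ))
      (comul (R := ℂ) b)) = counit (R := ℂ) b := by
  have h : TensorProduct.map (counit (R := ℂ) (A := B)) (counit (R := ℂ) (A := B)) =
      (counit (R := ℂ) (A := B)).lTensor ℂ ∘ₗ (counit (R := ℂ) (A := B)).rTensor B :=
    (LinearMap.lTensor_comp_rTensor _ _ _).symm
  rw [h, LinearMap.comp_apply, rTensor_counit_comul, LinearMap.lTensor_tmul,
    TensorProduct.lid_tmul, one_smul]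

theorem map_epsR_tmul (q : B ⊗[ℂ] B) (p : T ⊗[ℂ] T) :
    TensorProduct.map (epsR T B) (epsR T B)
      (TensorProduct.tensorTensorTensorComm ℂ T T B B (p ⊗ₜ[ℂ] q)) =
    TensorProduct.lid ℂ ℂ (TensorProduct.map (counit (R := ℂ)) (counit (R := ℂ)) q) • p := by
  induction q with
  | zero => simp
  | add q q' h h' => rw [TensorProduct.tmul_add, map_add, map_add, h, h', map_add, map_add, add_smul]
  | tmul b b' =>
    induction p with
    | zero => simp
    | add p p' h h' => rw [TensorProduct.add_tmul, map_add, map_add, h, h', smul_add]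
    | tmul t t' =>
      simp [epsR_tmul, ← TensorProduct.smul_tmul', TensorProduct.tmul_smul, smul_smul, mul_comm]

variable [Coalgebra ℂ T]

theorem map_epsR_comul (w : T ⊗[ℂ] B) :
    TensorProduct.map (epsR T B) (epsR T B) (TensorProduct.tensorTensorTensorComm ℂ T T B B
      (TensorProduct.map (comul (R := ℂ)) (comul (R := ℂ)) w)) =
    comul (R := ℂ) (epsR T B w) := by
  induction w with
  | zero => simp
  | add w w' h h' => simp only [map_add, h, h']
  | tmul t b => rw [TensorProduct.map_tmul, map_epsR_tmul, lid_counit_comul, epsR_tmul, map_smul]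

theorem counit_epsR (w : T ⊗[ℂ] B) : counit (R := ℂ) (epsR T B w) =
    TensorProduct.lid ℂ ℂ (TensorProduct.map (counit (R := ℂ)) (counit (R := ℂ)) w) := by
  induction w with
  | zero => simp
  | add w w' h h' => simp only [map_add, h, h']
  | tmul t b => simp [epsR_tmul, mul_comm]

end CounitAux

section Coextensions

variable {B C T : Type*} [AddCommGroup B] [Module ℂ B] [Coalgebra ℂ B]
  [AddCommGroup C] [Module ℂ C] [Coalgebra ℂ C] [AddCommGroup T] [Module ℂ T] [Coalgebra ℂ T]

/-- Right module coalgebras `T` over a right bicoalgebroid: `T` is a coalgebra, a right module and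
a `C`-bicomodule (the right coaction being the one of the module), such that the comultiplication
is `C`-cobalanced, `ε(t ◁ b) = ε(t) ε(b)` and `Δ(t ◁ b) = t₁ ◁ b₁ ⊗ t₂ ◁ b₂`, where the last
equation includes the assertion that its right side is defined. -/
structure RightModuleCoalgebra (𝓑 : RightBicoalgebroid B C) (T : Type*) [AddCommGroup T]
    [Module ℂ T] [Coalgebra ℂ T] extends RightModule 𝓑 T where
  leftComodule : LeftComodule C T
  bicomodule : ∀ t, TensorProduct.assoc ℂ C T C (leftComodule.coact.rTensor C (coact t)) =
    coact.lTensor C (leftComodule.coact t)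
  cobalanced : ∀ t : T, comul (R := ℂ) t ∈ cotensor coact leftComodule.coact
  counit_act : ∀ x : cotensor coact 𝓑.leftR, counit (R := ℂ) (act x) =
    TensorProduct.lid ℂ ℂ (TensorProduct.map (counit (R := ℂ)) (counit (R := ℂ)) x.1)
  comul_act : ∀ x : cotensor coact 𝓑.leftR, ∃ y : (T ⊗[ℂ] B) ⊗[ℂ] T,
    AppR act (TensorProduct.tensorTensorTensorComm ℂ T T B B
      (TensorProduct.map (comul (R := ℂ)) (comul (R := ℂ)) x.1)) y ∧
    AppL act y (comul (R := ℂ) (act x))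

namespace RightModuleCoalgebra

variable {𝓑 : RightBicoalgebroid B C} (X : RightModuleCoalgebra 𝓑 T)

/-- The subspace `I = {t ◁ b - ε(b) t}` of `T`. -/
noncomputable def augIdeal : Submodule ℂ T :=
  LinearMap.range (X.act - epsR T B ∘ₗ Submodule.subtype _)

theorem mkQ_comp_act : X.augIdeal.mkQ ∘ₗ X.act =
    (X.augIdeal.mkQ ∘ₗ epsR T B) ∘ₗ Submodule.subtype _ := by
  ext x
  rw [← sub_eq_zero, LinearMap.comp_apply, LinearMap.comp_apply, LinearMap.comp_apply, ← map_sub,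
    Submodule.mkQ_apply, Submodule.Quotient.mk_eq_zero]
  exact ⟨x, rfl⟩

/-- `I` is a coideal, so that `T ⧸ I` is a coalgebra. -/
instance isCoideal_augIdeal : X.augIdeal.IsCoideal where
  counit_eq_zero := by
    rintro _ ⟨x, rfl⟩
    rw [LinearMap.sub_apply, map_sub, X.counit_act, sub_eq_zero]
    exact (counit_epsR x.1).symm
  map_mkQ_comul_eq_zero := by
    rintro _ ⟨x, rfl⟩
    obtain ⟨y, ⟨z, hz, hzy⟩, ⟨z', hz', hzy'⟩⟩ := X.comul_act x
    rw [LinearMap.sub_apply, map_sub, map_sub, sub_eq_zero, LinearMap.comp_apply,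
      Submodule.subtype_apply, ← map_epsR_comul x.1, ← hz, ← hzy', LinearMap.map_rTensor,
      mkQ_comp_act, ← LinearMap.map_rTensor, hz', ← hzy, LinearMap.map_lTensor, mkQ_comp_act,
      ← LinearMap.map_lTensor, TensorProduct.map_comp, LinearMap.comp_apply]

/-- The coalgebra `T_B = T ⧸ I`. -/
abbrev Quot : Type _ := T ⧸ X.augIdeal

/-- `t ↦ π(t₁) ⊗ t₂`, where `π : T → T ⧸ I` is the quotient map. -/
noncomputable def quotLeft : T →ₗ[ℂ] X.Quot ⊗[ℂ] T :=
  X.augIdeal.mkQ.rTensor T ∘ₗ comul (R := ℂ)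

/-- `t ↦ t₁ ⊗ π(t₂)`. -/
noncomputable def quotRight : T →ₗ[ℂ] T ⊗[ℂ] X.Quot :=
  X.augIdeal.mkQ.lTensor T ∘ₗ comul (R := ℂ)

end RightModuleCoalgebra

/-- Left comodule coalgebras over a left bicoalgebroid. -/
structure LeftComoduleCoalgebra {K S : Type*} [AddCommGroup K] [Module ℂ K] [Coalgebra ℂ K]
    [AddCommGroup S] [Module ℂ S] [Coalgebra ℂ S] (𝓚 : LeftBicoalgebroid K S) (T : Type*)
    [AddCommGroup T] [Module ℂ T] [Coalgebra ℂ T] extends LeftComodule K T where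
  /-- `t₍₋₁₎ ε(t₍₀₎) = η(α(t₍₋₁₎)) ε(t₍₀₎)` -/
  counit_coact' : ∀ t, epsR K T (coact t) = 𝓚.unit (𝓚.α (epsR K T (coact t)))
  /-- `t₍₋₁₎ ⊗ t₍₀₎₁ ⊗ t₍₀₎₂ = t₁₍₋₁₎ t₂₍₋₁₎ ⊗ t₁₍₀₎ ⊗ t₂₍₀₎` -/
  comul_coact : ∀ t, AppL 𝓚.mul
    (TensorProduct.tensorTensorTensorComm ℂ K T K T
      (TensorProduct.map coact coact (comul (R := ℂ) t)))
    ((comul (R := ℂ) (A := T)).lTensor K (coact t))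
  /-- `β(t₁₍₋₁₎) ⊗ t₁₍₀₎ ⊗ t₂ = α(t₂₍₋₁₎) ⊗ t₁ ⊗ t₂₍₀₎` -/
  cobalanced : ∀ t : T,
    TensorProduct.assoc ℂ S T T ((𝓚.β.rTensor T ∘ₗ coact).rTensor T (comul (R := ℂ) t)) =
    TensorProduct.leftComm ℂ T S T
      ((𝓚.α.toLinearMap.rTensor T ∘ₗ coact).lTensor T (comul (R := ℂ) t))

/-- `K`-equivariant `B`-Galois coextensions `T` of `S = T ⧸ I`. -/
structure EquivariantGalois (𝓑 : RightHopfCoalgebra B C)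
    (X : RightModuleCoalgebra 𝓑.toRightBicoalgebroid T)
    {K : Type*} [AddCommGroup K] [Module ℂ K] [Coalgebra ℂ K] (𝓚 : LeftHopfCoalgebra K X.Quot)
    (Y : LeftComoduleCoalgebra 𝓚.toLeftBicoalgebroid T) where
  /-- The `S`-bicomodule structure `α(t₍₋₁₎) ⊗ t₍₀₎`, `t₍₀₎ ⊗ β(t₍₋₁₎)` that `T` has as a
  `K`-comodule is the one given by the quotient map `π : T → S`. -/
  left_coact : ∀ t, 𝓚.α.toLinearMap.rTensor T (Y.coact t) = X.quotLeft t
  right_coact : ∀ t, TensorProduct.comm ℂ X.Quot T (𝓚.β.rTensor T (Y.coact t)) = X.quotRight t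
  /-- `(t ◁ b)₍₋₁₎ ⊗ (t ◁ b)₍₀₎ = t₍₋₁₎ ⊗ t₍₀₎ ◁ b`, where the right side is defined -/
  equivariant : ∀ x : cotensor X.coact 𝓑.leftR,
    AppR X.act (TensorProduct.assoc ℂ K T B (Y.coact.rTensor B x.1)) (Y.coact (X.act x))
  /-- The canonical map `t ⊗ b ↦ t₁ ⊗ t₂ ◁ b` is a well-defined bijection
  from `T □_C B` onto `T □_S T`. -/
  can : cotensor X.coact 𝓑.leftR ≃ₗ[ℂ] cotensor X.quotRight X.quotLeft
  can_spec : ∀ x : cotensor X.coact 𝓑.leftR,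
    AppR X.act (TensorProduct.assoc ℂ T T B ((comul (R := ℂ)).rTensor B x.1)) (can x).1

/-- `κ = (ε ⊗ id) ∘ can⁻¹ : T □_S T → B`. -/
noncomputable def EquivariantGalois.kappa {𝓑 : RightHopfCoalgebra B C}
    {X : RightModuleCoalgebra 𝓑.toRightBicoalgebroid T}
    {K : Type*} [AddCommGroup K] [Module ℂ K] [Coalgebra ℂ K] {𝓚 : LeftHopfCoalgebra K X.Quot}
    {Y : LeftComoduleCoalgebra 𝓚.toLeftBicoalgebroid T} (G : EquivariantGalois 𝓑 X 𝓚 Y) :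
    cotensor X.quotRight X.quotLeft →ₗ[ℂ] B :=
  (TensorProduct.lid ℂ B).toLinearMap ∘ₗ (counit (R := ℂ) (A := T)).rTensor B ∘ₗ
    Submodule.subtype _ ∘ₗ G.can.symm.toLinearMap

end Coextensions

end CrossHopf

/-!
Write `P = M □_K T`. The action on `P` is that of `T`, and its module axioms are those of `T`. All
the work is in the coaction. For `m ⊗ t ∈ P` the element `t₂₍₋₁₎ ▷ m ⊗ t₂₍₀₎ ⊗ t₁` is defined and
lies in `M ⊗ (T □_S T)`, so that there is a unique
`δ(m ⊗ t) = m' ⊗ t' ⊗ b ∈ M ⊗ (T □_C B)` with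

  `m' ⊗ t'₁ ⊗ t'₂ ◁ b = t₂₍₋₁₎ ▷ m ⊗ t₂₍₀₎ ⊗ t₁`    (`EquivariantGalois.sw_delta`).

Since `can⁻¹` is left `T`-colinear (`comul_canInv`), the coaction `m ⊗ t ↦ b ⊗ m' ⊗ t'` is the one
expressed by `κ` (`coaction_eq_kappa`). The main identities for `δ` hold because they hold after an
application of `can`, which stays injective inside larger tensor products (`can_injective`), where
`δ` can be eliminated:

* `δ` has values in `P ⊗ B` by the anti-Yetter-Drinfeld condition on `M`
  (`delta_mem_cotensor`);
* coassociativity follows from stability of `M`, the comodule coalgebra axiom of `T`, and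
  associativity of the `K`-action, applied to `t₂₍₋₁₎ ▷ (t₃₍₋₁₎ ▷ m)` (`delta_delta`);
* the anti-Yetter-Drinfeld condition for `P` follows from `b₁ ⊗ b₂ b' = ν(b ⊗ b')` and the
  associativity of the `B`-action (`delta_actOn`). The domain conditions it contains come from
  coassociativity of `δ`, from the compatibility of `δ` with the `C`-coactions, from the
  colinearity of `ν⁻¹`, and from the Takeuchi condition `t₋₁ ⊗ t₀ ◁ b = β(b₁) ⊗ t ◁ b₂` for
  the action on `T`, a consequence of the one for `B` and of the unit.

The remaining identities are read off from the characterization of `δ`: applying `ε` to `t'₂ ◁ b`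
gives the counit axiom (`sw_delta_counit`), applying `ε` to `t'₁` gives stability (`sw_delta_act`),
and applying `t ↦ ε(t₀) t₁` to `t'₂ ◁ b` gives the compatibility with the left `C`-coaction
(`sw_delta_α`). The compatibility with the right one expresses that `t' ⊗ b` lies in `T □_C B`
(`sw_delta_β`).

Computations are carried out with Sweedler sums `sw x fun a b => F a b` in extensions `total f` of
the partially defined operations `f` to the whole tensor product. The extensions carry no
information, so every rewriting step with an axiom is preceded by a proof that its argument lies in
the domain `p` of `f`, or in the subspace `tens p A = p ⊗ A` for an operation on some tensor factors
only. The structure maps of `P` are first given on `M ⊗ T` (`SAYDOn`) and then restricted.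
-/

namespace CrossHopf

local notation "Δ" => Coalgebra.comul (R := ℂ)
local notation "ε" => Coalgebra.counit (R := ℂ)

/-! ### Sweedler sums -/

section Sums

variable {U V W Z A : Type*} [AddCommMonoid U] [Module ℂ U] [AddCommMonoid V] [Module ℂ V]
  [AddCommMonoid W] [Module ℂ W] [AddCommMonoid Z] [AddCommMonoid A] [Module ℂ A]

/-- The sum `∑ F(a, b)` over a chosen expression `x = ∑ a ⊗ b` as a sum of pure tensors, so that
`sw (Δ t) fun t₁ t₂ => F t₁ t₂` is what is written `F(t₁, t₂)` in Sweedler notation. It is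
independent of the choice whenever `F` is bilinear, see `sw_eq_lift`; sums for arbitrary `F` make
interchange of sums and rewriting under binders unconditional. -/
noncomputable def sw (x : V ⊗[ℂ] W) (F : V → W → Z) : Z :=
  ∑ p ∈ (TensorProduct.exists_finset x).choose, F p.1 p.2

theorem sw_congr {x : V ⊗[ℂ] W} {F G : V → W → Z} (h : ∀ a b, F a b = G a b) :
    sw x F = sw x G := by
  rw [show F = G from funext fun a => funext (h a)]

theorem sw_comm (x : V ⊗[ℂ] W) (y : U ⊗[ℂ] A) (F : V → W → U → A → Z) :
    sw x (fun a b => sw y (fun c d => F a b c d)) = sw y fun c d => sw x fun a b => F a b c d := by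
  unfold sw; rw [Finset.sum_comm]

end Sums

section Sweedler

variable {U V W Z A : Type*} [AddCommMonoid U] [Module ℂ U] [AddCommMonoid V] [Module ℂ V]
  [AddCommMonoid W] [Module ℂ W] [AddCommMonoid Z] [Module ℂ Z] [AddCommMonoid A] [Module ℂ A]

/-- Linearity of an unbundled function, as a property that `fun_prop` can derive for the
`fun`-expressions occurring in Sweedler sums. -/
@[fun_prop]
def Lin (f : V → W) : Prop := IsLinearMap ℂ f

/-- The linear map with the given underlying linear function. -/
def Lin.toMap {f : V → W} (hf : Lin f) : V →ₗ[ℂ] W := IsLinearMap.mk' f hf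

@[fun_prop] theorem Lin.id : Lin (fun x : V => x) := ⟨fun _ _ => rfl, fun _ _ => rfl⟩

@[fun_prop] theorem Lin.comp {f : V → W} {g : U → V} (hf : Lin f) (hg : Lin g) :
    Lin (fun x => f (g x)) :=
  ⟨fun x y => by rw [hg.1, hf.1], fun c x => by rw [hg.2, hf.2]⟩

@[fun_prop] theorem Lin.map (L : V →ₗ[ℂ] W) {f : U → V} (hf : Lin f) : Lin (fun x => L (f x)) :=
  ⟨fun x y => by rw [hf.1, L.map_add], fun c x => by rw [hf.2, L.map_smul]⟩

@[fun_prop] theorem Lin.equiv (L : V ≃ₗ[ℂ] W) {f : U → V} (hf : Lin f) :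
    Lin (fun x => L (f x)) :=
  ⟨fun x y => by rw [hf.1, L.map_add], fun c x => by rw [hf.2, L.map_smul]⟩

@[fun_prop] theorem Lin.tmul_left {f : U → V} (hf : Lin f) (w : W) :
    Lin (fun x => f x ⊗ₜ[ℂ] w) :=
  ⟨fun x y => by rw [hf.1, TensorProduct.add_tmul],
    fun c x => by rw [hf.2, TensorProduct.smul_tmul']⟩

@[fun_prop] theorem Lin.tmul_right {f : U → V} (hf : Lin f) (w : W) :
    Lin (fun x => w ⊗ₜ[ℂ] f x) :=
  ⟨fun x y => by rw [hf.1, TensorProduct.tmul_add],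
    fun c x => by rw [hf.2, TensorProduct.tmul_smul]⟩

@[fun_prop] theorem Lin.smul_left {f : U → ℂ} (hf : Lin f) (w : W) : Lin (fun x => f x • w) :=
  ⟨fun x y => by rw [hf.1, add_smul], fun c x => by rw [hf.2, smul_assoc]⟩

@[fun_prop] theorem Lin.smul_right {f : U → V} (hf : Lin f) (c : ℂ) : Lin (fun x => c • f x) :=
  ⟨fun x y => by rw [hf.1, smul_add], fun d x => by rw [hf.2, smul_comm]⟩

theorem sw_eq_lift (x : V ⊗[ℂ] W) {F : V → W → Z} (h₁ : ∀ b, Lin (fun a => F a b))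
    (h₂ : ∀ a, Lin (fun b => F a b)) :
    sw x F = TensorProduct.lift (LinearMap.mk₂ ℂ F (fun a a' b => (h₁ b).1 a a')
      (fun c a b => (h₁ b).2 c a) (fun a b b' => (h₂ a).1 b b') (fun c a b => (h₂ a).2 c b)) x := by
  conv_rhs => rw [(TensorProduct.exists_finset x).choose_spec]
  simp [sw]

@[fun_prop] theorem Lin.sw_left {F : V → W → Z} (h₁ : ∀ b, Lin (fun a => F a b))
    (h₂ : ∀ a, Lin (fun b => F a b)) {g : U → V ⊗[ℂ] W} (hg : Lin g) :
    Lin (fun u => sw (g u) F) := by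
  simp only [sw_eq_lift _ h₁ h₂]; fun_prop

@[fun_prop] theorem Lin.sw_right {F : U → V → W → Z} (x : V ⊗[ℂ] W)
    (h : ∀ a b, Lin (fun u => F u a b)) : Lin (fun u => sw x (F u)) :=
  ⟨fun u v => by simp [sw, (h _ _).1, Finset.sum_add_distrib],
    fun c u => by simp [sw, (h _ _).2, Finset.smul_sum]⟩

theorem sw_tmul (a : V) (b : W) {F : V → W → Z} (h₁ : ∀ b, Lin (fun a => F a b))
    (h₂ : ∀ a, Lin (fun b => F a b)) : sw (a ⊗ₜ b) F = F a b := by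
  simp [sw_eq_lift _ h₁ h₂]

theorem map_sw (L : Z →ₗ[ℂ] A) (x : V ⊗[ℂ] W) (F : V → W → Z) :
    L (sw x F) = sw x fun a b => L (F a b) := by
  simp [sw]

theorem equiv_sw (L : Z ≃ₗ[ℂ] A) (x : V ⊗[ℂ] W) (F : V → W → Z) :
    L (sw x F) = sw x fun a b => L (F a b) := by
  simp [sw]

theorem Lin.apply_sw {f : Z → A} (hf : Lin f) (x : V ⊗[ℂ] W) (F : V → W → Z) :
    f (sw x F) = sw x fun a b => f (F a b) :=
  map_sw hf.toMap x F

theorem tmul_sw (u : A) (x : V ⊗[ℂ] W) (F : V → W → Z) :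
    u ⊗ₜ[ℂ] (sw x F) = sw x fun a b => u ⊗ₜ[ℂ] (F a b) := by
  simp [sw, TensorProduct.tmul_sum]

theorem sw_tmul' (u : A) (x : V ⊗[ℂ] W) (F : V → W → Z) :
    (sw x F) ⊗ₜ[ℂ] u = sw x fun a b => (F a b) ⊗ₜ[ℂ] u := by
  simp [sw, TensorProduct.sum_tmul]

theorem smul_sw (c : ℂ) (x : V ⊗[ℂ] W) (F : V → W → Z) :
    c • (sw x F) = sw x fun a b => c • (F a b) := by
  simp [sw, Finset.smul_sum]

theorem sw_sw (x : V ⊗[ℂ] W) {G : V → W → U ⊗[ℂ] A} {F : U → A → Z}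
    (h₁ : ∀ b, Lin (fun a => F a b)) (h₂ : ∀ a, Lin (fun b => F a b)) :
    sw (sw x G) F = sw x fun a b => sw (G a b) F := by
  simp only [sw_eq_lift _ h₁ h₂, map_sw]

theorem sw_mk (x : V ⊗[ℂ] W) : sw x (fun a b => a ⊗ₜ[ℂ] b) = x := by
  rw [sw]; exact (TensorProduct.exists_finset x).choose_spec.symm

theorem map_eq_sw (L : V ⊗[ℂ] W →ₗ[ℂ] Z) (x : V ⊗[ℂ] W) :
    L x = sw x fun a b => L (a ⊗ₜ b) := by
  conv_lhs => rw [← sw_mk x, map_sw]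

theorem equiv_eq_sw (L : V ⊗[ℂ] W ≃ₗ[ℂ] Z) (x : V ⊗[ℂ] W) :
    L x = sw x fun a b => L (a ⊗ₜ b) := by
  conv_lhs => rw [← sw_mk x, equiv_sw]

theorem Lin.eq_sw {f : V ⊗[ℂ] W → Z} (hf : Lin f) (x : V ⊗[ℂ] W) :
    f x = sw x fun a b => f (a ⊗ₜ b) :=
  map_eq_sw hf.toMap x

variable {Y : Type*} [AddCommMonoid Y] [Module ℂ Y]

theorem sw_map (f : V →ₗ[ℂ] U) (g : W →ₗ[ℂ] Y) (x : V ⊗[ℂ] W) {F : U → Y → Z}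
    (h₁ : ∀ b, Lin (fun a => F a b)) (h₂ : ∀ a, Lin (fun b => F a b)) :
    sw (TensorProduct.map f g x) F = sw x fun a b => F (f a) (g b) := by
  rw [map_eq_sw (TensorProduct.map f g)]
  simp (disch := fun_prop) only [sw_sw, TensorProduct.map_tmul, sw_tmul]

theorem sw_rTensor (f : V →ₗ[ℂ] U) (x : V ⊗[ℂ] W) {F : U → W → Z}
    (h₁ : ∀ b, Lin (fun a => F a b)) (h₂ : ∀ a, Lin (fun b => F a b)) :
    sw (f.rTensor W x) F = sw x fun a b => F (f a) b :=
  sw_map f LinearMap.id x h₁ h₂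

theorem sw_lTensor (g : W →ₗ[ℂ] Y) (x : V ⊗[ℂ] W) {F : V → Y → Z}
    (h₁ : ∀ b, Lin (fun a => F a b)) (h₂ : ∀ a, Lin (fun b => F a b)) :
    sw (g.lTensor V x) F = sw x fun a b => F a (g b) :=
  sw_map LinearMap.id g x h₁ h₂

theorem sw_flip (x : V ⊗[ℂ] W) {F : W → V → Z}
    (h₁ : ∀ b, Lin (fun a => F a b)) (h₂ : ∀ a, Lin (fun b => F a b)) :
    sw (TensorProduct.comm ℂ V W x) F = sw x fun a b => F b a := by
  rw [equiv_eq_sw (TensorProduct.comm ℂ V W)]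
  simp (disch := fun_prop) only [sw_sw, TensorProduct.comm_tmul, sw_tmul]

theorem sw_assoc (x : (V ⊗[ℂ] W) ⊗[ℂ] U) {F : V → W ⊗[ℂ] U → Z}
    (h₁ : ∀ b, Lin (fun a => F a b)) (h₂ : ∀ a, Lin (fun b => F a b)) :
    sw (TensorProduct.assoc ℂ V W U x) F = sw x fun p c => sw p fun a b => F a (b ⊗ₜ c) := by
  have h (c : U) : Lin fun p => sw (TensorProduct.assoc ℂ V W U (p ⊗ₜ c)) F := by fun_prop
  rw [equiv_eq_sw (TensorProduct.assoc ℂ V W U), sw_sw _ h₁ h₂]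
  refine sw_congr fun p c => ?_
  rw [(h c).eq_sw p]
  simp (disch := fun_prop) only [TensorProduct.assoc_tmul, sw_tmul]

theorem sw_assoc_symm (x : V ⊗[ℂ] (W ⊗[ℂ] U)) {F : V ⊗[ℂ] W → U → Z}
    (h₁ : ∀ b, Lin (fun a => F a b)) (h₂ : ∀ a, Lin (fun b => F a b)) :
    sw ((TensorProduct.assoc ℂ V W U).symm x) F =
      sw x fun a q => sw q fun b c => F (a ⊗ₜ b) c := by
  have h (a : V) : Lin fun q => sw ((TensorProduct.assoc ℂ V W U).symm (a ⊗ₜ q)) F := by fun_prop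
  rw [equiv_eq_sw (TensorProduct.assoc ℂ V W U).symm, sw_sw _ h₁ h₂]
  refine sw_congr fun a q => ?_
  rw [(h a).eq_sw q]
  simp (disch := fun_prop) only [TensorProduct.assoc_symm_tmul, sw_tmul]

end Sweedler

section Laws

open Coalgebra

variable {T Z : Type*} [AddCommGroup T] [Module ℂ T] [Coalgebra ℂ T]
  [AddCommMonoid Z] [Module ℂ Z]

@[fun_prop] theorem Lin.coalgHom {C U : Type*} [AddCommGroup C] [Module ℂ C] [Coalgebra ℂ C]
    [AddCommMonoid U] [Module ℂ U] (L : T →ₗc[ℂ] C) {f : U → T} (hf : Lin f) :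
    Lin (fun x => L (f x)) :=
  Lin.map L.toLinearMap hf

theorem sw_coassoc (t : T) {F : T → T → T → Z} (h₁ : ∀ b c, Lin fun a => F a b c)
    (h₂ : ∀ a c, Lin fun b => F a b c) (h₃ : ∀ a b, Lin fun c => F a b c) :
    (sw (comul (R := ℂ) t) fun t₁ t₂ => sw (comul (R := ℂ) t₁) fun a b => F a b t₂) =
      sw (comul (R := ℂ) t) fun t₁ t₂ => sw (comul (R := ℂ) t₂) fun b c => F t₁ b c := by
  have h := congrArg (fun z => sw z fun a p => sw p fun b c => F a b c)
    (coassoc_apply (R := ℂ) t)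
  simp (disch := fun_prop) only [sw_assoc, sw_rTensor, sw_lTensor, sw_tmul] at h
  exact h

theorem sw_counit_left (t : T) {F : T → Z} (h : Lin F) :
    (sw (comul (R := ℂ) t) fun t₁ t₂ => counit (R := ℂ) t₁ • F t₂) = F t := by
  have h' := congrArg (fun z => sw z fun (c : ℂ) t => c • F t) (rTensor_counit_comul (R := ℂ) t)
  simp (disch := fun_prop) only [sw_rTensor, sw_tmul, one_smul] at h'
  exact h'

theorem sw_counit_right (t : T) {F : T → Z} (h : Lin F) :
    (sw (comul (R := ℂ) t) fun t₁ t₂ => counit (R := ℂ) t₂ • F t₁) = F t := by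
  have h' := congrArg (fun z => sw z fun t (c : ℂ) => c • F t) (lTensor_counit_comul (R := ℂ) t)
  simp (disch := fun_prop) only [sw_lTensor, sw_tmul, one_smul] at h'
  exact h'

variable {C M : Type*} [AddCommGroup C] [Module ℂ C] [Coalgebra ℂ C] [AddCommGroup M] [Module ℂ M]

theorem RightComodule.sw_coassoc (X : RightComodule C M) (m : M) {F : M → C → C → Z}
    (h₁ : ∀ b c, Lin fun a => F a b c)
    (h₂ : ∀ a c, Lin fun b => F a b c) (h₃ : ∀ a b, Lin fun c => F a b c) :
    (sw (X.coact m) fun m₀ m₁ => sw (X.coact m₀) fun a b => F a b m₁) =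
      sw (X.coact m) fun m₀ m₁ => sw (comul (R := ℂ) m₁) fun b c => F m₀ b c := by
  have h := congrArg (fun z => sw z fun a p => sw p fun b c => F a b c) (X.coassoc m)
  simp (disch := fun_prop) only [sw_assoc, sw_rTensor, sw_lTensor, sw_tmul] at h
  exact h

theorem RightComodule.sw_counit (X : RightComodule C M) (m : M) {F : M → Z} (h : Lin F) :
    (sw (X.coact m) fun m₀ m₁ => counit (R := ℂ) m₁ • F m₀) = F m := by
  have h' := congrArg F (X.counit_coact m)
  rw [map_eq_sw (LinearMap.lTensor M (counit (R := ℂ) (A := C)))] at h'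
  simpa only [equiv_sw, h.apply_sw, LinearMap.lTensor_tmul, TensorProduct.rid_tmul, h.2] using h'

theorem LeftComodule.sw_coassoc (X : LeftComodule C M) (m : M) {F : C → C → M → Z}
    (h₁ : ∀ b c, Lin fun a => F a b c)
    (h₂ : ∀ a c, Lin fun b => F a b c) (h₃ : ∀ a b, Lin fun c => F a b c) :
    (sw (X.coact m) fun m₁ m₀ => sw (X.coact m₀) fun b c => F m₁ b c) =
      sw (X.coact m) fun m₁ m₀ => sw (comul (R := ℂ) m₁) fun a b => F a b m₀ := by
  have h := congrArg (fun z => sw z fun a p => sw p fun b c => F a b c) (X.coassoc m)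
  simp (disch := fun_prop) only [sw_assoc, sw_rTensor, sw_lTensor, sw_tmul] at h
  exact h.symm

end Laws

/-! ### Linear maps defined on subspaces -/

section Partial

variable {V W A A' Z : Type*} [AddCommGroup V] [Module ℂ V] [AddCommGroup W] [Module ℂ W]
  [AddCommGroup A] [Module ℂ A] [AddCommGroup A'] [Module ℂ A'] [AddCommGroup Z] [Module ℂ Z]

/-- An extension of `f : p → W` to the whole space. Its values outside `p` are arbitrary, and it is
only evaluated on `p`, or on tensors whose sum is known to lie in a subspace of the form `p ⊗ A`. -/
noncomputable def total {p : Submodule ℂ V} (f : p →ₗ[ℂ] W) : V →ₗ[ℂ] W :=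
  (LinearMap.exists_extend f).choose

theorem total_comp {p : Submodule ℂ V} (f : p →ₗ[ℂ] W) : total f ∘ₗ p.subtype = f :=
  (LinearMap.exists_extend f).choose_spec

theorem total_coe {p : Submodule ℂ V} (f : p →ₗ[ℂ] W) (x : p) : total f x.1 = f x :=
  LinearMap.congr_fun (total_comp f) x

/-- The subspace `p ⊗ A` of `V ⊗ A`. -/
noncomputable def tens (p : Submodule ℂ V) (A : Type*) [AddCommGroup A] [Module ℂ A] :
    Submodule ℂ (V ⊗[ℂ] A) :=
  LinearMap.range (p.subtype.rTensor A)

theorem rTensor_total {p : Submodule ℂ V} (f : p →ₗ[ℂ] W) (z : p ⊗[ℂ] A) :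
    (total f).rTensor A (p.subtype.rTensor A z) = f.rTensor A z := by
  rw [← LinearMap.comp_apply, ← LinearMap.rTensor_comp, total_comp]

theorem lTensor_total {p : Submodule ℂ V} (f : p →ₗ[ℂ] W) (z : A ⊗[ℂ] p) :
    (total f).lTensor A (p.subtype.lTensor A z) = f.lTensor A z := by
  rw [← LinearMap.comp_apply, ← LinearMap.lTensor_comp, total_comp]

theorem app_iff {p : Submodule ℂ V} (f : p →ₗ[ℂ] W) (x : V) (y : W) :
    App f x y ↔ x ∈ p ∧ total f x = y := by
  constructor
  · rintro ⟨h, rfl⟩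
    exact ⟨h, total_coe f ⟨x, h⟩⟩
  · rintro ⟨h, rfl⟩
    exact ⟨h, (total_coe f ⟨x, h⟩).symm⟩

theorem appL_iff {p : Submodule ℂ V} (f : p →ₗ[ℂ] W) (x : V ⊗[ℂ] A) (y : W ⊗[ℂ] A) :
    AppL f x y ↔ x ∈ tens p A ∧ (total f).rTensor A x = y := by
  constructor
  · rintro ⟨z, rfl, rfl⟩
    exact ⟨⟨z, rfl⟩, rTensor_total f z⟩
  · rintro ⟨⟨z, rfl⟩, rfl⟩
    exact ⟨z, rfl, (rTensor_total f z).symm⟩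

theorem comm_lTensor_subtype (p : Submodule ℂ V) (z : A ⊗[ℂ] p) :
    TensorProduct.comm ℂ A V (p.subtype.lTensor A z) =
      p.subtype.rTensor A (TensorProduct.comm ℂ A p z) := by
  induction z with
  | zero => simp
  | add x y hx hy => simp only [map_add, hx, hy]
  | tmul a b => simp

theorem comm_mem_tens {p : Submodule ℂ V} {x : A ⊗[ℂ] V} :
    TensorProduct.comm ℂ A V x ∈ tens p A ↔ ∃ z : A ⊗[ℂ] p, p.subtype.lTensor A z = x := by
  constructor
  · rintro ⟨z, hz⟩
    refine ⟨TensorProduct.comm ℂ p A z, (TensorProduct.comm ℂ A V).injective ?_⟩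
    rw [comm_lTensor_subtype, ← hz]
    simp
  · rintro ⟨z, rfl⟩
    exact ⟨_, (comm_lTensor_subtype p z).symm⟩

theorem appR_iff {p : Submodule ℂ V} (f : p →ₗ[ℂ] W) (x : A ⊗[ℂ] V) (y : A ⊗[ℂ] W) :
    AppR f x y ↔ TensorProduct.comm ℂ A V x ∈ tens p A ∧ (total f).lTensor A x = y := by
  rw [comm_mem_tens]
  constructor
  · rintro ⟨z, rfl, rfl⟩
    exact ⟨⟨z, rfl⟩, lTensor_total f z⟩
  · rintro ⟨⟨z, rfl⟩, rfl⟩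
    exact ⟨z, rfl, (lTensor_total f z).symm⟩

theorem tmul_mem_tens {p : Submodule ℂ V} {x : V} (hx : x ∈ p) (a : A) : x ⊗ₜ[ℂ] a ∈ tens p A :=
  ⟨⟨x, hx⟩ ⊗ₜ a, rfl⟩

theorem sw_mem {U Y : Type*} [AddCommMonoid U] [Module ℂ U] [AddCommMonoid Y] [Module ℂ Y]
    {Q : Submodule ℂ Z} {x : U ⊗[ℂ] Y} {F : U → Y → Z}
    (h : ∀ a b, F a b ∈ Q) : sw x F ∈ Q :=
  Submodule.sum_mem _ fun _ _ => h _ _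

/-- Identities between linear functions that hold on `p` hold on `p ⊗ A`. -/
theorem tens_congr {Z : Type*} [AddCommMonoid Z] [Module ℂ Z]
    {p : Submodule ℂ V} {z : V ⊗[ℂ] A} (hz : z ∈ tens p A) {F G : V → A → Z}
    (hF₁ : ∀ b, Lin fun a => F a b) (hF₂ : ∀ a, Lin fun b => F a b)
    (hG₁ : ∀ b, Lin fun a => G a b) (hG₂ : ∀ a, Lin fun b => G a b)
    (h : ∀ x ∈ p, ∀ a, F x a = G x a) : sw z F = sw z G := by
  obtain ⟨w, rfl⟩ := hz
  rw [sw_rTensor _ _ hF₁ hF₂, sw_rTensor _ _ hG₁ hG₂]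
  exact sw_congr fun x a => h x x.2 a

/-- Membership in a subspace that holds on `p` holds on `p ⊗ A`. -/
theorem tens_mem {p : Submodule ℂ V} {z : V ⊗[ℂ] A} (hz : z ∈ tens p A) {F : V → A → Z}
    {Q : Submodule ℂ Z} (hF₁ : ∀ b, Lin fun a => F a b) (hF₂ : ∀ a, Lin fun b => F a b)
    (h : ∀ x ∈ p, ∀ a, F x a ∈ Q) : sw z F ∈ Q := by
  obtain ⟨w, rfl⟩ := hz
  rw [sw_rTensor _ _ hF₁ hF₂]
  exact sw_mem fun x a => h x x.2 a

/-- The remaining tensor factors may be transformed linearly. -/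
theorem tens_map {p : Submodule ℂ V} {z : V ⊗[ℂ] A} (hz : z ∈ tens p A) {f : A → A'}
    (hf : Lin f) : (sw z fun x a => x ⊗ₜ[ℂ] f a) ∈ tens p A' :=
  tens_mem hz (by fun_prop) (by fun_prop) fun _ hx _ => tmul_mem_tens hx _

/-- Flatness of `A`. -/
theorem mem_tens_eqLocus {f g : V →ₗ[ℂ] W} {z : V ⊗[ℂ] A} :
    z ∈ tens (LinearMap.eqLocus f g) A ↔ f.rTensor A z = g.rTensor A z := by
  have h := (Module.Flat.rTensor_exact A (LinearMap.exact_subtype_ker_map (f - g)) z)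
  rw [LinearMap.rTensor_sub, LinearMap.sub_apply, sub_eq_zero] at h
  rw [h, tens, LinearMap.eqLocus_eq_ker_sub]
  rfl

/-- Over a field, `(p ⊗ A) ∩ (q ⊗ A) = (p ∩ q) ⊗ A`. -/
theorem mem_tens_inf {p q : Submodule ℂ V} {z : V ⊗[ℂ] A} (hp : z ∈ tens p A)
    (hq : z ∈ tens q A) : z ∈ tens (p ⊓ q) A := by
  have e (r : Submodule ℂ V) : r = LinearMap.eqLocus r.mkQ 0 := by
    ext x; simp [Submodule.Quotient.mk_eq_zero]
  have epq : p ⊓ q = LinearMap.eqLocus (p.mkQ.prod q.mkQ) 0 := by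
    ext x; simp [Submodule.Quotient.mk_eq_zero]
  rw [e p, mem_tens_eqLocus] at hp
  rw [e q, mem_tens_eqLocus] at hq
  have hs : p.mkQ.prod q.mkQ = LinearMap.inl ℂ _ _ ∘ₗ p.mkQ + LinearMap.inr ℂ _ _ ∘ₗ q.mkQ := by
    ext x <;> simp
  rw [epq, mem_tens_eqLocus, hs, LinearMap.rTensor_add, LinearMap.add_apply,
    LinearMap.rTensor_comp, LinearMap.rTensor_comp, LinearMap.comp_apply, LinearMap.comp_apply,
    hp, hq]
  simp

variable {X C Y : Type*} [AddCommGroup X] [Module ℂ X] [AddCommGroup C] [Module ℂ C]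
  [AddCommGroup Y] [Module ℂ Y] {ρ : X →ₗ[ℂ] X ⊗[ℂ] C} {l : Y →ₗ[ℂ] C ⊗[ℂ] Y}

theorem mem_cotensor {x : X ⊗[ℂ] Y} : x ∈ cotensor ρ l ↔
    (sw x fun x y => sw (ρ x) fun x₀ x₁ => x₀ ⊗ₜ[ℂ] (x₁ ⊗ₜ[ℂ] y)) =
      sw x fun x y => sw (l y) fun y₁ y₀ => x ⊗ₜ[ℂ] (y₁ ⊗ₜ[ℂ] y₀) := by
  rw [cotensor, LinearMap.mem_eqLocus, map_eq_sw (_ ∘ₗ _), map_eq_sw (l.lTensor X)]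
  have h₁ (x : X) (y : Y) : ((TensorProduct.assoc ℂ X C Y).toLinearMap ∘ₗ ρ.rTensor Y) (x ⊗ₜ y) =
      sw (ρ x) fun x₀ x₁ => x₀ ⊗ₜ[ℂ] (x₁ ⊗ₜ[ℂ] y) := by
    rw [LinearMap.comp_apply, LinearMap.rTensor_tmul]
    conv_lhs => rw [← sw_mk (ρ x)]
    simp only [sw_tmul', map_sw, LinearEquiv.coe_coe, TensorProduct.assoc_tmul]
  have h₂ (x : X) (y : Y) : l.lTensor X (x ⊗ₜ y) =
      sw (l y) fun y₁ y₀ => x ⊗ₜ[ℂ] (y₁ ⊗ₜ[ℂ] y₀) := by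
    rw [LinearMap.lTensor_tmul, ← tmul_sw, sw_mk]
  simp only [h₁, h₂]

/-- The identity `x₀ ⊗ x₁ ⊗ y = x ⊗ y₋₁ ⊗ y₀` defining the cotensor product, in use. -/
theorem sw_cotensor {Z : Type*} [AddCommMonoid Z] [Module ℂ Z] {x : X ⊗[ℂ] Y}
    (hx : x ∈ cotensor ρ l) {F : X → C → Y → Z} (h₁ : ∀ b c, Lin fun a => F a b c)
    (h₂ : ∀ a c, Lin fun b => F a b c) (h₃ : ∀ a b, Lin fun c => F a b c) :
    (sw x fun x y => sw (ρ x) fun x₀ x₁ => F x₀ x₁ y) =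
      sw x fun x y => sw (l y) fun y₁ y₀ => F x y₁ y₀ := by
  have h := congrArg (fun z => sw z fun a p => sw p fun b c => F a b c) (mem_cotensor.1 hx)
  simp (disch := fun_prop) only [sw_sw, sw_tmul] at h
  exact h

/-- The identity defining the cotensor product, tensored with `A`, characterizes `(X □_C Y) ⊗ A`. -/
theorem mem_tens_cotensor {z : (X ⊗[ℂ] Y) ⊗[ℂ] A} : z ∈ tens (cotensor ρ l) A ↔
    (sw z fun v a => sw v fun x y => sw (ρ x) fun x₀ x₁ => x₀ ⊗ₜ[ℂ] (x₁ ⊗ₜ[ℂ] (y ⊗ₜ[ℂ] a))) =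
      sw z fun v a => sw v fun x y => sw (l y) fun y₁ y₀ =>
        x ⊗ₜ[ℂ] (y₁ ⊗ₜ[ℂ] (y₀ ⊗ₜ[ℂ] a)) := by
  constructor
  · intro hz
    exact tens_congr hz (by fun_prop) (by fun_prop) (by fun_prop) (by fun_prop)
      fun x hx a => sw_cotensor hx (F := fun x₀ x₁ y => x₀ ⊗ₜ[ℂ] (x₁ ⊗ₜ[ℂ] (y ⊗ₜ[ℂ] a)))
        (by fun_prop) (by fun_prop) (by fun_prop)
  · intro h
    rw [cotensor, mem_tens_eqLocus]
    have h' := congrArg (fun z => sw z fun a p => sw p fun b q => sw q fun c d =>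
      (a ⊗ₜ[ℂ] (b ⊗ₜ[ℂ] c)) ⊗ₜ[ℂ] d) h
    simp (disch := fun_prop) only [sw_sw, sw_tmul] at h'
    rw [map_eq_sw (LinearMap.rTensor A _), map_eq_sw (LinearMap.rTensor A (l.lTensor X))]
    simp only [LinearMap.rTensor_tmul]
    refine Eq.trans (sw_congr fun v a => ?_) (h'.trans (sw_congr fun v a => ?_))
    · rw [map_eq_sw (_ ∘ₗ _), sw_tmul']
      refine sw_congr fun x y => ?_
      rw [LinearMap.comp_apply, LinearMap.rTensor_tmul]
      conv_lhs => rw [← sw_mk (ρ x)]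
      simp only [sw_tmul', map_sw, LinearEquiv.coe_coe, TensorProduct.assoc_tmul]
    · rw [map_eq_sw (l.lTensor X), sw_tmul']
      refine sw_congr fun x y => ?_
      rw [LinearMap.lTensor_tmul]
      conv_rhs => rw [← sw_mk (l y)]
      simp only [sw_tmul', tmul_sw]

/-- The defining identity of the cotensor product inside a larger tensor product. -/
theorem sw_tens_cotensor {Z : Type*} [AddCommMonoid Z] [Module ℂ Z] {z : (X ⊗[ℂ] Y) ⊗[ℂ] A}
    (hz : z ∈ tens (cotensor ρ l) A) {F : X → C → Y → A → Z}
    (h₁ : ∀ b c d, Lin fun a => F a b c d) (h₂ : ∀ a c d, Lin fun b => F a b c d)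
    (h₃ : ∀ a b d, Lin fun c => F a b c d) (h₄ : ∀ a b c, Lin fun d => F a b c d) :
    (sw z fun v a => sw v fun x y => sw (ρ x) fun x₀ x₁ => F x₀ x₁ y a) =
      sw z fun v a => sw v fun x y => sw (l y) fun y₁ y₀ => F x y₁ y₀ a :=
  tens_congr hz (by fun_prop) (by fun_prop) (by fun_prop) (by fun_prop)
    fun _ hx a => sw_cotensor hx (F := fun x₀ x₁ y => F x₀ x₁ y a)
      (by fun_prop) (by fun_prop) (by fun_prop)

end Partial

/-! ### Right bicoalgebroids and their modules in Sweedler notation -/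

section SourceTarget

open Coalgebra

variable {H C Z : Type*} [AddCommGroup H] [Module ℂ H] [Coalgebra ℂ H]
  [AddCommGroup C] [Module ℂ C] [Coalgebra ℂ C] [AddCommMonoid Z] [Module ℂ Z]
  (s : SourceTarget H C)

theorem SourceTarget.sw_leftR (h : H) {F : C → H → Z} (h₁ : ∀ b, Lin fun a => F a b)
    (h₂ : ∀ a, Lin fun b => F a b) :
    sw (s.leftR h) F = sw (comul (R := ℂ) h) fun a b => F (s.β b) a := by
  simp (disch := fun_prop) only [leftR, LinearMap.comp_apply, LinearEquiv.coe_coe, sw_rTensor,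
    sw_flip]

theorem SourceTarget.sw_rightR (h : H) {F : H → C → Z} (h₁ : ∀ b, Lin fun a => F a b)
    (h₂ : ∀ a, Lin fun b => F a b) :
    sw (s.rightR h) F = sw (comul (R := ℂ) h) fun a b => F a (s.α b) := by
  simp (disch := fun_prop) only [rightR, LinearMap.comp_apply, sw_lTensor]
  rfl

theorem SourceTarget.sw_leftL (h : H) {F : C → H → Z} (h₁ : ∀ b, Lin fun a => F a b)
    (h₂ : ∀ a, Lin fun b => F a b) :
    sw (s.leftL h) F = sw (comul (R := ℂ) h) fun a b => F (s.α a) b := by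
  simp (disch := fun_prop) only [leftL, LinearMap.comp_apply, sw_rTensor]
  rfl

theorem SourceTarget.sw_rightL (h : H) {F : H → C → Z} (h₁ : ∀ b, Lin fun a => F a b)
    (h₂ : ∀ a, Lin fun b => F a b) :
    sw (s.rightL h) F = sw (comul (R := ℂ) h) fun a b => F b (s.β a) := by
  simp (disch := fun_prop) only [rightL, LinearMap.comp_apply, LinearEquiv.coe_coe, sw_lTensor,
    sw_flip]

theorem SourceTarget.sw_leftCop (h : H) {F : C → H → Z} (h₁ : ∀ b, Lin fun a => F a b)
    (h₂ : ∀ a, Lin fun b => F a b) :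
    sw (s.leftCop h) F = sw (comul (R := ℂ) h) fun a b => F (s.β a) b := by
  simp (disch := fun_prop) only [leftCop, LinearMap.comp_apply, sw_rTensor]

theorem SourceTarget.sw_rightCop (h : H) {F : H → C → Z} (h₁ : ∀ b, Lin fun a => F a b)
    (h₂ : ∀ a, Lin fun b => F a b) :
    sw (s.rightCop h) F = sw (comul (R := ℂ) h) fun a b => F a (s.β b) := by
  simp (disch := fun_prop) only [rightCop, LinearMap.comp_apply, sw_lTensor]

end SourceTarget

section RightModule

open Coalgebra

variable {B C M A Z : Type*} [AddCommGroup B] [Module ℂ B] [Coalgebra ℂ B]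
  [AddCommGroup C] [Module ℂ C] [Coalgebra ℂ C] [AddCommGroup M] [Module ℂ M]
  [AddCommGroup A] [Module ℂ A] [AddCommMonoid Z] [Module ℂ Z]
  {𝓑 : RightBicoalgebroid B C} (X : RightModule 𝓑 M)

theorem RightModule.act_right_mem {x : M ⊗[ℂ] B} (hx : x ∈ cotensor X.coact 𝓑.leftR) :
    (sw x fun m b => sw (comul (R := ℂ) b) fun b₁ b₂ => (m ⊗ₜ[ℂ] b₁) ⊗ₜ[ℂ] 𝓑.α b₂) ∈
      tens (cotensor X.coact 𝓑.leftR) C := by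
  have h := ((appL_iff _ _ _).1 (X.act_right ⟨x, hx⟩)).1
  rw [← sw_mk (TensorProduct.assoc ℂ M B C |>.symm _)] at h
  simp (disch := fun_prop) only [sw_assoc_symm, sw_lTensor, 𝓑.sw_rightR] at h
  exact h

theorem RightModule.sw_coact_act {x : M ⊗[ℂ] B} (hx : x ∈ cotensor X.coact 𝓑.leftR)
    {F : M → C → Z} (h₁ : ∀ b, Lin fun a => F a b) (h₂ : ∀ a, Lin fun b => F a b) :
    sw (X.coact (total X.act x)) F =
      sw x fun m b => sw (comul (R := ℂ) b) fun b₁ b₂ =>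
        F (total X.act (m ⊗ₜ b₁)) (𝓑.α b₂) := by
  have h := congrArg (fun z => sw z F) ((appL_iff _ _ _).1 (X.act_right ⟨x, hx⟩)).2
  simp (disch := fun_prop) only [sw_rTensor, sw_assoc_symm, sw_lTensor, 𝓑.sw_rightR] at h
  rw [h, ← total_coe]

/-- The subspace of `M ⊗ (B ⊗ B)` on which both sides of the associativity law are defined. -/
noncomputable def RightModule.assocDom : Submodule ℂ (M ⊗[ℂ] (B ⊗[ℂ] B)) :=
  (tens (cotensor X.coact 𝓑.leftR) B).comap (TensorProduct.assoc ℂ M B B).symm.toLinearMap ⊓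
    (tens (cotensor 𝓑.rightR 𝓑.leftR) M).comap
      (TensorProduct.comm ℂ M (B ⊗[ℂ] B)).toLinearMap

theorem mem_tens_comap {V V' : Type*} [AddCommGroup V] [Module ℂ V] [AddCommGroup V'] [Module ℂ V']
    (e : V ≃ₗ[ℂ] V') {q : Submodule ℂ V'} {z : V ⊗[ℂ] A}
    (h : e.toLinearMap.rTensor A z ∈ tens q A) : z ∈ tens (q.comap e.toLinearMap) A := by
  have h' := tens_mem (F := fun v a => e.symm v ⊗ₜ[ℂ] a) (Q := tens (q.comap e.toLinearMap) A) h
    (by fun_prop) (by fun_prop) fun x hx a => tmul_mem_tens (by simpa using hx) a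
  simp (disch := fun_prop) only [sw_rTensor, LinearEquiv.coe_coe, LinearEquiv.symm_apply_apply,
    sw_mk] at h'
  exact h'

/-- Regrouping of the passive factors: `p ⊗ (A' ⊗ A) = (p ⊗ A') ⊗ A`. -/
theorem tens_tens {V A' : Type*} [AddCommGroup V] [Module ℂ V] [AddCommGroup A'] [Module ℂ A']
    {p : Submodule ℂ V} {z : V ⊗[ℂ] (A' ⊗[ℂ] A)} (hz : z ∈ tens p (A' ⊗[ℂ] A)) :
    (sw z fun v a => sw a fun a' a => (v ⊗ₜ[ℂ] a') ⊗ₜ[ℂ] a) ∈ tens (tens p A') A :=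
  tens_mem hz (by fun_prop) (by fun_prop) fun _ hx _ =>
    sw_mem fun _ _ => tmul_mem_tens (tmul_mem_tens hx _) _

theorem RightModule.mem_tens_assocDom {z : (M ⊗[ℂ] (B ⊗[ℂ] B)) ⊗[ℂ] A}
    (h₁ : (sw z fun w a => sw w fun m p => sw p fun b b' => (m ⊗ₜ[ℂ] b) ⊗ₜ[ℂ] (b' ⊗ₜ[ℂ] a)) ∈
      tens (cotensor X.coact 𝓑.leftR) (B ⊗[ℂ] A))
    (h₂ : (sw z fun w a => sw w fun m p => sw p fun b b' => (b ⊗ₜ[ℂ] b') ⊗ₜ[ℂ] (m ⊗ₜ[ℂ] a)) ∈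
      tens (cotensor 𝓑.rightR 𝓑.leftR) (M ⊗[ℂ] A)) :
    z ∈ tens X.assocDom A := by
  refine mem_tens_inf (mem_tens_comap (TensorProduct.assoc ℂ M B B).symm ?_)
    (mem_tens_comap (TensorProduct.comm ℂ M (B ⊗[ℂ] B)) ?_)
  · have h := tens_tens h₁
    simp (disch := fun_prop) only [sw_sw, sw_tmul] at h
    convert h using 1
    rw [← sw_mk (LinearMap.rTensor A _ z)]
    simp (disch := fun_prop) only [sw_rTensor]
    refine sw_congr fun w a => ?_
    rw [← sw_mk ((TensorProduct.assoc ℂ M B B).symm.toLinearMap w), sw_tmul']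
    simp (disch := fun_prop) only [LinearEquiv.coe_coe, sw_assoc_symm]
  · have h := tens_tens h₂
    simp (disch := fun_prop) only [sw_sw, sw_tmul] at h
    convert h using 1
    rw [← sw_mk (LinearMap.rTensor A _ z)]
    simp (disch := fun_prop) only [sw_rTensor]
    refine sw_congr fun w a => ?_
    rw [← sw_mk ((TensorProduct.comm ℂ M (B ⊗[ℂ] B)).toLinearMap w), sw_tmul']
    simp (disch := fun_prop) only [LinearEquiv.coe_coe, sw_flip]
    refine sw_congr fun m p => ?_
    conv_lhs => rw [← sw_mk p]
    simp only [sw_tmul']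

theorem RightModule.assoc_of_mem {w : M ⊗[ℂ] (B ⊗[ℂ] B)} (hw : w ∈ X.assocDom) :
    (sw w fun m p => sw p fun b b' => total X.act (m ⊗ₜ b) ⊗ₜ[ℂ] b') ∈ cotensor X.coact 𝓑.leftR ∧
    (sw w fun m p => m ⊗ₜ[ℂ] total 𝓑.mul p) ∈ cotensor X.coact 𝓑.leftR ∧
    (sw w fun m p => sw p fun b b' => total X.act (total X.act (m ⊗ₜ b) ⊗ₜ[ℂ] b')) =
      sw w fun m p => total X.act (m ⊗ₜ[ℂ] total 𝓑.mul p) := by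
  obtain ⟨⟨u, hu⟩, hv⟩ := hw
  obtain ⟨v, hv⟩ := comm_mem_tens.1 hv
  rw [LinearEquiv.coe_coe] at hu
  obtain ⟨y, h₁, h₂⟩ := X.act_assoc u v (by rw [hu, hv, LinearEquiv.apply_symm_apply])
  rw [app_iff, ← rTensor_total, hu] at h₁
  rw [app_iff, ← lTensor_total, hv] at h₂
  have e₁ : (total X.act).rTensor B ((TensorProduct.assoc ℂ M B B).symm w) =
      sw w fun m p => sw p fun b b' => total X.act (m ⊗ₜ b) ⊗ₜ[ℂ] b' := by
    rw [← sw_mk (LinearMap.rTensor B _ _)]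
    simp (disch := fun_prop) only [sw_rTensor, sw_assoc_symm]
  have e₂ : (total 𝓑.mul).lTensor M w = sw w fun m p => m ⊗ₜ[ℂ] total 𝓑.mul p := by
    rw [← sw_mk (LinearMap.lTensor M _ _)]
    simp (disch := fun_prop) only [sw_lTensor]
  rw [e₁] at h₁
  rw [e₂] at h₂
  refine ⟨h₁.1, h₂.1, ?_⟩
  have h := h₁.2.trans h₂.2.symm
  simpa only [map_sw] using h

/-- Associativity of the action inside a larger tensor product. -/
theorem RightModule.sw_assoc {z : (M ⊗[ℂ] (B ⊗[ℂ] B)) ⊗[ℂ] A} (hz : z ∈ tens X.assocDom A)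
    {F : M → A → Z} (h₁ : ∀ b, Lin fun a => F a b) (h₂ : ∀ a, Lin fun b => F a b) :
    (sw z fun w a => sw w fun m p => sw p fun b b' =>
        F (total X.act (total X.act (m ⊗ₜ b) ⊗ₜ[ℂ] b')) a) =
      sw z fun w a => sw w fun m p => F (total X.act (m ⊗ₜ[ℂ] total 𝓑.mul p)) a := by
  refine tens_congr hz (by fun_prop) (by fun_prop) (by fun_prop) (by fun_prop) fun w hw a => ?_
  have h := congrArg (fun m => F m a) (X.assoc_of_mem hw).2.2
  simpa only [(h₁ a).apply_sw] using h

theorem RightModule.act_act_mem {z : (M ⊗[ℂ] (B ⊗[ℂ] B)) ⊗[ℂ] A} (hz : z ∈ tens X.assocDom A) :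
    (sw z fun w a => sw w fun m p => sw p fun b b' =>
        (total X.act (m ⊗ₜ b) ⊗ₜ[ℂ] b') ⊗ₜ[ℂ] a) ∈ tens (cotensor X.coact 𝓑.leftR) A := by
  refine tens_mem hz (by fun_prop) (by fun_prop) fun w hw a => ?_
  simpa only [sw_tmul'] using tmul_mem_tens (X.assoc_of_mem hw).1 a

theorem RightModule.act_mul_mem {z : (M ⊗[ℂ] (B ⊗[ℂ] B)) ⊗[ℂ] A} (hz : z ∈ tens X.assocDom A) :
    (sw z fun w a => sw w fun m p => (m ⊗ₜ[ℂ] total 𝓑.mul p) ⊗ₜ[ℂ] a) ∈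
      tens (cotensor X.coact 𝓑.leftR) A := by
  refine tens_mem hz (by fun_prop) (by fun_prop) fun w hw a => ?_
  simpa only [sw_tmul'] using tmul_mem_tens (X.assoc_of_mem hw).2.1 a

theorem RightModule.unit_mem (m : M) :
    (sw (X.coact m) fun m₀ m₁ => m₀ ⊗ₜ[ℂ] 𝓑.unit m₁) ∈ cotensor X.coact 𝓑.leftR := by
  have h := ((app_iff _ _ _).1 (X.act_unit m)).1
  rw [← sw_mk (LinearMap.lTensor M _ _)] at h
  simpa (disch := fun_prop) only [sw_lTensor] using h

theorem RightModule.sw_act_unit (m : M) {F : M → Z} (hF : Lin F) :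
    (sw (X.coact m) fun m₀ m₁ => F (total X.act (m₀ ⊗ₜ[ℂ] 𝓑.unit m₁))) = F m := by
  have h := ((app_iff _ _ _).1 (X.act_unit m)).2
  rw [map_eq_sw (total X.act)] at h
  simp (disch := fun_prop) only [sw_lTensor] at h
  conv_rhs => rw [← h, hF.apply_sw]

end RightModule

section RightModuleCoalgebra

open Coalgebra

variable {B C T Z : Type*} [AddCommGroup B] [Module ℂ B] [Coalgebra ℂ B]
  [AddCommGroup C] [Module ℂ C] [Coalgebra ℂ C] [AddCommGroup T] [Module ℂ T] [Coalgebra ℂ T]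
  [AddCommMonoid Z] [Module ℂ Z]
  {𝓑 : RightBicoalgebroid B C} (X : RightModuleCoalgebra 𝓑 T)

theorem RightModuleCoalgebra.counit_total_act {x : T ⊗[ℂ] B} (hx : x ∈ cotensor X.coact 𝓑.leftR) :
    counit (R := ℂ) (total X.act x) = sw x fun t b => counit (R := ℂ) t • counit (R := ℂ) b := by
  have h := X.counit_act ⟨x, hx⟩
  rw [← total_coe] at h
  refine h.trans ?_
  change TensorProduct.lid ℂ ℂ (TensorProduct.map _ _ x) = _
  conv_lhs => rw [← sw_mk x]
  simp only [map_sw, equiv_sw, TensorProduct.map_tmul, TensorProduct.lid_tmul]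

theorem RightModuleCoalgebra.comul_act_mem₂ {x : T ⊗[ℂ] B} (hx : x ∈ cotensor X.coact 𝓑.leftR) :
    (sw x fun t b => sw (comul (R := ℂ) t) fun t₁ t₂ => sw (comul (R := ℂ) b) fun b₁ b₂ =>
      (t₂ ⊗ₜ[ℂ] b₂) ⊗ₜ[ℂ] (t₁ ⊗ₜ[ℂ] b₁)) ∈ tens (cotensor X.coact 𝓑.leftR) (T ⊗[ℂ] B) := by
  obtain ⟨y, h₁, h₂⟩ := X.comul_act ⟨x, hx⟩
  have h := ((appR_iff _ _ _).1 h₁).1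
  rw [map_eq_sw (TensorProduct.map _ _)] at h
  simp only [TensorProduct.map_tmul] at h
  convert h using 1
  simp only [equiv_sw]
  refine sw_congr fun t b => ?_
  conv_rhs => rw [← sw_mk (comul (R := ℂ) t), ← sw_mk (comul (R := ℂ) b)]
  simp only [sw_tmul', tmul_sw, equiv_sw, TensorProduct.tensorTensorTensorComm_tmul,
    TensorProduct.comm_tmul]
  exact sw_comm _ _ _

theorem RightModuleCoalgebra.comul_act_eq {x : T ⊗[ℂ] B} (hx : x ∈ cotensor X.coact 𝓑.leftR) :
    (sw x fun t b => sw (comul (R := ℂ) t) fun t₁ t₂ => sw (comul (R := ℂ) b) fun b₁ b₂ =>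
      (t₁ ⊗ₜ[ℂ] b₁) ⊗ₜ[ℂ] total X.act (t₂ ⊗ₜ[ℂ] b₂)) ∈ tens (cotensor X.coact 𝓑.leftR) T ∧
    comul (R := ℂ) (total X.act x) =
    sw x fun t b => sw (comul (R := ℂ) t) fun t₁ t₂ => sw (comul (R := ℂ) b) fun b₁ b₂ =>
      total X.act (t₁ ⊗ₜ[ℂ] b₁) ⊗ₜ[ℂ] total X.act (t₂ ⊗ₜ[ℂ] b₂) := by
  obtain ⟨y, h₁, h₂⟩ := X.comul_act ⟨x, hx⟩
  have h := ((appR_iff _ _ _).1 h₁).2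
  have e : y = sw x fun t b => sw (comul (R := ℂ) t) fun t₁ t₂ => sw (comul (R := ℂ) b) fun b₁ b₂ =>
      (t₁ ⊗ₜ[ℂ] b₁) ⊗ₜ[ℂ] total X.act (t₂ ⊗ₜ[ℂ] b₂) := by
    rw [← h, map_eq_sw (TensorProduct.map _ _)]
    simp only [TensorProduct.map_tmul, equiv_sw, map_sw]
    refine sw_congr fun t b => ?_
    conv_lhs => rw [← sw_mk (comul (R := ℂ) t), ← sw_mk (comul (R := ℂ) b)]
    simp only [sw_tmul', tmul_sw, equiv_sw, map_sw, TensorProduct.tensorTensorTensorComm_tmul,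
      LinearMap.lTensor_tmul]
    exact sw_comm _ _ _
  rw [appL_iff] at h₂
  rw [← e]
  refine ⟨h₂.1, ?_⟩
  have h₃ := h₂.2
  rw [← total_coe] at h₃
  rw [← h₃, e]
  simp only [map_sw, LinearMap.rTensor_tmul]

theorem RightModuleCoalgebra.sw_comul_act {x : T ⊗[ℂ] B} (hx : x ∈ cotensor X.coact 𝓑.leftR)
    {F : T → T → Z} (h₁ : ∀ b, Lin fun a => F a b) (h₂ : ∀ a, Lin fun b => F a b) :
    sw (comul (R := ℂ) (total X.act x)) F =
      sw x fun t b => sw (comul (R := ℂ) t) fun t₁ t₂ => sw (comul (R := ℂ) b) fun b₁ b₂ =>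
        F (total X.act (t₁ ⊗ₜ[ℂ] b₁)) (total X.act (t₂ ⊗ₜ[ℂ] b₂)) := by
  rw [(X.comul_act_eq hx).2]
  simp (disch := fun_prop) only [sw_sw, sw_tmul]

end RightModuleCoalgebra

section RightBicoalgebroid

variable {B C Z : Type*} [AddCommGroup B] [Module ℂ B] [Coalgebra ℂ B]
  [AddCommGroup C] [Module ℂ C] [Coalgebra ℂ C] [AddCommMonoid Z] [Module ℂ Z]
  (𝓑 : RightBicoalgebroid B C)

namespace RightBicoalgebroid

theorem sw_unit_right (c : C) {F : B → C → Z} (h₁ : ∀ b, Lin fun a => F a b)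
    (h₂ : ∀ a, Lin fun b => F a b) :
    (sw (Δ (𝓑.unit c)) fun h₁ h₂ => F h₁ (𝓑.α h₂)) = sw (Δ c) fun c₁ c₂ => F (𝓑.unit c₁) c₂ := by
  have h := congrArg (fun z => sw z F) (𝓑.unit_right c)
  simp (disch := fun_prop) only [𝓑.sw_rightR, sw_rTensor] at h
  exact h

theorem sw_mul_left {x : B ⊗[ℂ] B} (hx : x ∈ cotensor 𝓑.rightR 𝓑.leftR)
    {F : C → B → Z} (h₁ : ∀ b, Lin fun a => F a b) (h₂ : ∀ a, Lin fun b => F a b) :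
    (sw (Δ (total 𝓑.mul x)) fun h₁ h₂ => F (𝓑.β h₂) h₁) =
      sw x fun b b' => sw (Δ b) fun b₁ b₂ => F (𝓑.β b₂) (total 𝓑.mul (b₁ ⊗ₜ b')) := by
  have h := congrArg (fun z => sw z F) ((appR_iff _ _ _).1 (𝓑.mul_left ⟨x, hx⟩)).2
  rw [← total_coe] at h
  simp (disch := fun_prop) only [sw_lTensor, sw_assoc, sw_rTensor, 𝓑.sw_leftR] at h
  exact h.symm

theorem sw_mul_right {x : B ⊗[ℂ] B} (hx : x ∈ cotensor 𝓑.rightR 𝓑.leftR)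
    {F : B → C → Z} (h₁ : ∀ b, Lin fun a => F a b) (h₂ : ∀ a, Lin fun b => F a b) :
    (sw (Δ (total 𝓑.mul x)) fun h₁ h₂ => F h₁ (𝓑.α h₂)) =
      sw x fun b b' => sw (Δ b') fun b₁ b₂ => F (total 𝓑.mul (b ⊗ₜ b₁)) (𝓑.α b₂) := by
  have h := congrArg (fun z => sw z F) ((appL_iff _ _ _).1 (𝓑.mul_right ⟨x, hx⟩)).2
  rw [← total_coe] at h
  simp (disch := fun_prop) only [sw_rTensor, sw_assoc_symm, sw_lTensor, 𝓑.sw_rightR] at h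
  exact h.symm

theorem mul_left_mem {x : B ⊗[ℂ] B} (hx : x ∈ cotensor 𝓑.rightR 𝓑.leftR) :
    (sw x fun b b' => sw (Δ b) fun b₁ b₂ => (b₁ ⊗ₜ[ℂ] b') ⊗ₜ[ℂ] 𝓑.β b₂) ∈
      tens (cotensor 𝓑.rightR 𝓑.leftR) C := by
  have h := ((appR_iff _ _ _).1 (𝓑.mul_left ⟨x, hx⟩)).1
  rw [← sw_mk (TensorProduct.comm ℂ _ _ _)] at h
  simp (disch := fun_prop) only [sw_flip, sw_assoc, sw_rTensor, 𝓑.sw_leftR] at h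
  exact h

theorem mul_right_mem {x : B ⊗[ℂ] B} (hx : x ∈ cotensor 𝓑.rightR 𝓑.leftR) :
    (sw x fun b b' => sw (Δ b') fun b₁ b₂ => (b ⊗ₜ[ℂ] b₁) ⊗ₜ[ℂ] 𝓑.α b₂) ∈
      tens (cotensor 𝓑.rightR 𝓑.leftR) C := by
  have h := ((appL_iff _ _ _).1 (𝓑.mul_right ⟨x, hx⟩)).1
  rw [← sw_mk (TensorProduct.assoc ℂ _ _ _ |>.symm _)] at h
  simp (disch := fun_prop) only [sw_assoc_symm, sw_lTensor, 𝓑.sw_rightR] at h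
  exact h

theorem takeuchi_mem {x : B ⊗[ℂ] B} (hx : x ∈ cotensor 𝓑.rightR 𝓑.leftR) :
    (sw x fun b b' => sw (Δ b) fun b₁ b₂ => (b₂ ⊗ₜ[ℂ] b') ⊗ₜ[ℂ] b₁) ∈
      tens (cotensor 𝓑.rightR 𝓑.leftR) B := by
  obtain ⟨y, y', -, h, -⟩ := 𝓑.takeuchi ⟨x, hx⟩
  have h := ((appL_iff _ _ _).1 h).1
  rw [← sw_mk (LinearMap.rTensor _ _ _), equiv_sw] at h
  simp (disch := fun_prop) only [sw_rTensor, LinearMap.comp_apply, LinearEquiv.coe_coe] at h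
  convert h using 1
  refine sw_congr fun b b' => ?_
  rw [← sw_mk (TensorProduct.comm ℂ _ _ _)]
  simp (disch := fun_prop) only [sw_flip, sw_tmul', equiv_sw, TensorProduct.rightComm_tmul]

theorem sw_takeuchi {x : B ⊗[ℂ] B} (hx : x ∈ cotensor 𝓑.rightR 𝓑.leftR)
    {F : B → C → Z} (h₁ : ∀ b, Lin fun a => F a b) (h₂ : ∀ a, Lin fun b => F a b) :
    (sw x fun b b' => sw (Δ b') fun b₁ b₂ => F (total 𝓑.mul (b ⊗ₜ b₂)) (𝓑.β b₁)) =
      sw x fun b b' => sw (Δ b) fun b₁ b₂ => F (total 𝓑.mul (b₂ ⊗ₜ b')) (𝓑.α b₁) := by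
  obtain ⟨y, y', h, h', e⟩ := 𝓑.takeuchi ⟨x, hx⟩
  have e := congrArg (fun z => sw z F) e
  have h := ((appL_iff _ _ _).1 h).2
  have h' := ((appL_iff _ _ _).1 h').2
  rw [← h, ← h'] at e
  rw [equiv_eq_sw (TensorProduct.rightComm ℂ B B B)] at e
  simp (disch := fun_prop) only [sw_lTensor, sw_rTensor, sw_assoc_symm, LinearMap.comp_apply,
    LinearEquiv.coe_coe, sw_flip, sw_sw] at e
  have k (u : B ⊗[ℂ] B) (b : B) :
      (sw (TensorProduct.rightComm ℂ B B B (u ⊗ₜ[ℂ] b)) fun p c =>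
        F (total 𝓑.mul p) (𝓑.α c)) = sw u fun a c => F (total 𝓑.mul (a ⊗ₜ b)) (𝓑.α c) := by
    conv_lhs => rw [← sw_mk u]
    simp (disch := fun_prop) only [sw_tmul', equiv_sw, TensorProduct.rightComm_tmul, sw_sw, sw_tmul]
  refine e.trans ?_
  refine sw_congr fun b b' => ?_
  exact (k _ _).trans (sw_flip _ (by fun_prop) (by fun_prop))

end RightBicoalgebroid

end RightBicoalgebroid

/-! ### Module coalgebras over right bicoalgebroids -/

section RightModuleCoalgebra

variable {B C T Z : Type*} [AddCommGroup B] [Module ℂ B] [Coalgebra ℂ B]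
  [AddCommGroup C] [Module ℂ C] [Coalgebra ℂ C] [AddCommGroup T] [Module ℂ T] [Coalgebra ℂ T]
  [AddCommMonoid Z] [Module ℂ Z]
  {𝓑 : RightBicoalgebroid B C} (X : RightModuleCoalgebra 𝓑 T)

namespace RightModuleCoalgebra

theorem total_act_unit (t : T) :
    total X.act (sw (X.coact t) fun t₀ t₁ => t₀ ⊗ₜ[ℂ] 𝓑.unit t₁) = t := by
  rw [map_sw]
  exact X.sw_act_unit t (F := fun t => t) (by fun_prop)

/-- The linear map `θ : t ↦ ε(t₀) t₁` to `C`. By the cobalanced comultiplication it determines the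
left `C`-coaction of `T`: `t₋₁ ⊗ t₀ = θ(t₁) ⊗ t₂`. -/
noncomputable def theta : T →ₗ[ℂ] C :=
  (TensorProduct.lid ℂ C).toLinearMap ∘ₗ (Coalgebra.counit (R := ℂ) (A := T)).rTensor C ∘ₗ X.coact

theorem theta_eq (t : T) : X.theta t = sw (X.coact t) fun t₀ t₁ => ε t₀ • t₁ := by
  rw [theta, LinearMap.comp_apply, LinearMap.comp_apply]
  conv_lhs => rw [← sw_mk (X.coact t)]
  simp only [map_sw, LinearMap.rTensor_tmul, LinearEquiv.coe_coe, TensorProduct.lid_tmul]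

theorem sw_leftCoact (t : T) {F : C → T → Z} (h₁ : ∀ b, Lin fun a => F a b)
    (h₂ : ∀ a, Lin fun b => F a b) :
    sw (X.leftComodule.coact t) F = sw (Δ t) fun t₁ t₂ => F (X.theta t₁) t₂ := by
  have e := sw_cotensor (X.cobalanced t) (F := fun a b c => ε a • F b c)
    (by fun_prop) (by fun_prop) (by fun_prop)
  calc _ = _ := (sw_counit_left t (F := fun t => sw (X.leftComodule.coact t) F)
        (by fun_prop)).symm
    _ = _ := by simp only [smul_sw]
    _ = _ := e.symm
    _ = _ := sw_congr fun t₁ t₂ => by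
      rw [theta_eq, (h₁ t₂).apply_sw]
      simp only [(h₁ t₂).2]

/-- `θ(t ◁ b) = ε(t) α(b)`. -/
theorem theta_act {x : T ⊗[ℂ] B} (hx : x ∈ cotensor X.coact 𝓑.leftR) :
    X.theta (total X.act x) = sw x fun t b => ε t • 𝓑.α b := by
  rw [theta_eq, X.sw_coact_act hx (by fun_prop) (by fun_prop)]
  have e := tens_congr (X.act_right_mem hx) (F := fun v c => ε (total X.act v) • c)
    (G := fun v c => sw v fun t b => (ε t • ε b) • c) (by fun_prop) (by fun_prop) (by fun_prop)
    (by fun_prop) fun x hx c => by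
      rw [X.counit_total_act hx]
      exact Lin.apply_sw (f := fun k : ℂ => k • c) (by fun_prop) _ _
  simp (disch := fun_prop) only [sw_sw, sw_tmul] at e
  rw [e]
  refine sw_congr fun t b => ?_
  simp only [smul_eq_mul, mul_smul, ← smul_sw]
  rw [sw_counit_left b (F := fun b => 𝓑.α b) (by fun_prop)]

/-- `t ◁ b₂ ⊗ b₁` is defined for `t ⊗ b ∈ T □_C B`. -/
theorem act_comul_mem {x : T ⊗[ℂ] B} (hx : x ∈ cotensor X.coact 𝓑.leftR) :
    (sw x fun t b => sw (Δ b) fun b₁ b₂ => (t ⊗ₜ[ℂ] b₂) ⊗ₜ[ℂ] b₁) ∈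
      tens (cotensor X.coact 𝓑.leftR) B := by
  have e := tens_map (X.comul_act_mem₂ hx) (f := fun a => sw a fun t b => ε t • b) (by fun_prop)
  simp (disch := fun_prop) only [sw_sw, sw_tmul, TensorProduct.tmul_smul, ← smul_sw] at e
  convert e using 1
  refine sw_congr fun t b => ?_
  exact (sw_counit_left t (F := fun t => sw (Δ b) fun b₁ b₂ => (t ⊗ₜ[ℂ] b₂) ⊗ₜ[ℂ] b₁)
    (by fun_prop)).symm

/-- `α(b₁) ⊗ t ◁ b₂` is the left `C`-coaction of `t ◁ b`. -/
theorem sw_leftCoact_act {x : T ⊗[ℂ] B} (hx : x ∈ cotensor X.coact 𝓑.leftR)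
    {F : C → T → Z} (h₁ : ∀ b, Lin fun a => F a b) (h₂ : ∀ a, Lin fun b => F a b) :
    sw (X.leftComodule.coact (total X.act x)) F =
      sw x fun t b => sw (Δ b) fun b₁ b₂ => F (𝓑.α b₁) (total X.act (t ⊗ₜ b₂)) := by
  rw [X.sw_leftCoact _ h₁ h₂, X.sw_comul_act hx (by fun_prop) (by fun_prop)]
  have e := tens_congr (X.comul_act_eq hx).1 (F := fun v t => F (X.theta (total X.act v)) t)
    (G := fun v t => sw v fun t' b => ε t' • F (𝓑.α b) t) (by fun_prop) (by fun_prop) (by fun_prop)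
    (by fun_prop) fun x hx c => by
      rw [X.theta_act hx, (h₁ c).apply_sw]
      simp only [(h₁ c).2]
  simp (disch := fun_prop) only [sw_sw, sw_tmul] at e
  rw [e]
  refine sw_congr fun t b => ?_
  simp only [← smul_sw]
  exact sw_counit_left t (F := fun t => sw (Δ b) fun b₁ b₂ => F (𝓑.α b₁) (total X.act (t ⊗ₜ b₂)))
    (by fun_prop)

/-- The left `C`-coaction of `T` is determined by the module structure:
`t₋₁ ⊗ t₀ = α(η(t₁)₁) ⊗ t₀ ◁ η(t₁)₂`, the subscripts `0, 1` on the right side referring to the right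
`C`-coaction. -/
theorem sw_leftCoact_eq (t : T) {F : C → T → Z} (h₁ : ∀ b, Lin fun a => F a b)
    (h₂ : ∀ a, Lin fun b => F a b) :
    sw (X.leftComodule.coact t) F = sw (X.coact t) fun t₀ t₁ => sw (Δ (𝓑.unit t₁)) fun b₁ b₂ =>
      F (𝓑.α b₁) (total X.act (t₀ ⊗ₜ b₂)) := by
  conv_lhs => rw [← X.total_act_unit t, X.sw_leftCoact_act (X.unit_mem t) h₁ h₂]
  simp (disch := fun_prop) only [sw_sw, sw_tmul]

/-- `η(t₁) b ⊗ t₀` is defined for `t ⊗ b ∈ T □_C B`. -/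
theorem unit_tmul_mem {x : T ⊗[ℂ] B} (hx : x ∈ cotensor X.coact 𝓑.leftR) :
    (sw x fun t b => sw (X.coact t) fun t₀ t₁ => (𝓑.unit t₁ ⊗ₜ[ℂ] b) ⊗ₜ[ℂ] t₀) ∈
      tens (cotensor 𝓑.rightR 𝓑.leftR) T := by
  rw [mem_tens_cotensor]
  simp (disch := fun_prop) only [sw_sw, sw_tmul, 𝓑.sw_rightR]
  calc _ = sw x fun t b => sw (X.coact t) fun t₀ t₁ => sw (X.coact t₀) fun t₀ c =>
        𝓑.unit c ⊗ₜ[ℂ] (t₁ ⊗ₜ[ℂ] (b ⊗ₜ[ℂ] t₀)) := sw_congr fun t b => by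
        rw [X.sw_coassoc t (F := fun t₀ c t₁ => 𝓑.unit c ⊗ₜ[ℂ] (t₁ ⊗ₜ[ℂ] (b ⊗ₜ[ℂ] t₀)))
          (by fun_prop) (by fun_prop) (by fun_prop)]
        exact sw_congr fun t₀ t₁ => 𝓑.sw_unit_right t₁ (F := fun h c =>
          h ⊗ₜ[ℂ] (c ⊗ₜ[ℂ] (b ⊗ₜ[ℂ] t₀))) (by fun_prop) (by fun_prop)
    _ = _ := sw_cotensor hx (F := fun t c b => sw (X.coact t) fun t₀ t₁ =>
        𝓑.unit t₁ ⊗ₜ[ℂ] (c ⊗ₜ[ℂ] (b ⊗ₜ[ℂ] t₀))) (by fun_prop) (by fun_prop) (by fun_prop)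
    _ = _ := sw_congr fun t b => sw_comm _ _ _

/-- The Takeuchi condition for the action on `T`: `t₋₁ ⊗ t₀ ◁ b = β(b₁) ⊗ t ◁ b₂`. -/
theorem sw_takeuchi {x : T ⊗[ℂ] B} (hx : x ∈ cotensor X.coact 𝓑.leftR)
    {F : C → T → Z} (h₁ : ∀ b, Lin fun a => F a b) (h₂ : ∀ a, Lin fun b => F a b) :
    (sw x fun t b => sw (X.leftComodule.coact t) fun c t => F c (total X.act (t ⊗ₜ b))) =
      sw x fun t b => sw (Δ b) fun b₁ b₂ => F (𝓑.β b₁) (total X.act (t ⊗ₜ b₂)) := by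
  have m₁ : (sw x fun t b => sw (X.coact t) fun t₀ t₁ => sw (Δ b) fun b₁ b₂ =>
      (t₀ ⊗ₜ[ℂ] (𝓑.unit t₁ ⊗ₜ[ℂ] b₂)) ⊗ₜ[ℂ] b₁) ∈ tens X.assocDom B := by
    refine X.mem_tens_assocDom ?_ ?_
    · simp (disch := fun_prop) only [sw_sw, sw_tmul]
      refine sw_mem fun t b => ?_
      rw [sw_comm]
      refine sw_mem fun b₁ b₂ => ?_
      rw [← sw_tmul']
      exact tmul_mem_tens (X.unit_mem t) _
    · have h := tens_mem (X.act_comul_mem hx) (F := fun v b₁ => sw v fun t b₂ =>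
        sw (X.coact t) fun t₀ t₁ => (𝓑.unit t₁ ⊗ₜ[ℂ] b₂) ⊗ₜ[ℂ] (t₀ ⊗ₜ[ℂ] b₁))
        (Q := tens (cotensor 𝓑.rightR 𝓑.leftR) (T ⊗[ℂ] B)) (by fun_prop) (by fun_prop)
        fun v hv b => by
          have := tens_map (X.unit_tmul_mem hv) (f := fun t => t ⊗ₜ[ℂ] b) (by fun_prop)
          simp (disch := fun_prop) only [sw_sw, sw_tmul] at this
          exact this
      simp (disch := fun_prop) only [sw_sw, sw_tmul] at h ⊢
      convert h using 1
      exact sw_congr fun t b => sw_comm _ _ _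
  have m₂ : (sw x fun t b => sw (X.coact t) fun t₀ t₁ => sw (Δ (𝓑.unit t₁)) fun h₁ h₂ =>
      (t₀ ⊗ₜ[ℂ] (h₂ ⊗ₜ[ℂ] b)) ⊗ₜ[ℂ] h₁) ∈ tens X.assocDom B := by
    refine X.mem_tens_assocDom ?_ ?_
    · simp (disch := fun_prop) only [sw_sw, sw_tmul]
      refine sw_mem fun t b => ?_
      have h := tens_map (X.act_comul_mem (X.unit_mem t)) (f := fun h => b ⊗ₜ[ℂ] h) (by fun_prop)
      simp (disch := fun_prop) only [sw_sw, sw_tmul] at h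
      exact h
    · have h := tens_mem (X.unit_tmul_mem hx) (F := fun v t => sw v fun b b' =>
        sw (Δ b) fun b₁ b₂ => (b₂ ⊗ₜ[ℂ] b') ⊗ₜ[ℂ] (t ⊗ₜ[ℂ] b₁))
        (Q := tens (cotensor 𝓑.rightR 𝓑.leftR) (T ⊗[ℂ] B)) (by fun_prop) (by fun_prop)
        fun v hv t => by
          have := tens_map (𝓑.takeuchi_mem hv) (f := fun b => t ⊗ₜ[ℂ] b) (by fun_prop)
          simp (disch := fun_prop) only [sw_sw, sw_tmul] at this
          exact this
      simp (disch := fun_prop) only [sw_sw, sw_tmul] at h ⊢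
      exact h
  -- `(t₀ ◁ η(t₁)) ◁ b = t₀ ◁ η(t₁) b` turns the claim into the Takeuchi condition of `𝓑` for
  -- `η(t₁) ⊗ b`
  have a₁ := X.sw_assoc m₁ (F := fun t b => F (𝓑.β b) t) (by fun_prop) (by fun_prop)
  have a₂ := X.sw_assoc m₂ (F := fun t b => F (𝓑.α b) t) (by fun_prop) (by fun_prop)
  have a₃ := tens_congr (X.unit_tmul_mem hx)
    (F := fun v t => sw v fun b b' => sw (Δ b') fun b₁ b₂ =>
      F (𝓑.β b₁) (total X.act (t ⊗ₜ total 𝓑.mul (b ⊗ₜ b₂))))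
    (G := fun v t => sw v fun b b' => sw (Δ b) fun b₁ b₂ =>
      F (𝓑.α b₁) (total X.act (t ⊗ₜ total 𝓑.mul (b₂ ⊗ₜ b'))))
    (by fun_prop) (by fun_prop) (by fun_prop) (by fun_prop)
    fun v hv t => 𝓑.sw_takeuchi hv (F := fun b c => F c (total X.act (t ⊗ₜ b)))
      (by fun_prop) (by fun_prop)
  simp (disch := fun_prop) only [sw_sw, sw_tmul] at a₁ a₂ a₃
  calc _ = _ := sw_congr fun t b => X.sw_leftCoact_eq t
        (F := fun c t => F c (total X.act (t ⊗ₜ b))) (by fun_prop) (by fun_prop)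
    _ = _ := a₂.trans (a₃.symm.trans a₁.symm)
    _ = _ := sw_congr fun t b => by
        rw [sw_comm]
        exact sw_congr fun b₁ b₂ => X.sw_act_unit t
          (F := fun t => F (𝓑.β b₁) (total X.act (t ⊗ₜ b₂))) (by fun_prop)

end RightModuleCoalgebra
end RightModuleCoalgebra

/-! ### The inverse of the Hopf map -/

section RightHopf

variable {B C Z : Type*} [AddCommGroup B] [Module ℂ B] [Coalgebra ℂ B]
  [AddCommGroup C] [Module ℂ C] [Coalgebra ℂ C] [AddCommMonoid Z] [Module ℂ Z]
  (𝓑 : RightHopfCoalgebra B C)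

namespace RightHopfCoalgebra

theorem nu_coe (x : cotensor 𝓑.rightR 𝓑.leftR) :
    (𝓑.nu x).1 = sw x.1 fun b b' => sw (Δ b) fun b₁ b₂ => b₁ ⊗ₜ[ℂ] total 𝓑.mul (b₂ ⊗ₜ b') := by
  rw [← ((appR_iff _ _ _).1 (𝓑.nu_spec x)).2, ← sw_mk (LinearMap.lTensor B _ _)]
  simp (disch := fun_prop) only [sw_lTensor, sw_assoc, sw_rTensor]

theorem nuInv_nu {x : B ⊗[ℂ] B} (hx : x ∈ cotensor 𝓑.rightR 𝓑.leftR) :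
    (sw x fun b b' => sw (Δ b) fun b₁ b₂ =>
      total 𝓑.nuInv (b₁ ⊗ₜ[ℂ] total 𝓑.mul (b₂ ⊗ₜ b'))) = x := by
  have h := total_coe 𝓑.nuInv (𝓑.nu ⟨x, hx⟩)
  rw [nu_coe] at h
  simp only [map_sw] at h
  rw [h]
  simp [nuInv]

theorem nuInv_mem {y : B ⊗[ℂ] B} (hy : y ∈ cotensor 𝓑.rightCop 𝓑.leftCop) :
    total 𝓑.nuInv y ∈ cotensor 𝓑.rightR 𝓑.leftR := by
  rw [total_coe 𝓑.nuInv ⟨y, hy⟩]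
  exact (𝓑.nu.symm ⟨y, hy⟩).2

theorem nu_nuInv {y : B ⊗[ℂ] B} (hy : y ∈ cotensor 𝓑.rightCop 𝓑.leftCop) :
    (sw (total 𝓑.nuInv y) fun b b' => sw (Δ b) fun b₁ b₂ =>
      b₁ ⊗ₜ[ℂ] total 𝓑.mul (b₂ ⊗ₜ b')) = y := by
  rw [total_coe 𝓑.nuInv ⟨y, hy⟩]
  refine (𝓑.nu_coe (𝓑.nu.symm ⟨y, hy⟩)).symm.trans ?_
  rw [LinearEquiv.apply_symm_apply]

/-- For `u ⊗ v ∈ B □_{C_cop} B` and `ν⁻ ⊗ ν⁺ = ν⁻¹(u ⊗ v)`, one has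
`β(ν⁻₂) ⊗ ν⁻₁ ⊗ ν⁺ = β(v₂) ⊗ ν⁻(u, v₁) ⊗ ν⁺(u, v₁)`. -/
theorem sw_nuInv_β {y : B ⊗[ℂ] B} (hy : y ∈ cotensor 𝓑.rightCop 𝓑.leftCop)
    {F : B ⊗[ℂ] B → C → Z} (h₁ : ∀ b, Lin fun a => F a b) (h₂ : ∀ a, Lin fun b => F a b) :
    (sw (total 𝓑.nuInv y) fun k k' => sw (Δ k) fun k₁ k₂ => F (k₁ ⊗ₜ k') (𝓑.β k₂)) =
      sw y fun u v => sw (Δ v) fun v₁ v₂ => F (total 𝓑.nuInv (u ⊗ₜ v₁)) (𝓑.β v₂) := by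
  have hx := 𝓑.nuInv_mem hy
  conv_rhs => rw [← 𝓑.nu_nuInv hy]
  generalize total 𝓑.nuInv y = x at hx
  have e₁ := tens_congr (𝓑.takeuchi_mem hx)
    (F := fun w k => sw (Δ (total 𝓑.mul w)) fun v₁ v₂ => F (total 𝓑.nuInv (k ⊗ₜ v₁)) (𝓑.β v₂))
    (G := fun w k => sw w fun b b' => sw (Δ b) fun b₁ b₂ =>
      F (total 𝓑.nuInv (k ⊗ₜ total 𝓑.mul (b₁ ⊗ₜ b'))) (𝓑.β b₂))
    (by fun_prop) (by fun_prop) (by fun_prop) (by fun_prop)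
    fun w hw k => 𝓑.sw_mul_left hw (F := fun c v => F (total 𝓑.nuInv (k ⊗ₜ v)) c)
      (by fun_prop) (by fun_prop)
  have e₂ := tens_congr (𝓑.mul_left_mem hx)
    (F := fun w c => sw w fun b b' => sw (Δ b) fun b₁ b₂ =>
      F (total 𝓑.nuInv (b₁ ⊗ₜ[ℂ] total 𝓑.mul (b₂ ⊗ₜ b'))) c)
    (G := fun w c => F w c)
    (by fun_prop) (by fun_prop) (by fun_prop) (by fun_prop)
    fun w hw c => by
      conv_rhs => rw [← 𝓑.nuInv_nu hw]
      simp only [(h₁ c).apply_sw]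
  simp (disch := fun_prop) only [sw_sw, sw_tmul] at e₁ e₂ ⊢
  rw [← e₂, e₁]
  exact sw_congr fun b b' => sw_coassoc b (F := fun b₁ b₂ b₃ =>
    F (total 𝓑.nuInv (b₁ ⊗ₜ total 𝓑.mul (b₂ ⊗ₜ b'))) (𝓑.β b₃))
    (by fun_prop) (by fun_prop) (by fun_prop)

/-- For `u ⊗ v ∈ B □_{C_cop} B` and `ν⁻ ⊗ ν⁺ = ν⁻¹(u ⊗ v)`, one has
`ν⁻ ⊗ ν⁺₁ ⊗ α(ν⁺₂) = ν⁻(u, v₁) ⊗ ν⁺(u, v₁) ⊗ α(v₂)`. -/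
theorem sw_nuInv_α {y : B ⊗[ℂ] B} (hy : y ∈ cotensor 𝓑.rightCop 𝓑.leftCop)
    {F : B ⊗[ℂ] B → C → Z} (h₁ : ∀ b, Lin fun a => F a b) (h₂ : ∀ a, Lin fun b => F a b) :
    (sw (total 𝓑.nuInv y) fun k k' => sw (Δ k') fun k₁ k₂ => F (k ⊗ₜ k₁) (𝓑.α k₂)) =
      sw y fun u v => sw (Δ v) fun v₁ v₂ => F (total 𝓑.nuInv (u ⊗ₜ v₁)) (𝓑.α v₂) := by
  have hx := 𝓑.nuInv_mem hy
  conv_rhs => rw [← 𝓑.nu_nuInv hy]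
  generalize total 𝓑.nuInv y = x at hx
  have e₁ := tens_congr (𝓑.takeuchi_mem hx)
    (F := fun w k => sw (Δ (total 𝓑.mul w)) fun v₁ v₂ => F (total 𝓑.nuInv (k ⊗ₜ v₁)) (𝓑.α v₂))
    (G := fun w k => sw w fun b b' => sw (Δ b') fun b₁ b₂ =>
      F (total 𝓑.nuInv (k ⊗ₜ total 𝓑.mul (b ⊗ₜ b₁))) (𝓑.α b₂))
    (by fun_prop) (by fun_prop) (by fun_prop) (by fun_prop)
    fun w hw k => 𝓑.sw_mul_right hw (F := fun v c => F (total 𝓑.nuInv (k ⊗ₜ v)) c)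
      (by fun_prop) (by fun_prop)
  have e₂ := tens_congr (𝓑.mul_right_mem hx)
    (F := fun w c => sw w fun b b' => sw (Δ b) fun b₁ b₂ =>
      F (total 𝓑.nuInv (b₁ ⊗ₜ[ℂ] total 𝓑.mul (b₂ ⊗ₜ b'))) c)
    (G := fun w c => F w c)
    (by fun_prop) (by fun_prop) (by fun_prop) (by fun_prop)
    fun w hw c => by
      conv_rhs => rw [← 𝓑.nuInv_nu hw]
      simp only [(h₁ c).apply_sw]
  simp (disch := fun_prop) only [sw_sw, sw_tmul] at e₁ e₂ ⊢
  rw [← e₂, e₁]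
  exact sw_congr fun b b' => sw_comm _ _ _

/-- For `u ⊗ v ∈ B □_{C_cop} B` and `ν⁻ ⊗ ν⁺ = ν⁻¹(u ⊗ v)`, one has
`ν⁻₁ ⊗ ν⁻₂ ⊗ ν⁺ = u₁ ⊗ ν⁻(u₂, v) ⊗ ν⁺(u₂, v)`. -/
theorem sw_nuInv_comul {y : B ⊗[ℂ] B} (hy : y ∈ cotensor 𝓑.rightCop 𝓑.leftCop)
    {F : B ⊗[ℂ] B → B → Z} (h₁ : ∀ b, Lin fun a => F a b) (h₂ : ∀ a, Lin fun b => F a b) :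
    (sw (total 𝓑.nuInv y) fun k k' => sw (Δ k) fun k₁ k₂ => F (k₂ ⊗ₜ k') k₁) =
      sw y fun u v => sw (Δ u) fun u₁ u₂ => F (total 𝓑.nuInv (u₂ ⊗ₜ v)) u₁ := by
  have hx := 𝓑.nuInv_mem hy
  conv_rhs => rw [← 𝓑.nu_nuInv hy]
  generalize total 𝓑.nuInv y = x at hx
  have e₂ := tens_congr (𝓑.takeuchi_mem hx)
    (F := fun w c => sw w fun b b' => sw (Δ b) fun b₁ b₂ =>
      F (total 𝓑.nuInv (b₁ ⊗ₜ[ℂ] total 𝓑.mul (b₂ ⊗ₜ b'))) c)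
    (G := fun w c => F w c)
    (by fun_prop) (by fun_prop) (by fun_prop) (by fun_prop)
    fun w hw c => by
      conv_rhs => rw [← 𝓑.nuInv_nu hw]
      simp only [(h₁ c).apply_sw]
  simp (disch := fun_prop) only [sw_sw, sw_tmul] at e₂ ⊢
  rw [← e₂]
  exact sw_congr fun b b' => (sw_coassoc b (F := fun b₁ b₂ b₃ =>
    F (total 𝓑.nuInv (b₂ ⊗ₜ total 𝓑.mul (b₃ ⊗ₜ b'))) b₁)
    (by fun_prop) (by fun_prop) (by fun_prop)).symm

end RightHopfCoalgebra
end RightHopf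

/-! ### Left bicoalgebroids and their modules in Sweedler notation -/

section LeftBicoalgebroid

variable {K S Z : Type*} [AddCommGroup K] [Module ℂ K] [Coalgebra ℂ K]
  [AddCommGroup S] [Module ℂ S] [Coalgebra ℂ S] [AddCommMonoid Z] [Module ℂ Z]
  (𝓚 : LeftBicoalgebroid K S)

namespace LeftBicoalgebroid

theorem sw_unit_left (c : S) {F : S → K → Z} (h₁ : ∀ b, Lin fun a => F a b)
    (h₂ : ∀ a, Lin fun b => F a b) :
    (sw (Δ (𝓚.unit c)) fun h₁ h₂ => F (𝓚.α h₁) h₂) = sw (Δ c) fun c₁ c₂ => F c₁ (𝓚.unit c₂) := by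
  have h := congrArg (fun z => sw z F) (𝓚.unit_left c)
  simp (disch := fun_prop) only [𝓚.sw_leftL, sw_lTensor] at h
  exact h

theorem sw_unit_right (c : S) {F : K → S → Z} (h₁ : ∀ b, Lin fun a => F a b)
    (h₂ : ∀ a, Lin fun b => F a b) :
    (sw (Δ (𝓚.unit c)) fun h₁ h₂ => F h₂ (𝓚.β h₁)) = sw (Δ c) fun c₁ c₂ => F (𝓚.unit c₁) c₂ := by
  have h := congrArg (fun z => sw z F) (𝓚.unit_right c)
  simp (disch := fun_prop) only [𝓚.sw_rightL, sw_rTensor] at h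
  exact h

theorem takeuchi_mem₁ {x : K ⊗[ℂ] K} (hx : x ∈ cotensor 𝓚.rightL 𝓚.leftL) :
    (sw x fun k k' => sw (Δ k') fun k₁ k₂ => (k ⊗ₜ[ℂ] k₁) ⊗ₜ[ℂ] k₂) ∈
      tens (cotensor 𝓚.rightL 𝓚.leftL) K := by
  obtain ⟨y, y', h, -, -⟩ := 𝓚.takeuchi ⟨x, hx⟩
  have h := ((appL_iff _ _ _).1 h).1
  rw [← sw_mk (TensorProduct.assoc ℂ _ _ _ |>.symm _)] at h
  simp (disch := fun_prop) only [sw_assoc_symm, sw_lTensor] at h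
  exact h

theorem takeuchi_mem₂ {x : K ⊗[ℂ] K} (hx : x ∈ cotensor 𝓚.rightL 𝓚.leftL) :
    (sw x fun k k' => sw (Δ k) fun k₁ k₂ => (k₁ ⊗ₜ[ℂ] k') ⊗ₜ[ℂ] k₂) ∈
      tens (cotensor 𝓚.rightL 𝓚.leftL) K := by
  obtain ⟨y, y', -, h, -⟩ := 𝓚.takeuchi ⟨x, hx⟩
  have h := ((appL_iff _ _ _).1 h).1
  rw [← sw_mk (LinearMap.rTensor _ _ _), equiv_sw] at h
  simp (disch := fun_prop) only [sw_rTensor] at h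
  convert h using 1
  refine sw_congr fun b b' => ?_
  conv_rhs => rw [← sw_mk (Δ b)]
  simp (disch := fun_prop) only [sw_tmul', equiv_sw, TensorProduct.rightComm_tmul]

theorem sw_takeuchi {x : K ⊗[ℂ] K} (hx : x ∈ cotensor 𝓚.rightL 𝓚.leftL)
    {F : K → S → Z} (h₁ : ∀ b, Lin fun a => F a b) (h₂ : ∀ a, Lin fun b => F a b) :
    (sw x fun k k' => sw (Δ k') fun k₁ k₂ => F (total 𝓚.mul (k ⊗ₜ k₁)) (𝓚.α k₂)) =
      sw x fun k k' => sw (Δ k) fun k₁ k₂ => F (total 𝓚.mul (k₁ ⊗ₜ k')) (𝓚.β k₂) := by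
  obtain ⟨y, y', h, h', e⟩ := 𝓚.takeuchi ⟨x, hx⟩
  have e := congrArg (fun z => sw z F) e
  have h := ((appL_iff _ _ _).1 h).2
  have h' := ((appL_iff _ _ _).1 h').2
  rw [← h, ← h'] at e
  rw [equiv_eq_sw (TensorProduct.rightComm ℂ K K K)] at e
  simp (disch := fun_prop) only [sw_lTensor, sw_rTensor, sw_assoc_symm, sw_sw] at e
  have k (u : K ⊗[ℂ] K) (b : K) :
      (sw (TensorProduct.rightComm ℂ K K K (u ⊗ₜ[ℂ] b)) fun p c =>
        F (total 𝓚.mul p) (𝓚.β c)) = sw u fun a c => F (total 𝓚.mul (a ⊗ₜ b)) (𝓚.β c) := by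
    conv_lhs => rw [← sw_mk u]
    simp (disch := fun_prop) only [sw_tmul', equiv_sw, TensorProduct.rightComm_tmul, sw_sw, sw_tmul]
  exact e.trans (sw_congr fun b b' => k _ _)

end LeftBicoalgebroid

variable (𝓗 : LeftHopfCoalgebra K S)

theorem LeftHopfCoalgebra.nuInv_nu {x : K ⊗[ℂ] K} (hx : x ∈ cotensor 𝓗.rightL 𝓗.leftL) :
    (sw x fun k k' => sw (Δ k') fun k₁ k₂ =>
      total 𝓗.nuInv (total 𝓗.mul (k ⊗ₜ k₁) ⊗ₜ[ℂ] k₂)) = x := by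
  have h := total_coe 𝓗.nuInv (𝓗.nu ⟨x, hx⟩)
  rw [← ((appL_iff _ _ _).1 (𝓗.nu_spec ⟨x, hx⟩)).2, map_eq_sw (total 𝓗.nuInv)] at h
  simp (disch := fun_prop) only [sw_rTensor, sw_assoc_symm, sw_lTensor] at h
  rw [h]
  simp [nuInv]

end LeftBicoalgebroid

section LeftModule

variable {K S M A Z : Type*} [AddCommGroup K] [Module ℂ K] [Coalgebra ℂ K]
  [AddCommGroup S] [Module ℂ S] [Coalgebra ℂ S] [AddCommGroup M] [Module ℂ M]
  [AddCommGroup A] [Module ℂ A] [AddCommMonoid Z] [Module ℂ Z]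
  {𝓚 : LeftBicoalgebroid K S} (N : LeftModule 𝓚 M)

/-- The subspace of `K ⊗ (K ⊗ M)` on which both sides of the associativity law are defined. -/
noncomputable def LeftModule.assocDom : Submodule ℂ (K ⊗[ℂ] (K ⊗[ℂ] M)) :=
  (tens (cotensor 𝓚.rightL 𝓚.leftL) M).comap (TensorProduct.assoc ℂ K K M).symm.toLinearMap ⊓
    (tens (cotensor 𝓚.rightL N.coact) K).comap
      (TensorProduct.comm ℂ K (K ⊗[ℂ] M)).toLinearMap

theorem LeftModule.mem_tens_assocDom {z : (K ⊗[ℂ] (K ⊗[ℂ] M)) ⊗[ℂ] A}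
    (h₁ : (sw z fun w a => sw w fun k p => sw p fun k' m => (k ⊗ₜ[ℂ] k') ⊗ₜ[ℂ] (m ⊗ₜ[ℂ] a)) ∈
      tens (cotensor 𝓚.rightL 𝓚.leftL) (M ⊗[ℂ] A))
    (h₂ : (sw z fun w a => sw w fun k p => sw p fun k' m => (k' ⊗ₜ[ℂ] m) ⊗ₜ[ℂ] (k ⊗ₜ[ℂ] a)) ∈
      tens (cotensor 𝓚.rightL N.coact) (K ⊗[ℂ] A)) :
    z ∈ tens N.assocDom A := by
  refine mem_tens_inf (mem_tens_comap (TensorProduct.assoc ℂ K K M).symm ?_)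
    (mem_tens_comap (TensorProduct.comm ℂ K (K ⊗[ℂ] M)) ?_)
  · have h := tens_tens h₁
    simp (disch := fun_prop) only [sw_sw, sw_tmul] at h
    convert h using 1
    rw [← sw_mk (LinearMap.rTensor A _ z)]
    simp (disch := fun_prop) only [sw_rTensor]
    refine sw_congr fun w a => ?_
    rw [← sw_mk ((TensorProduct.assoc ℂ K K M).symm.toLinearMap w), sw_tmul']
    simp (disch := fun_prop) only [LinearEquiv.coe_coe, sw_assoc_symm]
  · have h := tens_tens h₂
    simp (disch := fun_prop) only [sw_sw, sw_tmul] at h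
    convert h using 1
    rw [← sw_mk (LinearMap.rTensor A _ z)]
    simp (disch := fun_prop) only [sw_rTensor]
    refine sw_congr fun w a => ?_
    rw [← sw_mk ((TensorProduct.comm ℂ K (K ⊗[ℂ] M)).toLinearMap w), sw_tmul']
    simp (disch := fun_prop) only [LinearEquiv.coe_coe, sw_flip]
    refine sw_congr fun m p => ?_
    conv_lhs => rw [← sw_mk p]
    simp only [sw_tmul']

theorem LeftModule.assoc_of_mem {w : K ⊗[ℂ] (K ⊗[ℂ] M)} (hw : w ∈ N.assocDom) :
    (sw w fun k p => total N.act (k ⊗ₜ total N.act p)) =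
      sw w fun k p => sw p fun k' m => total N.act (total 𝓚.mul (k ⊗ₜ k') ⊗ₜ[ℂ] m) := by
  obtain ⟨⟨u, hu⟩, hv⟩ := hw
  obtain ⟨v, hv⟩ := comm_mem_tens.1 hv
  rw [LinearEquiv.coe_coe] at hu
  obtain ⟨y, h₁, h₂⟩ := N.act_assoc u v (by rw [hu, hv, LinearEquiv.apply_symm_apply])
  rw [app_iff, ← rTensor_total, hu] at h₁
  rw [app_iff, ← lTensor_total, hv] at h₂
  have h := h₂.2.trans h₁.2.symm
  rw [map_eq_sw (total N.act), map_eq_sw (total N.act)] at h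
  simpa (disch := fun_prop) only [sw_lTensor, sw_rTensor, sw_assoc_symm] using h

/-- Associativity of the action inside a larger tensor product. -/
theorem LeftModule.sw_assoc {z : (K ⊗[ℂ] (K ⊗[ℂ] M)) ⊗[ℂ] A} (hz : z ∈ tens N.assocDom A)
    {F : M → A → Z} (h₁ : ∀ b, Lin fun a => F a b) (h₂ : ∀ a, Lin fun b => F a b) :
    (sw z fun w a => sw w fun k p => F (total N.act (k ⊗ₜ total N.act p)) a) =
      sw z fun w a => sw w fun k p => sw p fun k' m =>
        F (total N.act (total 𝓚.mul (k ⊗ₜ k') ⊗ₜ[ℂ] m)) a := by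
  refine tens_congr hz (by fun_prop) (by fun_prop) (by fun_prop) (by fun_prop) fun w hw a => ?_
  have h := congrArg (fun m => F m a) (N.assoc_of_mem hw)
  simpa only [(h₁ a).apply_sw] using h

theorem LeftModule.unit_mem (m : M) :
    (sw (N.coact m) fun s m₀ => 𝓚.unit s ⊗ₜ[ℂ] m₀) ∈ cotensor 𝓚.rightL N.coact := by
  have h := ((app_iff _ _ _).1 (N.unit_act m)).1
  rw [← sw_mk (LinearMap.rTensor M _ _)] at h
  simpa (disch := fun_prop) only [sw_rTensor] using h

theorem LeftModule.sw_unit_act (m : M) {F : M → Z} (hF : Lin F) :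
    (sw (N.coact m) fun s m₀ => F (total N.act (𝓚.unit s ⊗ₜ[ℂ] m₀))) = F m := by
  have h := ((app_iff _ _ _).1 (N.unit_act m)).2
  rw [map_eq_sw (total N.act)] at h
  simp (disch := fun_prop) only [sw_rTensor] at h
  conv_rhs => rw [← h, hF.apply_sw]

theorem LeftModule.unit_comul_mem (m : M) :
    (sw (N.coact m) fun s m₀ => sw (Δ (𝓚.unit s)) fun h₁ h₂ => (h₁ ⊗ₜ[ℂ] m₀) ⊗ₜ[ℂ] h₂) ∈
      tens (cotensor 𝓚.rightL N.coact) K := by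
  rw [mem_tens_cotensor]
  simp (disch := fun_prop) only [sw_sw, sw_tmul, 𝓚.sw_rightL]
  calc _ = sw (N.coact m) fun s m₀ => sw (Δ s) fun c₁ c₂ => sw (Δ (𝓚.unit c₁)) fun h₁ h₂ =>
        h₁ ⊗ₜ[ℂ] (c₂ ⊗ₜ[ℂ] (m₀ ⊗ₜ[ℂ] h₂)) := sw_congr fun s m₀ => by
        rw [sw_coassoc (𝓚.unit s) (F := fun h₁ h₂ h₃ =>
          h₂ ⊗ₜ[ℂ] (𝓚.β h₁ ⊗ₜ[ℂ] (m₀ ⊗ₜ[ℂ] h₃))) (by fun_prop) (by fun_prop) (by fun_prop)]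
        exact 𝓚.sw_unit_right s (F := fun h c => sw (Δ h) fun h₁ h₂ =>
          h₁ ⊗ₜ[ℂ] (c ⊗ₜ[ℂ] (m₀ ⊗ₜ[ℂ] h₂))) (by fun_prop) (by fun_prop)
    _ = _ := (N.sw_coassoc m (F := fun c₁ c₂ m₀ => sw (Δ (𝓚.unit c₁)) fun h₁ h₂ =>
        h₁ ⊗ₜ[ℂ] (c₂ ⊗ₜ[ℂ] (m₀ ⊗ₜ[ℂ] h₂))) (by fun_prop) (by fun_prop) (by fun_prop)).symm
    _ = _ := sw_congr fun s m₀ => sw_comm _ _ _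

theorem LeftModule.tmul_unit_mem {x : K ⊗[ℂ] M} (hx : x ∈ cotensor 𝓚.rightL N.coact) :
    (sw x fun k m => sw (N.coact m) fun s m₀ => (k ⊗ₜ[ℂ] 𝓚.unit s) ⊗ₜ[ℂ] m₀) ∈
      tens (cotensor 𝓚.rightL 𝓚.leftL) M := by
  rw [mem_tens_cotensor]
  simp (disch := fun_prop) only [sw_sw, sw_tmul, 𝓚.sw_leftL]
  calc _ = _ := sw_congr fun k m => sw_comm _ _ _
    _ = _ := sw_cotensor hx (F := fun k c m => sw (N.coact m) fun s m₀ =>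
        k ⊗ₜ[ℂ] (c ⊗ₜ[ℂ] (𝓚.unit s ⊗ₜ[ℂ] m₀))) (by fun_prop) (by fun_prop) (by fun_prop)
    _ = _ := sw_congr fun k m => by
        rw [N.sw_coassoc m (F := fun c₁ c₂ m₀ => k ⊗ₜ[ℂ] (c₁ ⊗ₜ[ℂ] (𝓚.unit c₂ ⊗ₜ[ℂ] m₀)))
          (by fun_prop) (by fun_prop) (by fun_prop)]
        exact sw_congr fun s m₀ => (𝓚.sw_unit_left s (F := fun c h =>
          k ⊗ₜ[ℂ] (c ⊗ₜ[ℂ] (h ⊗ₜ[ℂ] m₀))) (by fun_prop) (by fun_prop)).symm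

end LeftModule

/-! ### Stable anti-Yetter-Drinfeld modules in Sweedler notation -/

section SAYD

variable {K S M Z : Type*} [AddCommGroup K] [Module ℂ K] [Coalgebra ℂ K]
  [AddCommGroup S] [Module ℂ S] [Coalgebra ℂ S] [AddCommGroup M] [Module ℂ M]
  [AddCommMonoid Z] [Module ℂ Z] {𝓚 : LeftHopfCoalgebra K S} (N : LeftRightSAYD 𝓚 M)

namespace LeftRightSAYD

theorem sw_right_coact (m : M) {F : M → S → Z} (h₁ : ∀ b, Lin fun a => F a b)
    (h₂ : ∀ a, Lin fun b => F a b) :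
    (sw (N.comodule.coact m) fun m₀ m₁ => F m₀ (𝓚.α m₁)) =
      sw (N.module.coact m) fun s m₀ => sw (Δ (𝓚.unit s)) fun h₁ h₂ =>
        F (total N.module.act (h₁ ⊗ₜ m₀)) (𝓚.α h₂) := by
  have h := congrArg (fun z => sw z F) ((appL_iff _ _ _).1 (N.right_coact m)).2
  rw [equiv_eq_sw (TensorProduct.rightComm ℂ K S M)] at h
  simp (disch := fun_prop) only [sw_rTensor, sw_lTensor, sw_sw, LinearMap.comp_apply] at h
  refine h.symm.trans (sw_congr fun s m₀ => ?_)
  generalize Δ (𝓚.unit s) = u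
  rw [← sw_mk (LinearMap.lTensor K _ u)]
  simp (disch := fun_prop) only [sw_lTensor, sw_tmul', equiv_sw, TensorProduct.rightComm_tmul,
    sw_sw, sw_tmul]
  rfl

theorem sw_left_coact (m : M) {F : S → M → Z} (h₁ : ∀ b, Lin fun a => F a b)
    (h₂ : ∀ a, Lin fun b => F a b) :
    sw (N.module.coact m) F = sw (N.comodule.coact m) fun m₀ m₁ => F (𝓚.β m₁) m₀ := by
  rw [N.left_coact]
  simp (disch := fun_prop) only [sw_flip, sw_lTensor]

theorem sw_ayd {x : K ⊗[ℂ] M} (hx : x ∈ cotensor 𝓚.rightL N.module.coact)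
    {F : M → K → Z} (h₁ : ∀ b, Lin fun a => F a b) (h₂ : ∀ a, Lin fun b => F a b) :
    sw (N.comodule.coact (total N.module.act x)) F =
      sw x fun k m => sw (Δ k) fun k₁ k₂ => sw (N.comodule.coact m) fun m₀ m₁ =>
        sw (total 𝓚.nuInv (m₁ ⊗ₜ k₁)) fun p q =>
          F (total N.module.act (q ⊗ₜ m₀)) (total 𝓚.mul (k₂ ⊗ₜ p)) := by
  obtain ⟨y, z, hy, hz, h⟩ := N.ayd ⟨x, hx⟩
  have hy := ((appR_iff _ _ _).1 hy).2
  have hz := ((appL_iff _ _ _).1 hz).2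
  have h := congrArg (fun z => sw z F) ((appR_iff _ _ _).1 h).2
  rw [← total_coe] at h
  refine h.symm.trans ?_
  have ey : y = sw x fun k m => sw (Δ k) fun k₁ k₂ => sw (N.comodule.coact m) fun m₀ m₁ =>
      (k₂ ⊗ₜ m₀) ⊗ₜ (total 𝓚.nuInv (m₁ ⊗ₜ k₁)) := by
    rw [← hy, map_eq_sw (TensorProduct.map _ _)]
    simp only [TensorProduct.map_tmul, map_sw]
    refine sw_congr fun k m => ?_
    conv_lhs => rw [← sw_mk (Δ k), ← sw_mk (N.comodule.coact m)]
    simp only [sw_tmul', tmul_sw, map_sw, cyc_tmul, LinearMap.lTensor_tmul]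
    exact sw_comm _ _ _
  have ez : z = sw x fun k m => sw (Δ k) fun k₁ k₂ => sw (N.comodule.coact m) fun m₀ m₁ =>
      sw (total 𝓚.nuInv (m₁ ⊗ₜ k₁)) fun p q => total N.module.act (q ⊗ₜ m₀) ⊗ₜ (k₂ ⊗ₜ p) := by
    rw [← hz, ey]
    simp only [map_sw]
    refine sw_congr fun k m => sw_congr fun k₁ k₂ => sw_congr fun m₀ m₁ => ?_
    conv_lhs => rw [← sw_mk (total 𝓚.nuInv _)]
    simp only [tmul_sw, map_sw, shuf_tmul, LinearMap.rTensor_tmul]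
  rw [ez]
  simp (disch := fun_prop) only [sw_lTensor, sw_sw, sw_tmul]

theorem sw_stable (m : M) {F : M → Z} (hF : Lin F) :
    (sw (N.comodule.coact m) fun m₀ m₁ => F (total N.module.act (m₁ ⊗ₜ m₀))) = F m := by
  have h := ((app_iff _ _ _).1 (N.stable m)).2
  rw [map_eq_sw (total N.module.act)] at h
  simp (disch := fun_prop) only [sw_flip] at h
  conv_rhs => rw [← h, hF.apply_sw]

/-- The Takeuchi condition for the action on `M`: `k₁ ▷ m ⊗ β(k₂) = k ▷ m₍₀₎ ⊗ α(m₍₁₎)`. -/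
theorem sw_takeuchi {x : K ⊗[ℂ] M} (hx : x ∈ cotensor 𝓚.rightL N.module.coact)
    {F : M → S → Z} (h₁ : ∀ b, Lin fun a => F a b) (h₂ : ∀ a, Lin fun b => F a b) :
    (sw x fun k m => sw (Δ k) fun k₁ k₂ => F (total N.module.act (k₁ ⊗ₜ m)) (𝓚.β k₂)) =
      sw x fun k m => sw (N.comodule.coact m) fun m₀ m₁ =>
        F (total N.module.act (k ⊗ₜ m₀)) (𝓚.α m₁) := by
  have m₁ : (sw x fun k m => sw (Δ k) fun k₁ k₂ => sw (N.module.coact m) fun s m₀ =>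
      (k₁ ⊗ₜ[ℂ] (𝓚.unit s ⊗ₜ[ℂ] m₀)) ⊗ₜ[ℂ] k₂) ∈ tens N.module.assocDom K := by
    refine N.module.mem_tens_assocDom ?_ ?_
    · have h := tens_mem (N.module.tmul_unit_mem hx) (F := fun v m => sw v fun k k' =>
        sw (Δ k) fun k₁ k₂ => (k₁ ⊗ₜ[ℂ] k') ⊗ₜ[ℂ] (m ⊗ₜ[ℂ] k₂))
        (Q := tens (cotensor 𝓚.rightL 𝓚.leftL) (M ⊗[ℂ] K)) (by fun_prop) (by fun_prop)
        fun v hv m => by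
          have := tens_map (𝓚.takeuchi_mem₂ hv) (f := fun k => m ⊗ₜ[ℂ] k) (by fun_prop)
          simp (disch := fun_prop) only [sw_sw, sw_tmul] at this
          exact this
      simp (disch := fun_prop) only [sw_sw, sw_tmul] at h ⊢
      convert h using 1
      exact sw_congr fun k m => sw_comm _ _ _
    · simp (disch := fun_prop) only [sw_sw, sw_tmul]
      refine sw_mem fun k m => sw_mem fun k₁ k₂ => ?_
      rw [← sw_tmul']
      exact tmul_mem_tens (N.module.unit_mem m) _
  have m₂ : (sw x fun k m => sw (N.module.coact m) fun s m₀ => sw (Δ (𝓚.unit s)) fun h₁ h₂ =>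
      (k ⊗ₜ[ℂ] (h₁ ⊗ₜ[ℂ] m₀)) ⊗ₜ[ℂ] h₂) ∈ tens N.module.assocDom K := by
    refine N.module.mem_tens_assocDom ?_ ?_
    · have h := tens_mem (N.module.tmul_unit_mem hx) (F := fun v m => sw v fun k k' =>
        sw (Δ k') fun k₁ k₂ => (k ⊗ₜ[ℂ] k₁) ⊗ₜ[ℂ] (m ⊗ₜ[ℂ] k₂))
        (Q := tens (cotensor 𝓚.rightL 𝓚.leftL) (M ⊗[ℂ] K)) (by fun_prop) (by fun_prop)
        fun v hv m => by
          have := tens_map (𝓚.takeuchi_mem₁ hv) (f := fun k => m ⊗ₜ[ℂ] k) (by fun_prop)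
          simp (disch := fun_prop) only [sw_sw, sw_tmul] at this
          exact this
      simp (disch := fun_prop) only [sw_sw, sw_tmul] at h ⊢
      exact h
    · simp (disch := fun_prop) only [sw_sw, sw_tmul]
      refine sw_mem fun k m => ?_
      have h := tens_map (N.module.unit_comul_mem m) (f := fun h => k ⊗ₜ[ℂ] h) (by fun_prop)
      simp (disch := fun_prop) only [sw_sw, sw_tmul] at h
      exact h
  -- `k ▷ (η(m₋₁) ▷ m₀) = k η(m₋₁) ▷ m₀` turns the claim into the Takeuchi condition of `𝓚` for
  -- `k ⊗ η(m₋₁)`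
  have a₁ := N.module.sw_assoc m₁ (F := fun m k => F m (𝓚.β k)) (by fun_prop) (by fun_prop)
  have a₂ := N.module.sw_assoc m₂ (F := fun m k => F m (𝓚.α k)) (by fun_prop) (by fun_prop)
  have a₃ := tens_congr (N.module.tmul_unit_mem hx)
    (F := fun v m => sw v fun k k' => sw (Δ k') fun k₁ k₂ =>
      F (total N.module.act (total 𝓚.mul (k ⊗ₜ k₁) ⊗ₜ m)) (𝓚.α k₂))
    (G := fun v m => sw v fun k k' => sw (Δ k) fun k₁ k₂ =>
      F (total N.module.act (total 𝓚.mul (k₁ ⊗ₜ k') ⊗ₜ m)) (𝓚.β k₂))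
    (by fun_prop) (by fun_prop) (by fun_prop) (by fun_prop)
    fun v hv m => 𝓚.sw_takeuchi hv (F := fun k c => F (total N.module.act (k ⊗ₜ m)) c)
      (by fun_prop) (by fun_prop)
  simp (disch := fun_prop) only [sw_sw, sw_tmul] at a₁ a₂ a₃
  calc _ = _ := sw_congr fun k m => sw_congr fun k₁ k₂ => (N.module.sw_unit_act m
          (F := fun m => F (total N.module.act (k₁ ⊗ₜ m)) (𝓚.β k₂)) (by fun_prop)).symm
    _ = _ := a₁.trans ((sw_congr fun k m => sw_comm _ _ _).trans (a₃.symm.trans a₂.symm))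
    _ = _ := sw_congr fun k m => (N.sw_right_coact m
        (F := fun m c => F (total N.module.act (k ⊗ₜ m)) c) (by fun_prop) (by fun_prop)).symm

end LeftRightSAYD
end SAYD

/-! ### Equivariant Galois coextensions in Sweedler notation -/

section Galois

variable {B C T K A Z : Type*} [AddCommGroup B] [Module ℂ B] [Coalgebra ℂ B]
  [AddCommGroup C] [Module ℂ C] [Coalgebra ℂ C] [AddCommGroup T] [Module ℂ T] [Coalgebra ℂ T]
  [AddCommGroup K] [Module ℂ K] [Coalgebra ℂ K] [AddCommGroup A] [Module ℂ A]
  [AddCommMonoid Z] [Module ℂ Z]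
  {𝓑 : RightHopfCoalgebra B C} {X : RightModuleCoalgebra 𝓑.toRightBicoalgebroid T}
  {𝓚 : LeftHopfCoalgebra K X.Quot} {Y : LeftComoduleCoalgebra 𝓚.toLeftBicoalgebroid T}

theorem RightModuleCoalgebra.sw_quotRight (t : T) {F : T → X.Quot → Z}
    (h₁ : ∀ b, Lin fun a => F a b) (h₂ : ∀ a, Lin fun b => F a b) :
    sw (X.quotRight t) F = sw (Δ t) fun t₁ t₂ => F t₁ (X.augIdeal.mkQ t₂) := by
  simp (disch := fun_prop) only [quotRight, LinearMap.comp_apply, sw_lTensor]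

theorem RightModuleCoalgebra.sw_quotLeft (t : T) {F : X.Quot → T → Z}
    (h₁ : ∀ b, Lin fun a => F a b) (h₂ : ∀ a, Lin fun b => F a b) :
    sw (X.quotLeft t) F = sw (Δ t) fun t₁ t₂ => F (X.augIdeal.mkQ t₁) t₂ := by
  simp (disch := fun_prop) only [quotLeft, LinearMap.comp_apply, sw_rTensor]

theorem LeftComoduleCoalgebra.comul_coact_mem (t : T) :
    (sw (Δ t) fun t₁ t₂ => sw (Y.coact t₁) fun k₁ y₁ => sw (Y.coact t₂) fun k₂ y₂ =>
      (k₁ ⊗ₜ[ℂ] k₂) ⊗ₜ[ℂ] (y₁ ⊗ₜ[ℂ] y₂)) ∈ tens (cotensor 𝓚.rightL 𝓚.leftL) (T ⊗[ℂ] T) := by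
  have h := ((appL_iff _ _ _).1 (Y.comul_coact t)).1
  rw [map_eq_sw (TensorProduct.map _ _), equiv_sw] at h
  convert h using 1
  refine sw_congr fun t₁ t₂ => ?_
  rw [TensorProduct.map_tmul]
  conv_rhs => rw [← sw_mk (Y.coact t₁), ← sw_mk (Y.coact t₂)]
  simp only [sw_tmul', tmul_sw, equiv_sw, TensorProduct.tensorTensorTensorComm_tmul]
  exact sw_comm _ _ _

theorem LeftComoduleCoalgebra.sw_comul_coact (t : T) {F : K → T → T → Z}
    (h₁ : ∀ b c, Lin fun a => F a b c)
    (h₂ : ∀ a c, Lin fun b => F a b c) (h₃ : ∀ a b, Lin fun c => F a b c) :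
    (sw (Y.coact t) fun k t₀ => sw (Δ t₀) fun a b => F k a b) =
      sw (Δ t) fun t₁ t₂ => sw (Y.coact t₁) fun k₁ y₁ => sw (Y.coact t₂) fun k₂ y₂ =>
        F (total 𝓚.mul (k₁ ⊗ₜ k₂)) y₁ y₂ := by
  have h := congrArg (fun z => sw z fun k p => sw p fun a b => F k a b)
    ((appL_iff _ _ _).1 (Y.comul_coact t)).2
  have e : (TensorProduct.tensorTensorTensorComm ℂ K T K T
      (TensorProduct.map Y.coact Y.coact (Δ t))) =
      (sw (Δ t) fun t₁ t₂ => sw (Y.coact t₁) fun k₁ y₁ => sw (Y.coact t₂) fun k₂ y₂ =>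
      (k₁ ⊗ₜ[ℂ] k₂) ⊗ₜ[ℂ] (y₁ ⊗ₜ[ℂ] y₂)) := by
    rw [map_eq_sw (TensorProduct.map _ _), equiv_sw]
    refine sw_congr fun t₁ t₂ => ?_
    rw [TensorProduct.map_tmul]
    conv_lhs => rw [← sw_mk (Y.coact t₁), ← sw_mk (Y.coact t₂)]
    simp only [sw_tmul', tmul_sw, equiv_sw, TensorProduct.tensorTensorTensorComm_tmul]
    exact sw_comm _ _ _
  rw [e] at h
  simp (disch := fun_prop) only [sw_rTensor, sw_lTensor, sw_sw, sw_tmul] at h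
  exact h.symm

namespace EquivariantGalois

theorem sw_left_coact (G : EquivariantGalois 𝓑 X 𝓚 Y) (t : T) {F : X.Quot → T → Z}
    (h₁ : ∀ b, Lin fun a => F a b) (h₂ : ∀ a, Lin fun b => F a b) :
    (sw (Y.coact t) fun k t₀ => F (𝓚.α k) t₀) =
      sw (Δ t) fun t₁ t₂ => F (X.augIdeal.mkQ t₁) t₂ := by
  have h := congrArg (fun z => sw z F) (G.left_coact t)
  simp (disch := fun_prop) only [sw_rTensor, X.sw_quotLeft] at h
  exact h

theorem sw_right_coact (G : EquivariantGalois 𝓑 X 𝓚 Y) (t : T) {F : T → X.Quot → Z}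
    (h₁ : ∀ b, Lin fun a => F a b) (h₂ : ∀ a, Lin fun b => F a b) :
    (sw (Y.coact t) fun k t₀ => F t₀ (𝓚.β k)) =
      sw (Δ t) fun t₁ t₂ => F t₁ (X.augIdeal.mkQ t₂) := by
  have h := congrArg (fun z => sw z F) (G.right_coact t)
  simp (disch := fun_prop) only [sw_rTensor, sw_flip, X.sw_quotRight] at h
  exact h

theorem act_coact_mem (G : EquivariantGalois 𝓑 X 𝓚 Y)
    {x : T ⊗[ℂ] B} (hx : x ∈ cotensor X.coact 𝓑.leftR) :
    (sw x fun t b => sw (Y.coact t) fun k t₀ => (t₀ ⊗ₜ[ℂ] b) ⊗ₜ[ℂ] k) ∈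
      tens (cotensor X.coact 𝓑.leftR) K := by
  have h := ((appR_iff _ _ _).1 (G.equivariant ⟨x, hx⟩)).1
  rw [← sw_mk (TensorProduct.comm ℂ _ _ _)] at h
  simp (disch := fun_prop) only [sw_flip, sw_assoc, sw_rTensor] at h
  exact h

theorem sw_coact_act (G : EquivariantGalois 𝓑 X 𝓚 Y) {x : T ⊗[ℂ] B}
    (hx : x ∈ cotensor X.coact 𝓑.leftR)
    {F : K → T → Z} (h₁ : ∀ b, Lin fun a => F a b) (h₂ : ∀ a, Lin fun b => F a b) :
    sw (Y.coact (total X.act x)) F =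
      sw x fun t b => sw (Y.coact t) fun k t₀ => F k (total X.act (t₀ ⊗ₜ b)) := by
  have h := congrArg (fun z => sw z F) ((appR_iff _ _ _).1 (G.equivariant ⟨x, hx⟩)).2
  rw [← total_coe] at h
  simp (disch := fun_prop) only [sw_lTensor, sw_assoc, sw_rTensor] at h
  exact h.symm

/-- The coactions of `K` and of `C` on `T` commute. -/
theorem sw_coact_coact (G : EquivariantGalois 𝓑 X 𝓚 Y) (t : T) {F : K → T → C → Z}
    (h₁ : ∀ b c, Lin fun a => F a b c)
    (h₂ : ∀ a c, Lin fun b => F a b c) (h₃ : ∀ a b, Lin fun c => F a b c) :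
    (sw (X.coact t) fun t₀ c => sw (Y.coact t₀) fun k y => F k y c) =
      sw (Y.coact t) fun k t₀ => sw (X.coact t₀) fun y c => F k y c := by
  have hx := X.unit_mem t
  have e₁ := G.sw_coact_act hx (F := fun k t => sw (X.coact t) fun y c => F k y c)
    (by fun_prop) (by fun_prop)
  rw [X.total_act_unit] at e₁
  have e₂ := tens_congr (G.act_coact_mem hx)
    (F := fun v k => sw (X.coact (total X.act v)) fun y c => F k y c)
    (G := fun v k => sw v fun t b => sw (Δ b) fun b₁ b₂ => F k (total X.act (t ⊗ₜ b₁)) (𝓑.α b₂))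
    (by fun_prop) (by fun_prop) (by fun_prop) (by fun_prop)
    fun x hx k => X.sw_coact_act hx (by fun_prop) (by fun_prop)
  simp (disch := fun_prop) only [sw_sw, sw_tmul] at e₁ e₂
  refine Eq.symm (e₁.trans (e₂.trans ?_))
  calc _ = sw (X.coact t) fun t₀ t₁ => sw (Δ t₁) fun c₁ c₂ => sw (Y.coact t₀) fun k y =>
        F k (total X.act (y ⊗ₜ 𝓑.unit c₁)) c₂ := sw_congr fun t₀ t₁ => by
        rw [sw_comm (Δ t₁)]
        exact sw_congr fun k y => 𝓑.sw_unit_right t₁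
          (F := fun h c => F k (total X.act (y ⊗ₜ h)) c) (by fun_prop) (by fun_prop)
    _ = _ := (X.sw_coassoc t (F := fun t₀ c₁ c₂ => sw (Y.coact t₀) fun k y =>
        F k (total X.act (y ⊗ₜ 𝓑.unit c₁)) c₂) (by fun_prop) (by fun_prop) (by fun_prop)).symm
    _ = _ := sw_congr fun t₀ t₁ => by
        have e := G.sw_coact_act (X.unit_mem t₀) (F := fun k t => F k t t₁)
          (by fun_prop) (by fun_prop)
        rw [X.total_act_unit] at e
        simp (disch := fun_prop) only [sw_sw, sw_tmul] at e
        exact e.symm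

/-- `t₍₋₁₎ ε(t₍₀₎) = η(π(t))`. -/
theorem sw_counit_coact (G : EquivariantGalois 𝓑 X 𝓚 Y) (t : T) {F : K → Z} (hF : Lin F) :
    (sw (Y.coact t) fun k t₀ => ε t₀ • F k) = F (𝓚.unit (X.augIdeal.mkQ t)) := by
  have e₁ (f : K → Z) (hf : Lin f) : f (epsR K T (Y.coact t)) =
      sw (Y.coact t) fun k t₀ => ε t₀ • f k := by
    rw [map_eq_sw (epsR K T), hf.apply_sw]
    simp only [epsR_tmul, hf.2]
  rw [← e₁ F hF, Y.counit_coact', e₁ (fun k => F (𝓚.unit (𝓚.α k))) (by fun_prop),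
    G.sw_left_coact t (F := fun s t => ε t • F (𝓚.unit s)) (by fun_prop) (by fun_prop)]
  exact sw_counit_right t (F := fun t => F (𝓚.unit (X.augIdeal.mkQ t))) (by fun_prop)

theorem can_coe (G : EquivariantGalois 𝓑 X 𝓚 Y) (x : cotensor X.coact 𝓑.leftR) :
    (G.can x).1 = sw x.1 fun t b => sw (Δ t) fun t₁ t₂ => t₁ ⊗ₜ[ℂ] total X.act (t₂ ⊗ₜ b) := by
  rw [← ((appR_iff _ _ _).1 (G.can_spec x)).2, ← sw_mk (LinearMap.lTensor T _ _)]
  simp (disch := fun_prop) only [sw_lTensor, sw_assoc, sw_rTensor]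

theorem comul_tmul_mem (G : EquivariantGalois 𝓑 X 𝓚 Y)
    {x : T ⊗[ℂ] B} (hx : x ∈ cotensor X.coact 𝓑.leftR) :
    (sw x fun t b => sw (Δ t) fun t₁ t₂ => (t₂ ⊗ₜ[ℂ] b) ⊗ₜ[ℂ] t₁) ∈
      tens (cotensor X.coact 𝓑.leftR) T := by
  have h := ((appR_iff _ _ _).1 (G.can_spec ⟨x, hx⟩)).1
  rw [← sw_mk (TensorProduct.comm ℂ _ _ _)] at h
  simp (disch := fun_prop) only [sw_flip, sw_assoc, sw_rTensor] at h
  exact h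

/-- The inverse of the canonical map, as a map to `T ⊗ B`. -/
noncomputable def canInv (G : EquivariantGalois 𝓑 X 𝓚 Y)
    : cotensor X.quotRight X.quotLeft →ₗ[ℂ] T ⊗[ℂ] B :=
  Submodule.subtype _ ∘ₗ G.can.symm.toLinearMap

theorem canInv_can (G : EquivariantGalois 𝓑 X 𝓚 Y)
    {x : T ⊗[ℂ] B} (hx : x ∈ cotensor X.coact 𝓑.leftR) :
    (sw x fun t b => sw (Δ t) fun t₁ t₂ =>
      total G.canInv (t₁ ⊗ₜ[ℂ] total X.act (t₂ ⊗ₜ b))) = x := by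
  have h := total_coe G.canInv (G.can ⟨x, hx⟩)
  rw [can_coe] at h
  simp only [map_sw] at h
  rw [h]
  simp [canInv]

theorem canInv_mem (G : EquivariantGalois 𝓑 X 𝓚 Y)
    {y : T ⊗[ℂ] T} (hy : y ∈ cotensor X.quotRight X.quotLeft) :
    total G.canInv y ∈ cotensor X.coact 𝓑.leftR := by
  rw [total_coe G.canInv ⟨y, hy⟩]
  exact (G.can.symm ⟨y, hy⟩).2

theorem can_canInv (G : EquivariantGalois 𝓑 X 𝓚 Y)
    {y : T ⊗[ℂ] T} (hy : y ∈ cotensor X.quotRight X.quotLeft) :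
    (sw (total G.canInv y) fun t b => sw (Δ t) fun t₁ t₂ =>
      t₁ ⊗ₜ[ℂ] total X.act (t₂ ⊗ₜ b)) = y := by
  rw [total_coe G.canInv ⟨y, hy⟩]
  refine (G.can_coe (G.can.symm ⟨y, hy⟩)).symm.trans ?_
  rw [LinearEquiv.apply_symm_apply]

theorem kappa_eq (G : EquivariantGalois 𝓑 X 𝓚 Y)
    {y : T ⊗[ℂ] T} (hy : y ∈ cotensor X.quotRight X.quotLeft) :
    total G.kappa y = sw (total G.canInv y) fun t b => ε t • b := by
  rw [total_coe G.kappa ⟨y, hy⟩, total_coe G.canInv ⟨y, hy⟩]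
  change TensorProduct.lid ℂ B ((Coalgebra.counit (R := ℂ) (A := T)).rTensor B
    (G.canInv ⟨y, hy⟩)) = _
  conv_lhs => rw [← sw_mk (G.canInv ⟨y, hy⟩)]
  simp only [map_sw, equiv_sw, LinearMap.rTensor_tmul, TensorProduct.lid_tmul]

/-- The canonical map is injective, also inside a larger tensor product. -/
theorem can_injective (G : EquivariantGalois 𝓑 X 𝓚 Y)
    {z z' : (T ⊗[ℂ] B) ⊗[ℂ] A} (hz : z ∈ tens (cotensor X.coact 𝓑.leftR) A)
    (hz' : z' ∈ tens (cotensor X.coact 𝓑.leftR) A)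
    (h : (sw z fun v a => sw v fun t b => sw (Δ t) fun t₁ t₂ =>
        (t₁ ⊗ₜ[ℂ] total X.act (t₂ ⊗ₜ b)) ⊗ₜ[ℂ] a) =
      sw z' fun v a => sw v fun t b => sw (Δ t) fun t₁ t₂ =>
        (t₁ ⊗ₜ[ℂ] total X.act (t₂ ⊗ₜ b)) ⊗ₜ[ℂ] a) : z = z' := by
  have e {w : (T ⊗[ℂ] B) ⊗[ℂ] A} (hw : w ∈ tens (cotensor X.coact 𝓑.leftR) A) :
      (sw w fun v a => sw v fun t b => sw (Δ t) fun t₁ t₂ =>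
        (total G.canInv (t₁ ⊗ₜ[ℂ] total X.act (t₂ ⊗ₜ b))) ⊗ₜ[ℂ] a) = w := by
    conv_rhs => rw [← sw_mk w]
    refine tens_congr hw (by fun_prop) (by fun_prop) (by fun_prop) (by fun_prop) fun x hx a => ?_
    conv_rhs => rw [← G.canInv_can hx]
    simp only [sw_tmul']
  have h' := congrArg (fun z => sw z fun y a => total G.canInv y ⊗ₜ[ℂ] a) h
  simp (disch := fun_prop) only [sw_sw, sw_tmul] at h'
  rwa [e hz, e hz'] at h'

end EquivariantGalois
end Galois

/-! ### The coaction on the cotensor product -/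

section Coaction

variable {B C T K M Z : Type*} [AddCommGroup B] [Module ℂ B] [Coalgebra ℂ B]
  [AddCommGroup C] [Module ℂ C] [Coalgebra ℂ C] [AddCommGroup T] [Module ℂ T] [Coalgebra ℂ T]
  [AddCommGroup K] [Module ℂ K] [Coalgebra ℂ K]
  [AddCommGroup M] [Module ℂ M] [AddCommMonoid Z] [Module ℂ Z]
  {𝓑 : RightHopfCoalgebra B C} {X : RightModuleCoalgebra 𝓑.toRightBicoalgebroid T}
  {𝓚 : LeftHopfCoalgebra K X.Quot} {Y : LeftComoduleCoalgebra 𝓚.toLeftBicoalgebroid T}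

namespace EquivariantGalois

/-- `t₂₍₋₁₎ ▷ m ⊗ t₂₍₀₎ ⊗ t₁` is defined for `m ⊗ t ∈ M □_K T`. -/
theorem comul_coact_tmul_mem (G : EquivariantGalois 𝓑 X 𝓚 Y) (N : LeftRightSAYD 𝓚 M)
    {x : M ⊗[ℂ] T} (hx : x ∈ cotensor N.comodule.coact Y.coact) :
    (sw x fun m t => sw (Δ t) fun t₁ t₂ => sw (Y.coact t₂) fun k t₀ =>
      (k ⊗ₜ[ℂ] m) ⊗ₜ[ℂ] (t₀ ⊗ₜ[ℂ] t₁)) ∈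
      tens (cotensor 𝓚.rightL N.module.coact) (T ⊗[ℂ] T) := by
  rw [mem_tens_cotensor]
  simp (disch := fun_prop) only [sw_sw, sw_tmul, 𝓚.sw_rightL, N.sw_left_coact]
  calc _ = sw x fun m t => sw (Δ t) fun t₁ t₂ => sw (Δ t₂) fun a b => sw (Y.coact a) fun k t₀ =>
        k ⊗ₜ[ℂ] (X.augIdeal.mkQ b ⊗ₜ[ℂ] (m ⊗ₜ[ℂ] (t₀ ⊗ₜ[ℂ] t₁))) :=
      sw_congr fun m t => sw_congr fun t₁ t₂ => by
        rw [← Y.sw_coassoc t₂ (F := fun k₁ k₂ t₀ =>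
          k₂ ⊗ₜ[ℂ] (𝓚.β k₁ ⊗ₜ[ℂ] (m ⊗ₜ[ℂ] (t₀ ⊗ₜ[ℂ] t₁))))
          (by fun_prop) (by fun_prop) (by fun_prop)]
        exact G.sw_right_coact t₂ (F := fun t s => sw (Y.coact t) fun k t₀ =>
          k ⊗ₜ[ℂ] (s ⊗ₜ[ℂ] (m ⊗ₜ[ℂ] (t₀ ⊗ₜ[ℂ] t₁)))) (by fun_prop) (by fun_prop)
    _ = sw x fun m t => sw (Δ t) fun a b => sw (Δ a) fun t₁ t₂ => sw (Y.coact t₂) fun k t₀ =>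
        k ⊗ₜ[ℂ] (X.augIdeal.mkQ b ⊗ₜ[ℂ] (m ⊗ₜ[ℂ] (t₀ ⊗ₜ[ℂ] t₁))) :=
      sw_congr fun m t => (sw_coassoc t (F := fun t₁ a b => sw (Y.coact a) fun k t₀ =>
        k ⊗ₜ[ℂ] (X.augIdeal.mkQ b ⊗ₜ[ℂ] (m ⊗ₜ[ℂ] (t₀ ⊗ₜ[ℂ] t₁))))
        (by fun_prop) (by fun_prop) (by fun_prop)).symm
    _ = sw x fun m t => sw (Y.coact t) fun k' a => sw (Δ a) fun t₁ t₂ =>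
        sw (Y.coact t₂) fun k t₀ => k ⊗ₜ[ℂ] (𝓚.β k' ⊗ₜ[ℂ] (m ⊗ₜ[ℂ] (t₀ ⊗ₜ[ℂ] t₁))) :=
      sw_congr fun m t => (G.sw_right_coact t (F := fun a s => sw (Δ a) fun t₁ t₂ =>
        sw (Y.coact t₂) fun k t₀ => k ⊗ₜ[ℂ] (s ⊗ₜ[ℂ] (m ⊗ₜ[ℂ] (t₀ ⊗ₜ[ℂ] t₁))))
        (by fun_prop) (by fun_prop)).symm
    _ = _ := (sw_cotensor hx (F := fun m k' a => sw (Δ a) fun t₁ t₂ => sw (Y.coact t₂) fun k t₀ =>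
        k ⊗ₜ[ℂ] (𝓚.β k' ⊗ₜ[ℂ] (m ⊗ₜ[ℂ] (t₀ ⊗ₜ[ℂ] t₁))))
        (by fun_prop) (by fun_prop) (by fun_prop)).symm
    _ = _ := sw_congr fun m t => by
        rw [sw_comm]
        exact sw_congr fun t₁ t₂ => sw_comm _ _ _

/-- `t₂₍₀₎ ⊗ t₁ ⊗ t₂₍₋₁₎ ▷ m` lies in `(T □_S T) ⊗ M`, so that `can⁻¹` can be applied. This
rests on the Takeuchi condition for the action on `M`. -/
theorem coact_tmul_mem (G : EquivariantGalois 𝓑 X 𝓚 Y) (N : LeftRightSAYD 𝓚 M)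
    {x : M ⊗[ℂ] T} (hx : x ∈ cotensor N.comodule.coact Y.coact) :
    (sw x fun m t => sw (Δ t) fun t₁ t₂ => sw (Y.coact t₂) fun k t₀ =>
      (t₀ ⊗ₜ[ℂ] t₁) ⊗ₜ[ℂ] total N.module.act (k ⊗ₜ m)) ∈
      tens (cotensor X.quotRight X.quotLeft) M := by
  rw [mem_tens_cotensor]
  simp (disch := fun_prop) only [sw_sw, sw_tmul, X.sw_quotRight, X.sw_quotLeft]
  have e := tens_congr (G.comul_coact_tmul_mem N hx)
    (F := fun v p => sw p fun t₀ t₁ => sw v fun k m => sw (Δ k) fun k₁ k₂ =>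
      t₀ ⊗ₜ[ℂ] (𝓚.β k₂ ⊗ₜ[ℂ] (t₁ ⊗ₜ[ℂ] total N.module.act (k₁ ⊗ₜ m))))
    (G := fun v p => sw p fun t₀ t₁ => sw v fun k m => sw (N.comodule.coact m) fun m₀ m₁ =>
      t₀ ⊗ₜ[ℂ] (𝓚.α m₁ ⊗ₜ[ℂ] (t₁ ⊗ₜ[ℂ] total N.module.act (k ⊗ₜ m₀))))
    (by fun_prop) (by fun_prop) (by fun_prop) (by fun_prop)
    fun v hv p => sw_congr fun t₀ t₁ => N.sw_takeuchi hv
      (F := fun m s => t₀ ⊗ₜ[ℂ] (s ⊗ₜ[ℂ] (t₁ ⊗ₜ[ℂ] m))) (by fun_prop) (by fun_prop)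
  simp (disch := fun_prop) only [sw_sw, sw_tmul] at e
  calc _ = sw x fun m t => sw (Δ t) fun t₁ t₂ => sw (Y.coact t₂) fun k t₀ => sw (Δ k) fun k₁ k₂ =>
        t₀ ⊗ₜ[ℂ] (𝓚.β k₂ ⊗ₜ[ℂ] (t₁ ⊗ₜ[ℂ] total N.module.act (k₁ ⊗ₜ m))) :=
      sw_congr fun m t => sw_congr fun t₁ t₂ => by
        rw [← Y.sw_coassoc t₂ (F := fun k₁ k₂ t₀ =>
          t₀ ⊗ₜ[ℂ] (𝓚.β k₂ ⊗ₜ[ℂ] (t₁ ⊗ₜ[ℂ] total N.module.act (k₁ ⊗ₜ m))))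
          (by fun_prop) (by fun_prop) (by fun_prop)]
        exact sw_congr fun k t₀ => (G.sw_right_coact t₀ (F := fun t s =>
          t ⊗ₜ[ℂ] (s ⊗ₜ[ℂ] (t₁ ⊗ₜ[ℂ] total N.module.act (k ⊗ₜ m))))
          (by fun_prop) (by fun_prop)).symm
    _ = _ := e
    _ = sw x fun m t => sw (N.comodule.coact m) fun m₀ m₁ => sw (Δ t) fun t₁ t₂ =>
        sw (Y.coact t₂) fun k t₀ =>
        t₀ ⊗ₜ[ℂ] (𝓚.α m₁ ⊗ₜ[ℂ] (t₁ ⊗ₜ[ℂ] total N.module.act (k ⊗ₜ m₀))) :=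
      sw_congr fun m t => by
        rw [sw_comm (N.comodule.coact m)]
        exact sw_congr fun t₁ t₂ => sw_comm _ _ _
    _ = _ := sw_cotensor hx (F := fun m k' t => sw (Δ t) fun t₁ t₂ => sw (Y.coact t₂) fun k t₀ =>
        t₀ ⊗ₜ[ℂ] (𝓚.α k' ⊗ₜ[ℂ] (t₁ ⊗ₜ[ℂ] total N.module.act (k ⊗ₜ m))))
        (by fun_prop) (by fun_prop) (by fun_prop)
    _ = sw x fun m t => sw (Δ t) fun a b => sw (Δ b) fun t₁ t₂ => sw (Y.coact t₂) fun k t₀ =>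
        t₀ ⊗ₜ[ℂ] (X.augIdeal.mkQ a ⊗ₜ[ℂ] (t₁ ⊗ₜ[ℂ] total N.module.act (k ⊗ₜ m))) :=
      sw_congr fun m t => G.sw_left_coact t (F := fun s t => sw (Δ t) fun t₁ t₂ =>
        sw (Y.coact t₂) fun k t₀ =>
        t₀ ⊗ₜ[ℂ] (s ⊗ₜ[ℂ] (t₁ ⊗ₜ[ℂ] total N.module.act (k ⊗ₜ m)))) (by fun_prop) (by fun_prop)
    _ = _ := sw_congr fun m t => (sw_coassoc t (F := fun a t₁ t₂ => sw (Y.coact t₂) fun k t₀ =>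
        t₀ ⊗ₜ[ℂ] (X.augIdeal.mkQ a ⊗ₜ[ℂ] (t₁ ⊗ₜ[ℂ] total N.module.act (k ⊗ₜ m))))
        (by fun_prop) (by fun_prop) (by fun_prop)).symm
    _ = _ := sw_congr fun m t => sw_congr fun t₁ t₂ => sw_comm _ _ _

/-- The map `δ : m ⊗ t ↦ can⁻¹(t₂₍₀₎ ⊗ t₁) ⊗ t₂₍₋₁₎ ▷ m` on `M ⊗ T`, which sends `M □_K T` to
`(T □_C B) ⊗ M`. Up to the order of the tensor factors it is the coaction of `M □_K T`, since
`can⁻¹` is left `T`-colinear. -/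
noncomputable def delta (G : EquivariantGalois 𝓑 X 𝓚 Y) (N : LeftRightSAYD 𝓚 M) :
    M ⊗[ℂ] T →ₗ[ℂ] (T ⊗[ℂ] B) ⊗[ℂ] M :=
  Lin.toMap (f := fun x => sw x fun m t => sw (Δ t) fun t₁ t₂ => sw (Y.coact t₂) fun k t₀ =>
    total G.canInv (t₀ ⊗ₜ[ℂ] t₁) ⊗ₜ[ℂ] total N.module.act (k ⊗ₜ m)) (by fun_prop)

theorem delta_eq (G : EquivariantGalois 𝓑 X 𝓚 Y) (N : LeftRightSAYD 𝓚 M)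
    (x : M ⊗[ℂ] T) : G.delta N x =
    sw x fun m t => sw (Δ t) fun t₁ t₂ => sw (Y.coact t₂) fun k t₀ =>
      total G.canInv (t₀ ⊗ₜ[ℂ] t₁) ⊗ₜ[ℂ] total N.module.act (k ⊗ₜ m) := rfl

theorem delta_mem (G : EquivariantGalois 𝓑 X 𝓚 Y) (N : LeftRightSAYD 𝓚 M)
    {x : M ⊗[ℂ] T} (hx : x ∈ cotensor N.comodule.coact Y.coact) :
    G.delta N x ∈ tens (cotensor X.coact 𝓑.leftR) M := by
  have h := tens_mem (G.coact_tmul_mem N hx) (F := fun y m => total G.canInv y ⊗ₜ[ℂ] m)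
    (Q := tens (cotensor X.coact 𝓑.leftR) M) (by fun_prop) (by fun_prop)
    fun y hy m => tmul_mem_tens (G.canInv_mem hy) m
  simp (disch := fun_prop) only [sw_sw, sw_tmul] at h
  exact h

/-- The characterization of `m' ⊗ t' ⊗ b = δ(m ⊗ t)` by
`m' ⊗ t'₁ ⊗ t'₂ ◁ b = t₂₍₋₁₎ ▷ m ⊗ t₂₍₀₎ ⊗ t₁`. -/
theorem sw_delta (G : EquivariantGalois 𝓑 X 𝓚 Y) (N : LeftRightSAYD 𝓚 M)
    {x : M ⊗[ℂ] T} (hx : x ∈ cotensor N.comodule.coact Y.coact)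
    {F : T → T → M → Z} (h₁ : ∀ b c, Lin fun a => F a b c)
    (h₂ : ∀ a c, Lin fun b => F a b c) (h₃ : ∀ a b, Lin fun c => F a b c) :
    (sw (G.delta N x) fun v m => sw v fun t b => sw (Δ t) fun t₁ t₂ =>
        F t₁ (total X.act (t₂ ⊗ₜ b)) m) =
      sw x fun m t => sw (Δ t) fun t₁ t₂ => sw (Y.coact t₂) fun k t₀ =>
        F t₀ t₁ (total N.module.act (k ⊗ₜ m)) := by
  have h := tens_congr (G.coact_tmul_mem N hx)
    (F := fun y m => sw (total G.canInv y) fun t b => sw (Δ t) fun t₁ t₂ =>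
        F t₁ (total X.act (t₂ ⊗ₜ b)) m) (G := fun y m => sw y fun t t' => F t t' m)
    (by fun_prop) (by fun_prop) (by fun_prop) (by fun_prop)
    fun y hy m => by
      have e := congrArg (fun y => sw y fun t t' => F t t' m) (G.can_canInv hy)
      simp (disch := fun_prop) only [sw_sw, sw_tmul] at e
      exact e
  simp (disch := fun_prop) only [sw_sw, sw_tmul] at h
  rw [delta_eq]
  simp (disch := fun_prop) only [sw_sw, sw_tmul]
  exact h

/-- The `K`-coactions of `M` and of `T` agree on `δ(x)`. After `can` has been applied, the
anti-Yetter-Drinfeld condition on `M` yields `ν⁻¹(t₁₍₋₁₎ t₂₍₋₁₎₁ ⊗ t₂₍₋₁₎₂)`, which is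
`t₁₍₋₁₎ ⊗ t₂₍₋₁₎` because `t₁₍₋₁₎ t₂₍₋₁₎₁ ⊗ t₂₍₋₁₎₂` is a value of `ν`. -/
theorem delta_coact (G : EquivariantGalois 𝓑 X 𝓚 Y) (N : LeftRightSAYD 𝓚 M)
    {x : M ⊗[ℂ] T} (hx : x ∈ cotensor N.comodule.coact Y.coact) :
    (sw (G.delta N x) fun v m => sw v fun t b => sw (N.comodule.coact m) fun m₀ m₁ =>
        (t ⊗ₜ[ℂ] b) ⊗ₜ[ℂ] (m₀ ⊗ₜ[ℂ] m₁)) =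
      sw (G.delta N x) fun v m => sw v fun t b => sw (Y.coact t) fun k t₀ =>
        (t₀ ⊗ₜ[ℂ] b) ⊗ₜ[ℂ] (m ⊗ₜ[ℂ] k) := by
  refine G.can_injective ?_ ?_ ?_
  · refine tens_mem (G.delta_mem N hx) (by fun_prop) (by fun_prop) fun v hv m => ?_
    rw [sw_comm]
    refine sw_mem fun m₀ m₁ => ?_
    rw [← sw_tmul', sw_mk]
    exact tmul_mem_tens hv _
  · refine tens_mem (G.delta_mem N hx) (by fun_prop) (by fun_prop) fun v hv m => ?_
    have h := tens_map (G.act_coact_mem hv) (f := fun k => m ⊗ₜ[ℂ] k) (by fun_prop)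
    simp (disch := fun_prop) only [sw_sw, sw_tmul] at h
    exact h
  · simp (disch := fun_prop) only [sw_sw, sw_tmul]
    -- the anti-Yetter-Drinfeld condition for `t₂₍₋₁₎ ▷ m`
    have eA := tens_congr (G.comul_coact_tmul_mem N hx)
      (F := fun v p => sw (N.comodule.coact (total N.module.act v)) fun m₀ m₁ =>
        p ⊗ₜ[ℂ] (m₀ ⊗ₜ[ℂ] m₁))
      (G := fun v p => sw v fun k m => sw (Δ k) fun k₁ k₂ => sw (N.comodule.coact m) fun m₀ m₁ =>
        sw (total 𝓚.nuInv (m₁ ⊗ₜ k₁)) fun q r =>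
          p ⊗ₜ[ℂ] (total N.module.act (r ⊗ₜ m₀) ⊗ₜ[ℂ] total 𝓚.mul (k₂ ⊗ₜ q)))
      (by fun_prop) (by fun_prop) (by fun_prop) (by fun_prop)
      fun v hv p => N.sw_ayd hv (F := fun m₀ m₁ => p ⊗ₜ[ℂ] (m₀ ⊗ₜ[ℂ] m₁))
        (by fun_prop) (by fun_prop)
    -- `ν⁻¹` cancels `ν` on `t₁₍₋₁₎ ⊗ t₂₍₋₁₎`
    have eN (m : M) (t : T) := tens_congr (Y.comul_coact_mem t)
      (F := fun v p => sw p fun y₁ y₂ => sw v fun k k' => sw (Δ k') fun k₁ k₂ =>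
        sw (Δ k₂) fun k₂ k₃ =>
        sw (total 𝓚.nuInv (total 𝓚.mul (k ⊗ₜ k₁) ⊗ₜ k₂)) fun q r =>
          (y₂ ⊗ₜ[ℂ] y₁) ⊗ₜ[ℂ] (total N.module.act (r ⊗ₜ m) ⊗ₜ[ℂ] total 𝓚.mul (k₃ ⊗ₜ q)))
      (G := fun v p => sw p fun y₁ y₂ => sw v fun k k' => sw (Δ k') fun k₁ k₂ =>
          (y₂ ⊗ₜ[ℂ] y₁) ⊗ₜ[ℂ] (total N.module.act (k₁ ⊗ₜ m) ⊗ₜ[ℂ] total 𝓚.mul (k₂ ⊗ₜ k)))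
      (by fun_prop) (by fun_prop) (by fun_prop) (by fun_prop)
      fun v hv p => sw_congr fun y₁ y₂ => by
        have e := tens_congr (𝓚.takeuchi_mem₁ hv)
          (F := fun w k₃ => sw w fun k k' => sw (Δ k') fun k₁ k₂ =>
            sw (total 𝓚.nuInv (total 𝓚.mul (k ⊗ₜ k₁) ⊗ₜ k₂)) fun q r =>
            (y₂ ⊗ₜ[ℂ] y₁) ⊗ₜ[ℂ] (total N.module.act (r ⊗ₜ m) ⊗ₜ[ℂ] total 𝓚.mul (k₃ ⊗ₜ q)))
          (G := fun w k₃ => sw w fun q r =>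
            (y₂ ⊗ₜ[ℂ] y₁) ⊗ₜ[ℂ] (total N.module.act (r ⊗ₜ m) ⊗ₜ[ℂ] total 𝓚.mul (k₃ ⊗ₜ q)))
          (by fun_prop) (by fun_prop) (by fun_prop) (by fun_prop)
          fun w hw k₃ => by
            conv_rhs => rw [← 𝓚.nuInv_nu hw]
            simp (disch := fun_prop) only [sw_sw]
        simp (disch := fun_prop) only [sw_sw, sw_tmul] at e
        refine Eq.trans (sw_congr fun k k' => ?_) e
        exact (sw_coassoc k' (F := fun k₁ k₂ k₃ =>
          sw (total 𝓚.nuInv (total 𝓚.mul (k ⊗ₜ k₁) ⊗ₜ k₂)) fun q r =>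
            (y₂ ⊗ₜ[ℂ] y₁) ⊗ₜ[ℂ] (total N.module.act (r ⊗ₜ m) ⊗ₜ[ℂ] total 𝓚.mul (k₃ ⊗ₜ q)))
          (by fun_prop) (by fun_prop) (by fun_prop)).symm
    -- equivariance: `t₂₍₋₁₎ ⊗ t₂₍₀₎ ◁ b` is the coaction of `t₂ ◁ b`
    have eE := tens_congr (G.delta_mem N hx)
      (F := fun v m => sw v fun t b => sw (Δ t) fun t₁ t₂ => sw (Y.coact t₁) fun k₁ y₁ =>
        sw (Y.coact t₂) fun k₂ y₂ =>
          (y₁ ⊗ₜ[ℂ] total X.act (y₂ ⊗ₜ b)) ⊗ₜ[ℂ] (m ⊗ₜ[ℂ] total 𝓚.mul (k₁ ⊗ₜ k₂)))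
      (G := fun v m => sw v fun t b => sw (Δ t) fun t₁ t₂ => sw (Y.coact t₁) fun k₁ y₁ =>
        sw (Y.coact (total X.act (t₂ ⊗ₜ b))) fun k₂ y₂ =>
          (y₁ ⊗ₜ[ℂ] y₂) ⊗ₜ[ℂ] (m ⊗ₜ[ℂ] total 𝓚.mul (k₁ ⊗ₜ k₂)))
      (by fun_prop) (by fun_prop) (by fun_prop) (by fun_prop)
      fun v hv m => by
        have e := tens_congr (G.comul_tmul_mem hv)
          (F := fun w t₁ => sw w fun t₂ b => sw (Y.coact t₁) fun k₁ y₁ =>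
            sw (Y.coact t₂) fun k₂ y₂ =>
            (y₁ ⊗ₜ[ℂ] total X.act (y₂ ⊗ₜ b)) ⊗ₜ[ℂ] (m ⊗ₜ[ℂ] total 𝓚.mul (k₁ ⊗ₜ k₂)))
          (G := fun w t₁ => sw (Y.coact t₁) fun k₁ y₁ => sw (Y.coact (total X.act w)) fun k₂ y₂ =>
            (y₁ ⊗ₜ[ℂ] y₂) ⊗ₜ[ℂ] (m ⊗ₜ[ℂ] total 𝓚.mul (k₁ ⊗ₜ k₂)))
          (by fun_prop) (by fun_prop) (by fun_prop) (by fun_prop)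
          fun w hw t₁ => by
            rw [sw_comm]
            exact sw_congr fun k₁ y₁ => (G.sw_coact_act hw (F := fun k₂ y₂ =>
              (y₁ ⊗ₜ[ℂ] y₂) ⊗ₜ[ℂ] (m ⊗ₜ[ℂ] total 𝓚.mul (k₁ ⊗ₜ k₂)))
              (by fun_prop) (by fun_prop)).symm
        simp (disch := fun_prop) only [sw_sw, sw_tmul] at e
        exact e
    simp (disch := fun_prop) only [sw_sw, sw_tmul] at eA eN
    calc _ = sw (G.delta N x) fun v m => sw v fun t b => sw (Δ t) fun t₁ t₂ =>
          sw (N.comodule.coact m) fun m₀ m₁ =>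
          (t₁ ⊗ₜ[ℂ] total X.act (t₂ ⊗ₜ b)) ⊗ₜ[ℂ] (m₀ ⊗ₜ[ℂ] m₁) :=
        sw_congr fun v m => sw_congr fun t b => sw_comm _ _ _
      _ = _ := G.sw_delta N hx (F := fun a b m => sw (N.comodule.coact m) fun m₀ m₁ =>
          (a ⊗ₜ[ℂ] b) ⊗ₜ[ℂ] (m₀ ⊗ₜ[ℂ] m₁)) (by fun_prop) (by fun_prop) (by fun_prop)
      _ = _ := eA
      _ = sw x fun m t => sw (N.comodule.coact m) fun m₀ m₁ => sw (Δ t) fun t₁ t₂ =>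
          sw (Y.coact t₂) fun k t₀ => sw (Δ k) fun k₁ k₂ =>
          sw (total 𝓚.nuInv (m₁ ⊗ₜ k₁)) fun q r => (t₀ ⊗ₜ[ℂ] t₁) ⊗ₜ[ℂ]
            (total N.module.act (r ⊗ₜ m₀) ⊗ₜ[ℂ] total 𝓚.mul (k₂ ⊗ₜ q)) :=
        sw_congr fun m t => by
          rw [sw_comm (N.comodule.coact m)]
          refine sw_congr fun t₁ t₂ => ?_
          rw [sw_comm (N.comodule.coact m)]
          exact sw_congr fun k t₀ => sw_comm _ _ _
      _ = _ := sw_cotensor hx (F := fun m k' t => sw (Δ t) fun t₁ t₂ =>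
          sw (Y.coact t₂) fun k t₀ => sw (Δ k) fun k₁ k₂ =>
          sw (total 𝓚.nuInv (k' ⊗ₜ k₁)) fun q r => (t₀ ⊗ₜ[ℂ] t₁) ⊗ₜ[ℂ]
            (total N.module.act (r ⊗ₜ m) ⊗ₜ[ℂ] total 𝓚.mul (k₂ ⊗ₜ q)))
          (by fun_prop) (by fun_prop) (by fun_prop)
      _ = sw x fun m t => sw (Δ t) fun t₁ t₂ => sw (Y.coact t₁) fun k y₁ =>
          sw (Y.coact t₂) fun k' y₂ => sw (Δ k') fun k₁ k₂ => sw (Δ k₂) fun k₂ k₃ =>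
          sw (total 𝓚.nuInv (total 𝓚.mul (k ⊗ₜ k₁) ⊗ₜ k₂)) fun q r =>
          (y₂ ⊗ₜ[ℂ] y₁) ⊗ₜ[ℂ] (total N.module.act (r ⊗ₜ m) ⊗ₜ[ℂ] total 𝓚.mul (k₃ ⊗ₜ q)) :=
        sw_congr fun m t => by
          rw [Y.sw_comul_coact t (F := fun k' t₁ t₂ =>
            sw (Y.coact t₂) fun k t₀ => sw (Δ k) fun k₁ k₂ =>
            sw (total 𝓚.nuInv (k' ⊗ₜ k₁)) fun q r => (t₀ ⊗ₜ[ℂ] t₁) ⊗ₜ[ℂ]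
            (total N.module.act (r ⊗ₜ m) ⊗ₜ[ℂ] total 𝓚.mul (k₂ ⊗ₜ q)))
            (by fun_prop) (by fun_prop) (by fun_prop)]
          refine sw_congr fun t₁ t₂ => sw_congr fun k y₁ => ?_
          exact Y.sw_coassoc t₂ (F := fun k₁ k₂ y₂ => sw (Δ k₂) fun k₂ k₃ =>
            sw (total 𝓚.nuInv (total 𝓚.mul (k ⊗ₜ k₁) ⊗ₜ k₂)) fun q r =>
            (y₂ ⊗ₜ[ℂ] y₁) ⊗ₜ[ℂ] (total N.module.act (r ⊗ₜ m) ⊗ₜ[ℂ] total 𝓚.mul (k₃ ⊗ₜ q)))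
            (by fun_prop) (by fun_prop) (by fun_prop)
      _ = _ := sw_congr fun m t => eN m t
      _ = sw x fun m t => sw (Δ t) fun t₁ t₂ => sw (Y.coact t₂) fun k t₀ =>
          sw (Y.coact t₀) fun k₁ y₁ => sw (Y.coact t₁) fun k₂ y₂ =>
          (y₁ ⊗ₜ[ℂ] y₂) ⊗ₜ[ℂ] (total N.module.act (k ⊗ₜ m) ⊗ₜ[ℂ] total 𝓚.mul (k₁ ⊗ₜ k₂)) :=
        sw_congr fun m t => sw_congr fun t₁ t₂ => by
          rw [Y.sw_coassoc t₂ (F := fun k k₁ y₁ => sw (Y.coact t₁) fun k₂ y₂ => (y₁ ⊗ₜ[ℂ] y₂) ⊗ₜ[ℂ]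
            (total N.module.act (k ⊗ₜ m) ⊗ₜ[ℂ] total 𝓚.mul (k₁ ⊗ₜ k₂)))
            (by fun_prop) (by fun_prop) (by fun_prop), sw_comm (Y.coact t₁)]
          exact sw_congr fun k y₁ => sw_comm _ _ _
      _ = _ := (G.sw_delta N hx (F := fun t t' m => sw (Y.coact t) fun k₁ y₁ =>
          sw (Y.coact t') fun k₂ y₂ =>
          (y₁ ⊗ₜ[ℂ] y₂) ⊗ₜ[ℂ] (m ⊗ₜ[ℂ] total 𝓚.mul (k₁ ⊗ₜ k₂)))
          (by fun_prop) (by fun_prop) (by fun_prop)).symm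
      _ = _ := eE.symm
      _ = _ := sw_congr fun v m => sw_congr fun t b => (Y.sw_comul_coact t (F := fun k a c =>
          (a ⊗ₜ[ℂ] total X.act (c ⊗ₜ b)) ⊗ₜ[ℂ] (m ⊗ₜ[ℂ] k))
          (by fun_prop) (by fun_prop) (by fun_prop)).symm

/-- The values of `δ` lie in `M □_K T`. -/
theorem delta_mem_cotensor (G : EquivariantGalois 𝓑 X 𝓚 Y) (N : LeftRightSAYD 𝓚 M)
    {x : M ⊗[ℂ] T} (hx : x ∈ cotensor N.comodule.coact Y.coact) :
    (sw (G.delta N x) fun v m => sw v fun t b => (m ⊗ₜ[ℂ] t) ⊗ₜ[ℂ] b) ∈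
      tens (cotensor N.comodule.coact Y.coact) B := by
  rw [mem_tens_cotensor]
  have h := congrArg (fun z => sw z fun v p => sw v fun t b => sw p fun m k =>
    m ⊗ₜ[ℂ] (k ⊗ₜ[ℂ] (t ⊗ₜ[ℂ] b))) (G.delta_coact N hx)
  simp (disch := fun_prop) only [sw_sw, sw_tmul] at h ⊢
  exact h

end EquivariantGalois
end Coaction

/-! ### The module structure of the cotensor product -/

section CotensorModule

variable {B C T K A M Z : Type*} [AddCommGroup B] [Module ℂ B] [Coalgebra ℂ B]
  [AddCommGroup C] [Module ℂ C] [Coalgebra ℂ C] [AddCommGroup T] [Module ℂ T]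
  [AddCommGroup K] [Module ℂ K] [Coalgebra ℂ K] [AddCommGroup A] [Module ℂ A]
  [AddCommGroup M] [Module ℂ M] [AddCommMonoid Z] [Module ℂ Z]

namespace RightModule

variable {𝓑 : RightBicoalgebroid B C} (X : RightModule 𝓑 T) (M)

/-- The coaction `m ⊗ t ↦ m ⊗ t₀ ⊗ t₁` of `C` on `M ⊗ T`. -/
noncomputable def coactOn : M ⊗[ℂ] T →ₗ[ℂ] (M ⊗[ℂ] T) ⊗[ℂ] C :=
  (TensorProduct.assoc ℂ M T C).symm.toLinearMap ∘ₗ X.coact.lTensor M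

/-- The map `(m ⊗ t) ⊗ b ↦ m ⊗ t ◁ b` on `(M ⊗ T) ⊗ B`, the action being extended arbitrarily. -/
noncomputable def actOn : (M ⊗[ℂ] T) ⊗[ℂ] B →ₗ[ℂ] M ⊗[ℂ] T :=
  (total X.act).lTensor M ∘ₗ (TensorProduct.assoc ℂ M T B).toLinearMap

variable {M}

theorem sw_coactOn (x : M ⊗[ℂ] T) {F : M ⊗[ℂ] T → C → Z} (h₁ : ∀ b, Lin fun a => F a b)
    (h₂ : ∀ a, Lin fun b => F a b) :
    sw (X.coactOn M x) F = sw x fun m t => sw (X.coact t) fun t₀ c => F (m ⊗ₜ t₀) c := by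
  simp (disch := fun_prop) only [coactOn, LinearMap.comp_apply, LinearEquiv.coe_coe, sw_assoc_symm,
    sw_lTensor]

theorem actOn_eq (x : M ⊗[ℂ] T) (b : B) :
    X.actOn M (x ⊗ₜ b) = sw x fun m t => m ⊗ₜ[ℂ] total X.act (t ⊗ₜ b) := by
  conv_lhs => rw [← sw_mk x]
  simp only [sw_tmul', map_sw, actOn, LinearMap.comp_apply, LinearEquiv.coe_coe,
    TensorProduct.assoc_tmul, LinearMap.lTensor_tmul]

theorem sw_actOn (z : (M ⊗[ℂ] T) ⊗[ℂ] B) {F : M → T → Z} (h₁ : ∀ b, Lin fun a => F a b)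
    (h₂ : ∀ a, Lin fun b => F a b) :
    sw (X.actOn M z) F = sw z fun x b => sw x fun m t => F m (total X.act (t ⊗ₜ b)) := by
  rw [map_eq_sw (X.actOn M)]
  simp (disch := fun_prop) only [sw_sw, actOn_eq, sw_tmul]

/-- `(M ⊗ T) □_C B` is `M ⊗ (T □_C B)`. -/
theorem mem_tens_coactOn {z : ((M ⊗[ℂ] T) ⊗[ℂ] B) ⊗[ℂ] A} :
    z ∈ tens (cotensor (X.coactOn M) 𝓑.leftR) A ↔
      (sw z fun w a => sw w fun x b => sw x fun m t => (t ⊗ₜ[ℂ] b) ⊗ₜ[ℂ] (m ⊗ₜ[ℂ] a)) ∈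
        tens (cotensor X.coact 𝓑.leftR) (M ⊗[ℂ] A) := by
  rw [mem_tens_cotensor, mem_tens_cotensor]
  simp (disch := fun_prop) only [sw_sw, sw_tmul, X.sw_coactOn]
  constructor
  · intro h
    have h' := congrArg (fun u => sw u fun x p => sw x fun m t => sw p fun c p => sw p fun b a =>
      t ⊗ₜ[ℂ] (c ⊗ₜ[ℂ] (b ⊗ₜ[ℂ] (m ⊗ₜ[ℂ] a)))) h
    simp (disch := fun_prop) only [sw_sw, sw_tmul] at h'
    rw [h']
    exact sw_congr fun w a => sw_congr fun x b => sw_comm _ _ _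
  · intro h
    have h' := congrArg (fun u => sw u fun t p => sw p fun c p => sw p fun b p => sw p fun m a =>
      (m ⊗ₜ[ℂ] t) ⊗ₜ[ℂ] (c ⊗ₜ[ℂ] (b ⊗ₜ[ℂ] a))) h
    simp (disch := fun_prop) only [sw_sw, sw_tmul] at h'
    rw [h']
    refine sw_congr fun w a => sw_congr fun x b => ?_
    rw [sw_comm]
    refine sw_congr fun c b => ?_
    rw [← sw_tmul', sw_mk]

theorem mem_coactOn {z : (M ⊗[ℂ] T) ⊗[ℂ] B} :
    z ∈ cotensor (X.coactOn M) 𝓑.leftR ↔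
      (sw z fun x b => sw x fun m t => (t ⊗ₜ[ℂ] b) ⊗ₜ[ℂ] m) ∈
        tens (cotensor X.coact 𝓑.leftR) M := by
  constructor
  · intro h
    have h' := X.mem_tens_coactOn.1 (tmul_mem_tens h (1 : ℂ))
    simp (disch := fun_prop) only [sw_tmul] at h'
    have h'' := tens_map h' (f := fun p => sw p fun m (c : ℂ) => c • m) (by fun_prop)
    simp (disch := fun_prop) only [sw_sw, sw_tmul, one_smul] at h''
    exact h''
  · intro h
    rw [mem_tens_cotensor] at h
    rw [mem_cotensor]
    simp (disch := fun_prop) only [sw_sw, sw_tmul, X.sw_coactOn] at h ⊢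
    have h' := congrArg (fun u => sw u fun t p => sw p fun c p => sw p fun b m =>
      (m ⊗ₜ[ℂ] t) ⊗ₜ[ℂ] (c ⊗ₜ[ℂ] b)) h
    simp (disch := fun_prop) only [sw_sw, sw_tmul] at h'
    rw [h']
    refine sw_congr fun x b => ?_
    rw [sw_comm]
    refine sw_congr fun c b => ?_
    rw [← sw_tmul', sw_mk]

theorem app_actOn
    {z : (M ⊗[ℂ] T) ⊗[ℂ] B} (hz : z ∈ cotensor (X.coactOn M) 𝓑.leftR) :
    AppR X.act (TensorProduct.assoc ℂ M T B z) (X.actOn M z) := by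
  refine (appR_iff _ _ _).2 ⟨?_, rfl⟩
  have h := X.mem_coactOn.1 hz
  rw [← sw_mk (TensorProduct.comm ℂ M (T ⊗[ℂ] B) _)]
  simp (disch := fun_prop) only [sw_flip, CrossHopf.sw_assoc]
  exact h

theorem coactOn_coassoc (x : M ⊗[ℂ] T) :
    (sw (X.coactOn M x) fun v c => sw (X.coactOn M v) fun v₀ v₁ => v₀ ⊗ₜ[ℂ] (v₁ ⊗ₜ[ℂ] c)) =
      sw (X.coactOn M x) fun v c => sw (Δ c) fun c₁ c₂ => v ⊗ₜ[ℂ] (c₁ ⊗ₜ[ℂ] c₂) := by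
  simp (disch := fun_prop) only [X.sw_coactOn, sw_tmul]
  exact sw_congr fun m t => X.sw_coassoc t (F := fun t c c' => (m ⊗ₜ[ℂ] t) ⊗ₜ[ℂ] (c ⊗ₜ[ℂ] c'))
    (by fun_prop) (by fun_prop) (by fun_prop)

theorem coactOn_counit (x : M ⊗[ℂ] T) : (sw (X.coactOn M x) fun v c => ε c • v) = x := by
  simp (disch := fun_prop) only [X.sw_coactOn]
  conv_rhs => rw [← sw_mk x]
  exact sw_congr fun m t => X.sw_counit t (F := fun t => m ⊗ₜ[ℂ] t) (by fun_prop)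

theorem actOn_right_mem {z : (M ⊗[ℂ] T) ⊗[ℂ] B} (hz : z ∈ cotensor (X.coactOn M) 𝓑.leftR) :
    (sw z fun v b => sw (Δ b) fun b₁ b₂ => (v ⊗ₜ[ℂ] b₁) ⊗ₜ[ℂ] 𝓑.α b₂) ∈
      tens (cotensor (X.coactOn M) 𝓑.leftR) C := by
  rw [X.mem_tens_coactOn]
  have h := tens_mem (X.mem_coactOn.1 hz) (F := fun u m => sw u fun t b => sw (Δ b) fun b₁ b₂ =>
    (t ⊗ₜ[ℂ] b₁) ⊗ₜ[ℂ] (m ⊗ₜ[ℂ] 𝓑.α b₂)) (Q := tens (cotensor X.coact 𝓑.leftR) (M ⊗[ℂ] C))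
    (by fun_prop) (by fun_prop) fun u hu m => by
      have h := tens_map (X.act_right_mem hu) (f := fun c => m ⊗ₜ[ℂ] c) (by fun_prop)
      simp (disch := fun_prop) only [sw_sw, sw_tmul] at h
      exact h
  simp (disch := fun_prop) only [sw_sw, sw_tmul] at h ⊢
  convert h using 1
  exact sw_congr fun x b => sw_comm _ _ _

theorem coactOn_actOn {z : (M ⊗[ℂ] T) ⊗[ℂ] B} (hz : z ∈ cotensor (X.coactOn M) 𝓑.leftR) :
    X.coactOn M (X.actOn M z) =
      sw z fun v b => sw (Δ b) fun b₁ b₂ => X.actOn M (v ⊗ₜ b₁) ⊗ₜ[ℂ] 𝓑.α b₂ := by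
  have h := tens_congr (X.mem_coactOn.1 hz)
    (F := fun u m => sw (X.coact (total X.act u)) fun t c => (m ⊗ₜ[ℂ] t) ⊗ₜ[ℂ] c)
    (G := fun u m => sw u fun t b => sw (Δ b) fun b₁ b₂ =>
      (m ⊗ₜ[ℂ] total X.act (t ⊗ₜ b₁)) ⊗ₜ[ℂ] 𝓑.α b₂)
    (by fun_prop) (by fun_prop) (by fun_prop) (by fun_prop)
    fun u hu m => X.sw_coact_act hu (by fun_prop) (by fun_prop)
  rw [← sw_mk (X.coactOn M _)]
  simp (disch := fun_prop) only [X.sw_coactOn, X.sw_actOn, sw_sw, sw_tmul, actOn_eq, sw_tmul']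
    at h ⊢
  rw [h]
  exact sw_congr fun x b => sw_comm _ _ _

theorem actOn_assoc {w : (M ⊗[ℂ] T) ⊗[ℂ] (B ⊗[ℂ] B)}
    (h₁ : (sw w fun v p => sw p fun b b' => (v ⊗ₜ[ℂ] b) ⊗ₜ[ℂ] b') ∈
      tens (cotensor (X.coactOn M) 𝓑.leftR) B)
    (h₂ : (sw w fun v p => p ⊗ₜ[ℂ] v) ∈ tens (cotensor 𝓑.rightR 𝓑.leftR) (M ⊗[ℂ] T)) :
    (sw w fun v p => sw p fun b b' => X.actOn M (v ⊗ₜ b) ⊗ₜ[ℂ] b') ∈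
      cotensor (X.coactOn M) 𝓑.leftR ∧
    (sw w fun v p => v ⊗ₜ[ℂ] total 𝓑.mul p) ∈ cotensor (X.coactOn M) 𝓑.leftR ∧
    (sw w fun v p => sw p fun b b' => X.actOn M (X.actOn M (v ⊗ₜ b) ⊗ₜ[ℂ] b')) =
      sw w fun v p => X.actOn M (v ⊗ₜ[ℂ] total 𝓑.mul p) := by
  have hm : (sw w fun v p => sw v fun m t => (t ⊗ₜ[ℂ] p) ⊗ₜ[ℂ] m) ∈ tens X.assocDom M := by
    refine X.mem_tens_assocDom ?_ ?_
    · have h := tens_map (X.mem_tens_coactOn.1 h₁)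
        (f := fun p => TensorProduct.comm ℂ M B p) (by fun_prop)
      simp (disch := fun_prop) only [sw_sw, sw_tmul, TensorProduct.comm_tmul] at h ⊢
      convert h using 1
      exact sw_congr fun x b => sw_comm _ _ _
    · have h := tens_map h₂ (f := fun v => TensorProduct.comm ℂ M T v) (by fun_prop)
      simp (disch := fun_prop) only [sw_sw, sw_tmul] at h ⊢
      convert h using 1
      refine sw_congr fun v p => ?_
      rw [equiv_eq_sw (TensorProduct.comm ℂ M T) v, tmul_sw]
      refine sw_congr fun m t => ?_
      conv_rhs => rw [← sw_mk p]
      simp only [sw_tmul', TensorProduct.comm_tmul]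
  refine ⟨?_, ?_, ?_⟩
  · rw [X.mem_coactOn]
    have h := X.act_act_mem hm
    simp (disch := fun_prop) only [sw_sw, sw_tmul, actOn_eq, sw_tmul'] at h ⊢
    convert h using 1
    exact sw_congr fun x b => sw_comm _ _ _
  · rw [X.mem_coactOn]
    have h := X.act_mul_mem hm
    simp (disch := fun_prop) only [sw_sw, sw_tmul] at h ⊢
    exact h
  · have h := X.sw_assoc hm (F := fun t m => m ⊗ₜ[ℂ] t) (by fun_prop) (by fun_prop)
    simp (disch := fun_prop) only [sw_sw, sw_tmul, actOn_eq, sw_tmul', map_sw] at h ⊢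
    rw [← h]
    exact sw_congr fun x b => sw_comm _ _ _

theorem actOn_unit (x : M ⊗[ℂ] T) :
    (sw (X.coactOn M x) fun v c => v ⊗ₜ[ℂ] 𝓑.unit c) ∈ cotensor (X.coactOn M) 𝓑.leftR ∧
    X.actOn M (sw (X.coactOn M x) fun v c => v ⊗ₜ[ℂ] 𝓑.unit c) = x := by
  constructor
  · rw [X.mem_coactOn]
    simp (disch := fun_prop) only [X.sw_coactOn, sw_sw, sw_tmul]
    refine sw_mem fun m t => ?_
    rw [← sw_tmul']
    exact tmul_mem_tens (X.unit_mem t) m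
  · rw [map_sw]
    simp (disch := fun_prop) only [X.sw_coactOn, actOn_eq, sw_tmul]
    conv_rhs => rw [← sw_mk x]
    exact sw_congr fun m t => X.sw_act_unit t (F := fun t => m ⊗ₜ[ℂ] t) (by fun_prop)

end RightModule

namespace EquivariantGalois

variable [Coalgebra ℂ T] {𝓑 : RightHopfCoalgebra B C}
  {X : RightModuleCoalgebra 𝓑.toRightBicoalgebroid T}
  {𝓚 : LeftHopfCoalgebra K X.Quot} {Y : LeftComoduleCoalgebra 𝓚.toLeftBicoalgebroid T}

theorem coactOn_mem (G : EquivariantGalois 𝓑 X 𝓚 Y) (N : RightComodule K M)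
    {x : M ⊗[ℂ] T} (hx : x ∈ cotensor N.coact Y.coact) :
    X.coactOn M x ∈ tens (cotensor N.coact Y.coact) C := by
  rw [mem_tens_cotensor]
  simp (disch := fun_prop) only [X.sw_coactOn, sw_tmul]
  calc _ = sw x fun m t => sw (N.coact m) fun m₀ m₁ => sw (X.coact t) fun t₀ c =>
        m₀ ⊗ₜ[ℂ] (m₁ ⊗ₜ[ℂ] (t₀ ⊗ₜ[ℂ] c)) := sw_congr fun m t => sw_comm _ _ _
    _ = _ := sw_cotensor hx (F := fun m k t => sw (X.coact t) fun t₀ c =>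
        m ⊗ₜ[ℂ] (k ⊗ₜ[ℂ] (t₀ ⊗ₜ[ℂ] c))) (by fun_prop) (by fun_prop) (by fun_prop)
    _ = _ := sw_congr fun m t => (G.sw_coact_coact t (F := fun k t c =>
        m ⊗ₜ[ℂ] (k ⊗ₜ[ℂ] (t ⊗ₜ[ℂ] c))) (by fun_prop) (by fun_prop) (by fun_prop)).symm

theorem actOn_mem (G : EquivariantGalois 𝓑 X 𝓚 Y) (N : RightComodule K M)
    {z : (M ⊗[ℂ] T) ⊗[ℂ] B} (hz : z ∈ tens (cotensor N.coact Y.coact) B)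
    (hz' : z ∈ cotensor (X.coactOn M) 𝓑.leftR) :
    X.actOn M z ∈ cotensor N.coact Y.coact := by
  rw [mem_cotensor]
  simp (disch := fun_prop) only [X.sw_actOn]
  have h := tens_congr (X.mem_coactOn.1 hz')
    (F := fun u m => sw (Y.coact (total X.act u)) fun k t => m ⊗ₜ[ℂ] (k ⊗ₜ[ℂ] t))
    (G := fun u m => sw u fun t b => sw (Y.coact t) fun k t =>
      m ⊗ₜ[ℂ] (k ⊗ₜ[ℂ] total X.act (t ⊗ₜ b)))
    (by fun_prop) (by fun_prop) (by fun_prop) (by fun_prop)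
    fun u hu m => G.sw_coact_act hu (by fun_prop) (by fun_prop)
  have h' := sw_tens_cotensor hz (F := fun m k t b => m ⊗ₜ[ℂ] (k ⊗ₜ[ℂ] total X.act (t ⊗ₜ b)))
    (by fun_prop) (by fun_prop) (by fun_prop) (by fun_prop)
  simp (disch := fun_prop) only [sw_sw, sw_tmul] at h
  rw [h, h']

end EquivariantGalois
end CotensorModule

/-! ### Counit, stability and the base coactions -/

section CotensorComodule

variable {B C T K M Z : Type*} [AddCommGroup B] [Module ℂ B] [Coalgebra ℂ B]
  [AddCommGroup C] [Module ℂ C] [Coalgebra ℂ C] [AddCommGroup T] [Module ℂ T] [Coalgebra ℂ T]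
  [AddCommGroup K] [Module ℂ K] [Coalgebra ℂ K]
  [AddCommGroup M] [Module ℂ M] [AddCommMonoid Z] [Module ℂ Z]
  {𝓑 : RightHopfCoalgebra B C} {X : RightModuleCoalgebra 𝓑.toRightBicoalgebroid T}
  {𝓚 : LeftHopfCoalgebra K X.Quot} {Y : LeftComoduleCoalgebra 𝓚.toLeftBicoalgebroid T}

/-- Stability of `M` on `M □_K T`: `t₍₋₁₎ ▷ m ⊗ t₍₀₎ = m ⊗ t`. -/
theorem LeftRightSAYD.sw_stable_cotensor (N : LeftRightSAYD 𝓚 M) {x : M ⊗[ℂ] T}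
    (hx : x ∈ cotensor N.comodule.coact Y.coact) {F : M → T → Z}
    (h₁ : ∀ b, Lin fun a => F a b) (h₂ : ∀ a, Lin fun b => F a b) :
    (sw x fun m t => sw (Y.coact t) fun k t₀ => F (total N.module.act (k ⊗ₜ m)) t₀) = sw x F :=
  (sw_cotensor hx (F := fun m k t => F (total N.module.act (k ⊗ₜ m)) t)
    (by fun_prop) (by fun_prop) (by fun_prop)).symm.trans
    (sw_congr fun m t => N.sw_stable m (F := fun m => F m t) (by fun_prop))

/-- `α(η(t₁)₁) ⊗ m ⊗ t₀ ◁ η(t₁)₂` is defined. -/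
theorem RightModuleCoalgebra.unit_mem_coactOn
    (X : RightModuleCoalgebra 𝓑.toRightBicoalgebroid T) (x : M ⊗[ℂ] T) :
    (sw (X.coactOn M x) fun v c => sw (Δ (𝓑.unit c)) fun b₁ b₂ => (v ⊗ₜ[ℂ] b₂) ⊗ₜ[ℂ] 𝓑.α b₁) ∈
      tens (cotensor (X.coactOn M) 𝓑.leftR) C := by
  rw [X.mem_tens_coactOn]
  simp (disch := fun_prop) only [X.sw_coactOn, sw_sw, sw_tmul]
  refine sw_mem fun m t => ?_
  have h := tens_map (X.act_comul_mem (X.unit_mem t)) (f := fun b => m ⊗ₜ[ℂ] 𝓑.α b) (by fun_prop)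
  simp (disch := fun_prop) only [sw_sw, sw_tmul] at h
  exact h

namespace EquivariantGalois

/-- A function of `t₁` and `t₂ ◁ b` that depends on `t₂` only through `ε(t₂)` is a function of
`t ⊗ b`. -/
theorem sw_can_counit (G : EquivariantGalois 𝓑 X 𝓚 Y) {x : T ⊗[ℂ] B}
    (hx : x ∈ cotensor X.coact 𝓑.leftR) {F : T → T → Z} {F' : T → B → Z}
    (h₁ : ∀ b, Lin fun a => F a b) (h₂ : ∀ a, Lin fun b => F a b)
    (h₁' : ∀ b, Lin fun a => F' a b) (h₂' : ∀ a, Lin fun b => F' a b)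
    (h : ∀ u ∈ cotensor X.coact 𝓑.leftR, ∀ a,
      F a (total X.act u) = sw u fun t b => ε t • F' a b) :
    (sw x fun t b => sw (Δ t) fun t₁ t₂ => F t₁ (total X.act (t₂ ⊗ₜ b))) = sw x F' := by
  have e := tens_congr (G.comul_tmul_mem hx) (F := fun u a => F a (total X.act u))
    (G := fun u a => sw u fun t b => ε t • F' a b)
    (by fun_prop) (by fun_prop) (by fun_prop) (by fun_prop) h
  simp (disch := fun_prop) only [sw_sw, sw_tmul] at e
  rw [e]
  exact sw_congr fun t b => sw_counit_right t (F := fun t => F' t b) (by fun_prop)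

/-- `ε(b) m' ⊗ t' = m ⊗ t` for `m' ⊗ t' ⊗ b = δ(m ⊗ t)`. -/
theorem sw_delta_counit (G : EquivariantGalois 𝓑 X 𝓚 Y) (N : LeftRightSAYD 𝓚 M) {x : M ⊗[ℂ] T}
    (hx : x ∈ cotensor N.comodule.coact Y.coact) {F : M → T → Z}
    (h₁ : ∀ b, Lin fun a => F a b) (h₂ : ∀ a, Lin fun b => F a b) :
    (sw (G.delta N x) fun v m => sw v fun t b => ε b • F m t) = sw x F := by
  have e := G.sw_delta N hx (F := fun t t' m => ε t' • F m t)
    (by fun_prop) (by fun_prop) (by fun_prop)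
  refine Eq.trans ?_ (e.trans ?_)
  · refine (tens_congr (G.delta_mem N hx) (by fun_prop) (by fun_prop) (by fun_prop) (by fun_prop)
      fun v hv m => ?_).symm
    refine G.sw_can_counit hv (F := fun t t' => ε t' • F m t) (F' := fun t b => ε b • F m t)
      (by fun_prop) (by fun_prop) (by fun_prop) (by fun_prop) fun u hu a => ?_
    rw [X.counit_total_act hu, Lin.apply_sw (f := fun c : ℂ => c • F m a) (by fun_prop)]
    simp only [smul_assoc]
  · rw [← N.sw_stable_cotensor hx h₁ h₂]
    refine sw_congr fun m t => ?_
    simp only [← smul_sw]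
    exact sw_counit_left t (F := fun t => sw (Y.coact t) fun k t₀ =>
      F (total N.module.act (k ⊗ₜ m)) t₀) (by fun_prop)

/-- `m' ⊗ t' ⊗ β(b) = m ⊗ t₀ ⊗ t₁` for `m' ⊗ t' ⊗ b = δ(m ⊗ t)`. -/
theorem sw_delta_β (G : EquivariantGalois 𝓑 X 𝓚 Y) (N : LeftRightSAYD 𝓚 M) {x : M ⊗[ℂ] T}
    (hx : x ∈ cotensor N.comodule.coact Y.coact) {F : M → T → C → Z}
    (h₁ : ∀ b c, Lin fun a => F a b c)
    (h₂ : ∀ a c, Lin fun b => F a b c) (h₃ : ∀ a b, Lin fun c => F a b c) :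
    (sw (G.delta N x) fun v m => sw v fun t b => F m t (𝓑.β b)) =
      sw x fun m t => sw (X.coact t) fun t₀ c => F m t₀ c := by
  rw [← G.sw_delta_counit N hx (F := fun m t => sw (X.coact t) fun t₀ c => F m t₀ c)
    (by fun_prop) (by fun_prop)]
  refine tens_congr (G.delta_mem N hx) (by fun_prop) (by fun_prop) (by fun_prop) (by fun_prop)
    fun v hv m => ?_
  have e := sw_cotensor hv (F := fun t c b => ε b • F m t c)
    (by fun_prop) (by fun_prop) (by fun_prop)
  simp (disch := fun_prop) only [𝓑.sw_leftR] at e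
  simp only [smul_sw]
  rw [e]
  exact sw_congr fun t b =>
    (sw_counit_left b (F := fun b => F m t (𝓑.β b)) (by fun_prop)).symm

/-- `m' ⊗ t' ◁ b = m ⊗ t` for `m' ⊗ t' ⊗ b = δ(m ⊗ t)`. -/
theorem sw_delta_act (G : EquivariantGalois 𝓑 X 𝓚 Y) (N : LeftRightSAYD 𝓚 M) {x : M ⊗[ℂ] T}
    (hx : x ∈ cotensor N.comodule.coact Y.coact) {F : M → T → Z}
    (h₁ : ∀ b, Lin fun a => F a b) (h₂ : ∀ a, Lin fun b => F a b) :
    (sw (G.delta N x) fun v m => sw v fun t b => F m (total X.act (t ⊗ₜ b))) = sw x F := by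
  have e := G.sw_delta N hx (F := fun t t' m => ε t • F m t')
    (by fun_prop) (by fun_prop) (by fun_prop)
  calc _ = _ := sw_congr fun v m => sw_congr fun t b =>
        (sw_counit_left t (F := fun t => F m (total X.act (t ⊗ₜ b))) (by fun_prop)).symm
    _ = _ := e
    _ = sw x fun m t => sw (Y.coact t) fun k t₀ =>
        F (total N.module.act (𝓚.unit (𝓚.β k) ⊗ₜ m)) t₀ := sw_congr fun m t => by
        rw [G.sw_right_coact t (F := fun t s => F (total N.module.act (𝓚.unit s ⊗ₜ m)) t)
          (by fun_prop) (by fun_prop)]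
        exact sw_congr fun t₁ t₂ => G.sw_counit_coact t₂
          (F := fun k => F (total N.module.act (k ⊗ₜ m)) t₁) (by fun_prop)
    _ = _ := (sw_cotensor hx (F := fun m k t =>
        F (total N.module.act (𝓚.unit (𝓚.β k) ⊗ₜ m)) t)
        (by fun_prop) (by fun_prop) (by fun_prop)).symm
    _ = _ := sw_congr fun m t => by
        rw [← N.module.sw_unit_act m (F := fun m => F m t) (by fun_prop)]
        exact (N.sw_left_coact m (F := fun s m => F (total N.module.act (𝓚.unit s ⊗ₜ m)) t)
          (by fun_prop) (by fun_prop)).symm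

/-- `M □_K T` is stable under the left `C`-coaction of `T`, since the latter is given by the module
structure. -/
theorem leftCoact_mem (G : EquivariantGalois 𝓑 X 𝓚 Y) (N : LeftRightSAYD 𝓚 M) {x : M ⊗[ℂ] T}
    (hx : x ∈ cotensor N.comodule.coact Y.coact) :
    (sw x fun m t => sw (X.leftComodule.coact t) fun c t₀ => (m ⊗ₜ[ℂ] t₀) ⊗ₜ[ℂ] c) ∈
      tens (cotensor N.comodule.coact Y.coact) C := by
  have h := X.unit_mem_coactOn x
  have h' : (sw (X.coactOn M x) fun v c => sw (Δ (𝓑.unit c)) fun b₁ b₂ =>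
      (v ⊗ₜ[ℂ] b₂) ⊗ₜ[ℂ] 𝓑.α b₁) ∈ tens (tens (cotensor N.comodule.coact Y.coact) B) C :=
    tens_mem (G.coactOn_mem N.comodule hx) (F := fun v c => sw (Δ (𝓑.unit c)) fun b₁ b₂ =>
      (v ⊗ₜ[ℂ] b₂) ⊗ₜ[ℂ] 𝓑.α b₁) (by fun_prop) (by fun_prop) fun v hv c =>
      sw_mem (Q := tens (tens _ B) C) fun b₁ b₂ => tmul_mem_tens (tmul_mem_tens hv _) _
  have h'' := tens_mem (mem_tens_inf h h') (F := fun z c => X.actOn M z ⊗ₜ[ℂ] c)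
    (Q := tens (cotensor N.comodule.coact Y.coact) C) (by fun_prop) (by fun_prop)
    fun z hz c => tmul_mem_tens (G.actOn_mem N.comodule hz.2 hz.1) c
  simp (disch := fun_prop) only [sw_sw, sw_tmul, X.sw_coactOn, X.actOn_eq] at h''
  convert h'' using 1
  exact sw_congr fun m t => X.sw_leftCoact_eq t (F := fun c t => (m ⊗ₜ[ℂ] t) ⊗ₜ[ℂ] c)
    (by fun_prop) (by fun_prop)

/-- `α(b) ⊗ m' ⊗ t' = t₋₁ ⊗ m ⊗ t₀` for `m' ⊗ t' ⊗ b = δ(m ⊗ t)`. -/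
theorem sw_delta_α (G : EquivariantGalois 𝓑 X 𝓚 Y) (N : LeftRightSAYD 𝓚 M) {x : M ⊗[ℂ] T}
    (hx : x ∈ cotensor N.comodule.coact Y.coact) {F : M → T → C → Z}
    (h₁ : ∀ b c, Lin fun a => F a b c)
    (h₂ : ∀ a c, Lin fun b => F a b c) (h₃ : ∀ a b, Lin fun c => F a b c) :
    (sw (G.delta N x) fun v m => sw v fun t b => F m t (𝓑.α b)) =
      sw x fun m t => sw (X.leftComodule.coact t) fun c t₀ => F m t₀ c := by
  have e := G.sw_delta N hx (F := fun t t' m => F m t (X.theta t'))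
    (by fun_prop) (by fun_prop) (by fun_prop)
  have e' := tens_congr (G.leftCoact_mem N hx)
    (F := fun x c => sw x fun m t => sw (Y.coact t) fun k t₀ =>
      F (total N.module.act (k ⊗ₜ m)) t₀ c)
    (G := fun x c => sw x fun m t => F m t c)
    (by fun_prop) (by fun_prop) (by fun_prop) (by fun_prop)
    fun x hx c => N.sw_stable_cotensor hx (F := fun m t => F m t c) (by fun_prop) (by fun_prop)
  simp (disch := fun_prop) only [sw_sw, sw_tmul] at e'
  refine Eq.trans ?_ (e.trans (Eq.trans ?_ e'))
  · refine (tens_congr (G.delta_mem N hx) (by fun_prop) (by fun_prop) (by fun_prop) (by fun_prop)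
      fun v hv m => ?_).symm
    refine G.sw_can_counit hv (F := fun t t' => F m t (X.theta t'))
      (F' := fun t b => F m t (𝓑.α b))
      (by fun_prop) (by fun_prop) (by fun_prop) (by fun_prop) fun u hu a => ?_
    rw [X.theta_act hu, (h₃ m a).apply_sw]
    simp only [(h₃ m a).2]
  · exact sw_congr fun m t => (X.sw_leftCoact t (F := fun c t => sw (Y.coact t) fun k t₀ =>
      F (total N.module.act (k ⊗ₜ m)) t₀ c) (by fun_prop) (by fun_prop)).symm

end EquivariantGalois
end CotensorComodule

/-! ### Coassociativity of the coaction on the cotensor product -/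

section Coassociativity

variable {B C T K M Z : Type*} [AddCommGroup B] [Module ℂ B] [Coalgebra ℂ B]
  [AddCommGroup C] [Module ℂ C] [Coalgebra ℂ C] [AddCommGroup T] [Module ℂ T] [Coalgebra ℂ T]
  [AddCommGroup K] [Module ℂ K] [Coalgebra ℂ K]
  [AddCommGroup M] [Module ℂ M] [AddCommMonoid Z] [Module ℂ Z]
  {𝓑 : RightHopfCoalgebra B C} {X : RightModuleCoalgebra 𝓑.toRightBicoalgebroid T}
  {𝓚 : LeftHopfCoalgebra K X.Quot} {Y : LeftComoduleCoalgebra 𝓚.toLeftBicoalgebroid T}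

namespace EquivariantGalois

/-- `t₂₍₋₁₎ t₃₍₋₁₎ ▷ m = t₂₍₋₁₎ ▷ (t₃₍₋₁₎ ▷ m)` on `M □_K T`. -/
theorem sw_act_act_comul (G : EquivariantGalois 𝓑 X 𝓚 Y) (N : LeftRightSAYD 𝓚 M) {x : M ⊗[ℂ] T}
    (hx : x ∈ cotensor N.comodule.coact Y.coact) {F : M → T → T → T → Z}
    (h₁ : ∀ b c d, Lin fun a => F a b c d) (h₂ : ∀ a c d, Lin fun b => F a b c d)
    (h₃ : ∀ a b d, Lin fun c => F a b c d) (h₄ : ∀ a b c, Lin fun d => F a b c d) :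
    (sw x fun m t => sw (Δ t) fun t₁ u => sw (Δ u) fun t₂ t₃ =>
      sw (Y.coact t₂) fun k₁ y₁ => sw (Y.coact t₃) fun k₂ y₂ =>
        F (total N.module.act (total 𝓚.mul (k₁ ⊗ₜ k₂) ⊗ₜ m)) t₁ y₁ y₂) =
      sw x fun m t => sw (Δ t) fun t₁ u => sw (Δ u) fun t₂ t₃ =>
      sw (Y.coact t₂) fun k₁ y₁ => sw (Y.coact t₃) fun k₂ y₂ =>
        F (total N.module.act (k₁ ⊗ₜ total N.module.act (k₂ ⊗ₜ m))) t₁ y₁ y₂ := by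
  have hm : (sw x fun m t => sw (Δ t) fun t₁ u => sw (Δ u) fun t₂ t₃ =>
      sw (Y.coact t₂) fun k₁ y₁ => sw (Y.coact t₃) fun k₂ y₂ =>
        (k₁ ⊗ₜ[ℂ] (k₂ ⊗ₜ[ℂ] m)) ⊗ₜ[ℂ] (t₁ ⊗ₜ[ℂ] (y₁ ⊗ₜ[ℂ] y₂))) ∈
      tens N.module.assocDom (T ⊗[ℂ] (T ⊗[ℂ] T)) := by
    refine N.module.mem_tens_assocDom ?_ ?_
    · simp (disch := fun_prop) only [sw_sw, sw_tmul]
      refine sw_mem fun m t => sw_mem fun t₁ u => ?_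
      have h := tens_map (Y.comul_coact_mem u) (f := fun p => m ⊗ₜ[ℂ] (t₁ ⊗ₜ[ℂ] p)) (by fun_prop)
      simp (disch := fun_prop) only [sw_sw, sw_tmul] at h
      exact h
    · simp (disch := fun_prop) only [sw_sw, sw_tmul]
      have h := tens_map (G.comul_coact_tmul_mem N hx) (f := fun p => sw p fun y₂ u =>
        sw (Δ u) fun t₁ t₂ => sw (Y.coact t₂) fun k₁ y₁ =>
          k₁ ⊗ₜ[ℂ] (t₁ ⊗ₜ[ℂ] (y₁ ⊗ₜ[ℂ] y₂))) (by fun_prop)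
      simp (disch := fun_prop) only [sw_sw, sw_tmul, tmul_sw] at h
      convert h using 1
      refine sw_congr fun m t => ?_
      rw [← sw_coassoc t (F := fun t₁ t₂ t₃ => sw (Y.coact t₂) fun k₁ y₁ =>
        sw (Y.coact t₃) fun k₂ y₂ => (k₂ ⊗ₜ[ℂ] m) ⊗ₜ[ℂ] (k₁ ⊗ₜ[ℂ] (t₁ ⊗ₜ[ℂ] (y₁ ⊗ₜ[ℂ] y₂))))
        (by fun_prop) (by fun_prop) (by fun_prop)]
      refine sw_congr fun u t₃ => ?_
      rw [sw_comm (Y.coact t₃)]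
      exact sw_congr fun t₁ t₂ => sw_comm _ _ _
  have h := N.module.sw_assoc hm (F := fun m p => sw p fun t₁ p => sw p fun y₁ y₂ => F m t₁ y₁ y₂)
    (by fun_prop) (by fun_prop)
  simp (disch := fun_prop) only [sw_sw, sw_tmul] at h
  exact h.symm

theorem sw_act_act (G : EquivariantGalois 𝓑 X 𝓚 Y) (N : LeftRightSAYD 𝓚 M) {x : M ⊗[ℂ] T}
    (hx : x ∈ cotensor N.comodule.coact Y.coact) {F : M → T → T → Z}
    (h₁ : ∀ b c, Lin fun a => F a b c) (h₂ : ∀ a c, Lin fun b => F a b c)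
    (h₃ : ∀ a b, Lin fun c => F a b c) :
    (sw x fun m t => sw (Δ t) fun t₁ t₂ =>
      sw (Y.coact t₁) fun k₁ y₁ => sw (Y.coact t₂) fun k₂ y₂ =>
        F (total N.module.act (total 𝓚.mul (k₁ ⊗ₜ k₂) ⊗ₜ m)) y₁ y₂) =
      sw x fun m t => sw (Δ t) fun t₁ t₂ =>
      sw (Y.coact t₁) fun k₁ y₁ => sw (Y.coact t₂) fun k₂ y₂ =>
        F (total N.module.act (k₁ ⊗ₜ total N.module.act (k₂ ⊗ₜ m))) y₁ y₂ := by
  have h := G.sw_act_act_comul N hx (F := fun m t y y' => ε t • F m y y')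
    (by fun_prop) (by fun_prop) (by fun_prop) (by fun_prop)
  simp only [← smul_sw] at h
  refine Eq.trans (sw_congr fun m t => ?_) (h.trans (sw_congr fun m t => ?_))
  · exact (sw_counit_left t (F := fun u => sw (Δ u) fun t₂ t₃ =>
      sw (Y.coact t₂) fun k₁ y₁ => sw (Y.coact t₃) fun k₂ y₂ =>
        F (total N.module.act (total 𝓚.mul (k₁ ⊗ₜ k₂) ⊗ₜ m)) y₁ y₂) (by fun_prop)).symm
  · exact sw_counit_left t (F := fun u => sw (Δ u) fun t₂ t₃ =>
      sw (Y.coact t₂) fun k₁ y₁ => sw (Y.coact t₃) fun k₂ y₂ =>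
        F (total N.module.act (k₁ ⊗ₜ total N.module.act (k₂ ⊗ₜ m))) y₁ y₂) (by fun_prop)

/-- On `M □_K T`, with `a ⊗ c = Δ(t₂₍₀₎)`,
`t₃₍₋₁₎ ▷ m ⊗ t₁ ⊗ t₂ ⊗ t₃₍₀₎ =
c₍₋₁₎ ▷ (t₁₍₋₁₎ ▷ (t₂₍₋₁₎ ▷ m)) ⊗ t₁₍₀₎ ⊗ a ⊗ c₍₀₎`. This comes from stability,
`m ⊗ t = t₍₋₁₎ ▷ m ⊗ t₍₀₎`, and colinearity of the comultiplication of `T`. -/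
theorem sw_coact_comul (G : EquivariantGalois 𝓑 X 𝓚 Y) (N : LeftRightSAYD 𝓚 M) {x : M ⊗[ℂ] T}
    (hx : x ∈ cotensor N.comodule.coact Y.coact) {F : M → T → T → T → Z}
    (h₁ : ∀ b c d, Lin fun a => F a b c d) (h₂ : ∀ a c d, Lin fun b => F a b c d)
    (h₃ : ∀ a b d, Lin fun c => F a b c d) (h₄ : ∀ a b c, Lin fun d => F a b c d) :
    (sw x fun m t => sw (Δ t) fun t₁ u => sw (Δ u) fun t₂ t₃ => sw (Y.coact t₃) fun k y =>
        F (total N.module.act (k ⊗ₜ m)) t₁ t₂ y) =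
      sw x fun m t => sw (Δ t) fun t₁ t₂ =>
      sw (Y.coact t₁) fun k₁ y₁ => sw (Y.coact t₂) fun k₂ y₂ => sw (Δ y₂) fun a c =>
      sw (Y.coact c) fun k y => F (total N.module.act (k ⊗ₜ
        total N.module.act (k₁ ⊗ₜ total N.module.act (k₂ ⊗ₜ m)))) y₁ a y := by
  calc _ = sw x fun m t => sw (Y.coact t) fun k' t => sw (Δ t) fun t₁ u => sw (Δ u) fun t₂ t₃ =>
        sw (Y.coact t₃) fun k y =>
        F (total N.module.act (k ⊗ₜ total N.module.act (k' ⊗ₜ m))) t₁ t₂ y :=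
      (N.sw_stable_cotensor hx (F := fun m t => sw (Δ t) fun t₁ u => sw (Δ u) fun t₂ t₃ =>
        sw (Y.coact t₃) fun k y => F (total N.module.act (k ⊗ₜ m)) t₁ t₂ y)
        (by fun_prop) (by fun_prop)).symm
    _ = _ := sw_congr fun m t => Y.sw_comul_coact t (F := fun k' t₁ u => sw (Δ u) fun t₂ t₃ =>
        sw (Y.coact t₃) fun k y =>
        F (total N.module.act (k ⊗ₜ total N.module.act (k' ⊗ₜ m))) t₁ t₂ y)
        (by fun_prop) (by fun_prop) (by fun_prop)
    _ = _ := G.sw_act_act N hx (F := fun m y₁ y₂ => sw (Δ y₂) fun a c =>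
      sw (Y.coact c) fun k y => F (total N.module.act (k ⊗ₜ m)) y₁ a y)
      (by fun_prop) (by fun_prop) (by fun_prop)

/-- Coassociativity of `δ` after `can` has been applied to the outer `δ`. It is proved by another
application of `can`. -/
theorem delta_delta_aux (G : EquivariantGalois 𝓑 X 𝓚 Y) (N : LeftRightSAYD 𝓚 M) {x : M ⊗[ℂ] T}
    (hx : x ∈ cotensor N.comodule.coact Y.coact) :
    (sw (G.delta N x) fun v m => sw v fun t b => sw (Δ t) fun t₁ t₂ => sw (Y.coact t₂) fun k t₀ =>
      (t₀ ⊗ₜ[ℂ] b) ⊗ₜ[ℂ] (t₁ ⊗ₜ[ℂ] total N.module.act (k ⊗ₜ m))) =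
      sw (G.delta N x) fun v m => sw v fun t b => sw (Δ t) fun t₁ t₂ => sw (Δ b) fun b₁ b₂ =>
        (t₁ ⊗ₜ[ℂ] b₁) ⊗ₜ[ℂ] (total X.act (t₂ ⊗ₜ b₂) ⊗ₜ[ℂ] m) := by
  refine G.can_injective ?_ ?_ ?_
  · refine tens_mem (G.delta_mem N hx) (by fun_prop) (by fun_prop) fun v hv m => ?_
    have h := tens_mem (G.comul_tmul_mem hv) (F := fun w t₁ => sw w fun t₂ b =>
      sw (Y.coact t₂) fun k t₀ => (t₀ ⊗ₜ[ℂ] b) ⊗ₜ[ℂ] (t₁ ⊗ₜ[ℂ] total N.module.act (k ⊗ₜ m)))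
      (Q := tens (cotensor X.coact 𝓑.leftR) (T ⊗[ℂ] M)) (by fun_prop) (by fun_prop)
      fun w hw t₁ => by
        have h := tens_map (G.act_coact_mem hw)
          (f := fun k => t₁ ⊗ₜ[ℂ] total N.module.act (k ⊗ₜ m)) (by fun_prop)
        simp (disch := fun_prop) only [sw_sw, sw_tmul] at h
        exact h
    simp (disch := fun_prop) only [sw_sw, sw_tmul] at h
    exact h
  · refine tens_mem (G.delta_mem N hx) (by fun_prop) (by fun_prop) fun v hv m => ?_
    have h := tens_map (X.comul_act_eq hv).1 (f := fun t => t ⊗ₜ[ℂ] m) (by fun_prop)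
    simp (disch := fun_prop) only [sw_sw, sw_tmul] at h
    exact h
  · simp (disch := fun_prop) only [sw_sw, sw_tmul]
    -- equivariance
    have eE := tens_congr (G.delta_mem N hx)
      (F := fun v m => sw v fun t b => sw (Δ t) fun u t₃ => sw (Δ u) fun t₁ t₂ =>
        sw (Y.coact t₂) fun k₁ y₁ => sw (Y.coact (total X.act (t₃ ⊗ₜ b))) fun k₂ y₂ =>
        (y₁ ⊗ₜ[ℂ] y₂) ⊗ₜ[ℂ]
          (t₁ ⊗ₜ[ℂ] total N.module.act (k₁ ⊗ₜ total N.module.act (k₂ ⊗ₜ m))))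
      (G := fun v m => sw v fun t b => sw (Δ t) fun u t₃ => sw (Δ u) fun t₁ t₂ =>
        sw (Y.coact t₂) fun k₁ y₁ => sw (Y.coact t₃) fun k₂ y₂ =>
        (y₁ ⊗ₜ[ℂ] total X.act (y₂ ⊗ₜ b)) ⊗ₜ[ℂ]
          (t₁ ⊗ₜ[ℂ] total N.module.act (k₁ ⊗ₜ total N.module.act (k₂ ⊗ₜ m))))
      (by fun_prop) (by fun_prop) (by fun_prop) (by fun_prop)
      fun v hv m => by
        have e := tens_congr (G.comul_tmul_mem hv)
          (F := fun w u => sw (Δ u) fun t₁ t₂ =>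
            sw (Y.coact t₂) fun k₁ y₁ => sw (Y.coact (total X.act w)) fun k₂ y₂ =>
            (y₁ ⊗ₜ[ℂ] y₂) ⊗ₜ[ℂ]
              (t₁ ⊗ₜ[ℂ] total N.module.act (k₁ ⊗ₜ total N.module.act (k₂ ⊗ₜ m))))
          (G := fun w u => sw (Δ u) fun t₁ t₂ =>
            sw (Y.coact t₂) fun k₁ y₁ => sw w fun t₃ b => sw (Y.coact t₃) fun k₂ y₂ =>
            (y₁ ⊗ₜ[ℂ] total X.act (y₂ ⊗ₜ b)) ⊗ₜ[ℂ]
              (t₁ ⊗ₜ[ℂ] total N.module.act (k₁ ⊗ₜ total N.module.act (k₂ ⊗ₜ m))))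
          (by fun_prop) (by fun_prop) (by fun_prop) (by fun_prop)
          fun w hw u => sw_congr fun t₁ t₂ => sw_congr fun k₁ y₁ =>
            G.sw_coact_act hw (by fun_prop) (by fun_prop)
        simp (disch := fun_prop) only [sw_sw, sw_tmul] at e
        exact e
    -- associativity of the `K`-action, available because `δ` has values in `M □_K T`
    have eA := tens_congr (G.delta_mem_cotensor N hx)
      (F := fun x b => sw x fun m t => sw (Δ t) fun t₁ u => sw (Δ u) fun t₂ t₃ =>
        sw (Y.coact t₂) fun k₁ y₁ => sw (Y.coact t₃) fun k₂ y₂ =>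
        (y₁ ⊗ₜ[ℂ] total X.act (y₂ ⊗ₜ b)) ⊗ₜ[ℂ]
          (t₁ ⊗ₜ[ℂ] total N.module.act (total 𝓚.mul (k₁ ⊗ₜ k₂) ⊗ₜ m)))
      (G := fun x b => sw x fun m t => sw (Δ t) fun t₁ u => sw (Δ u) fun t₂ t₃ =>
        sw (Y.coact t₂) fun k₁ y₁ => sw (Y.coact t₃) fun k₂ y₂ =>
        (y₁ ⊗ₜ[ℂ] total X.act (y₂ ⊗ₜ b)) ⊗ₜ[ℂ]
          (t₁ ⊗ₜ[ℂ] total N.module.act (k₁ ⊗ₜ total N.module.act (k₂ ⊗ₜ m))))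
      (by fun_prop) (by fun_prop) (by fun_prop) (by fun_prop)
      fun x hx b => G.sw_act_act_comul N hx (F := fun m t₁ y₁ y₂ =>
        (y₁ ⊗ₜ[ℂ] total X.act (y₂ ⊗ₜ b)) ⊗ₜ[ℂ] (t₁ ⊗ₜ[ℂ] m))
        (by fun_prop) (by fun_prop) (by fun_prop) (by fun_prop)
    -- multiplicativity of the comultiplication of `T` on `t₂ ◁ b`
    have eR := tens_congr (G.delta_mem N hx)
      (F := fun v m => sw v fun t b => sw (Δ t) fun t₁ t₂ => sw (Δ t₂) fun t₂ t₃ =>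
        sw (Δ b) fun b₁ b₂ =>
        (t₁ ⊗ₜ[ℂ] total X.act (t₂ ⊗ₜ b₁)) ⊗ₜ[ℂ] (total X.act (t₃ ⊗ₜ b₂) ⊗ₜ[ℂ] m))
      (G := fun v m => sw v fun t b => sw (Δ t) fun t₁ t₂ =>
        sw (Δ (total X.act (t₂ ⊗ₜ b))) fun a c => (t₁ ⊗ₜ[ℂ] a) ⊗ₜ[ℂ] (c ⊗ₜ[ℂ] m))
      (by fun_prop) (by fun_prop) (by fun_prop) (by fun_prop)
      fun v hv m => by
        have e := tens_congr (G.comul_tmul_mem hv)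
          (F := fun w t₁ => sw (Δ (total X.act w)) fun a c => (t₁ ⊗ₜ[ℂ] a) ⊗ₜ[ℂ] (c ⊗ₜ[ℂ] m))
          (G := fun w t₁ => sw w fun t b => sw (Δ t) fun t₂ t₃ => sw (Δ b) fun b₁ b₂ =>
            (t₁ ⊗ₜ[ℂ] total X.act (t₂ ⊗ₜ b₁)) ⊗ₜ[ℂ] (total X.act (t₃ ⊗ₜ b₂) ⊗ₜ[ℂ] m))
          (by fun_prop) (by fun_prop) (by fun_prop) (by fun_prop)
          fun w hw t₁ => X.sw_comul_act hw (by fun_prop) (by fun_prop)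
        simp (disch := fun_prop) only [sw_sw, sw_tmul] at e
        exact e.symm
    simp (disch := fun_prop) only [sw_sw, sw_tmul] at eA
    -- both sides after `can`, with `δ` eliminated by its characterization
    have eL : (sw (G.delta N x) fun v m => sw v fun t b => sw (Δ t) fun t₁ u =>
        sw (Y.coact u) fun k t₀ => sw (Δ t₀) fun a c =>
        (a ⊗ₜ[ℂ] total X.act (c ⊗ₜ b)) ⊗ₜ[ℂ] (t₁ ⊗ₜ[ℂ] total N.module.act (k ⊗ₜ m))) =
        sw x fun m t => sw (Δ t) fun t₁ t₂ => sw (Y.coact t₂) fun k t₀ => sw (Δ t₀) fun a c =>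
        sw (Y.coact c) fun k₁ y₁ => sw (Y.coact t₁) fun k₂ y₂ => (y₁ ⊗ₜ[ℂ] y₂) ⊗ₜ[ℂ] (a ⊗ₜ[ℂ]
          total N.module.act (k₁ ⊗ₜ total N.module.act (k₂ ⊗ₜ total N.module.act (k ⊗ₜ m)))) := by
      calc _ = _ := sw_congr fun v m => sw_congr fun t b => sw_congr fun t₁ u =>
            Y.sw_comul_coact u (F := fun k a c => (a ⊗ₜ[ℂ] total X.act (c ⊗ₜ b)) ⊗ₜ[ℂ]
              (t₁ ⊗ₜ[ℂ] total N.module.act (k ⊗ₜ m))) (by fun_prop) (by fun_prop) (by fun_prop)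
        _ = _ := eA
        _ = _ := sw_congr fun v m => sw_congr fun t b => (sw_coassoc t (F := fun t₁ t₂ t₃ =>
            sw (Y.coact t₂) fun k₁ y₁ => sw (Y.coact t₃) fun k₂ y₂ =>
            (y₁ ⊗ₜ[ℂ] total X.act (y₂ ⊗ₜ b)) ⊗ₜ[ℂ]
              (t₁ ⊗ₜ[ℂ] total N.module.act (k₁ ⊗ₜ total N.module.act (k₂ ⊗ₜ m))))
            (by fun_prop) (by fun_prop) (by fun_prop)).symm
        _ = _ := eE.symm
        _ = _ := G.sw_delta N hx (F := fun u t' m => sw (Δ u) fun t₁ t₂ =>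
            sw (Y.coact t₂) fun k₁ y₁ => sw (Y.coact t') fun k₂ y₂ =>
            (y₁ ⊗ₜ[ℂ] y₂) ⊗ₜ[ℂ]
              (t₁ ⊗ₜ[ℂ] total N.module.act (k₁ ⊗ₜ total N.module.act (k₂ ⊗ₜ m))))
            (by fun_prop) (by fun_prop) (by fun_prop)
    have eR' : (sw (G.delta N x) fun v m => sw v fun t b => sw (Δ t) fun u t₃ =>
        sw (Δ b) fun b₁ b₂ => sw (Δ u) fun t₁ t₂ =>
        (t₁ ⊗ₜ[ℂ] total X.act (t₂ ⊗ₜ b₁)) ⊗ₜ[ℂ] (total X.act (t₃ ⊗ₜ b₂) ⊗ₜ[ℂ] m)) =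
        sw x fun m t => sw (Δ t) fun t₁ u => sw (Δ u) fun t₂ t₃ => sw (Y.coact t₃) fun k y =>
          (y ⊗ₜ[ℂ] t₁) ⊗ₜ[ℂ] (t₂ ⊗ₜ[ℂ] total N.module.act (k ⊗ₜ m)) := by
      calc _ = _ := sw_congr fun v m => sw_congr fun t b => by
            rw [← sw_coassoc t (F := fun t₁ t₂ t₃ => sw (Δ b) fun b₁ b₂ =>
              (t₁ ⊗ₜ[ℂ] total X.act (t₂ ⊗ₜ b₁)) ⊗ₜ[ℂ] (total X.act (t₃ ⊗ₜ b₂) ⊗ₜ[ℂ] m))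
              (by fun_prop) (by fun_prop) (by fun_prop)]
            exact sw_congr fun u t₃ => sw_comm _ _ _
        _ = _ := eR
        _ = _ := G.sw_delta N hx (F := fun t₁ t' m => sw (Δ t') fun a c =>
            (t₁ ⊗ₜ[ℂ] a) ⊗ₜ[ℂ] (c ⊗ₜ[ℂ] m)) (by fun_prop) (by fun_prop) (by fun_prop)
        _ = _ := sw_congr fun m t => by
            rw [← sw_coassoc t (F := fun t₁ t₂ t₃ => sw (Y.coact t₃) fun k y =>
              (y ⊗ₜ[ℂ] t₁) ⊗ₜ[ℂ] (t₂ ⊗ₜ[ℂ] total N.module.act (k ⊗ₜ m)))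
              (by fun_prop) (by fun_prop) (by fun_prop)]
            exact sw_congr fun u t₃ => sw_comm _ _ _
    rw [eL, eR', G.sw_coact_comul N hx (F := fun m t₁ t₂ y => (y ⊗ₜ[ℂ] t₁) ⊗ₜ[ℂ] (t₂ ⊗ₜ[ℂ] m))
      (by fun_prop) (by fun_prop) (by fun_prop) (by fun_prop)]
    refine sw_congr fun m t => sw_congr fun t₁ t₂ => ?_
    rw [sw_comm (Y.coact t₁)]
    refine sw_congr fun k t₀ => ?_
    rw [sw_comm (Y.coact t₁)]
    exact sw_congr fun a c => sw_comm _ _ _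

/-- Coassociativity of `δ`. -/
theorem delta_delta (G : EquivariantGalois 𝓑 X 𝓚 Y) (N : LeftRightSAYD 𝓚 M) {x : M ⊗[ℂ] T}
    (hx : x ∈ cotensor N.comodule.coact Y.coact) :
    (sw (G.delta N x) fun v m => sw v fun t b => sw (G.delta N (m ⊗ₜ t)) fun v' m' =>
      v' ⊗ₜ[ℂ] (b ⊗ₜ[ℂ] m')) =
      sw (G.delta N x) fun v m => sw v fun t b => sw (Δ b) fun b₁ b₂ =>
        (t ⊗ₜ[ℂ] b₂) ⊗ₜ[ℂ] (b₁ ⊗ₜ[ℂ] m) := by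
  refine G.can_injective ?_ ?_ ?_
  · have h := tens_mem (G.delta_mem_cotensor N hx)
      (F := fun x b => sw (G.delta N x) fun v' m' => v' ⊗ₜ[ℂ] (b ⊗ₜ[ℂ] m'))
      (Q := tens (cotensor X.coact 𝓑.leftR) (B ⊗[ℂ] M)) (by fun_prop) (by fun_prop)
      fun x hx b => tens_map (G.delta_mem N hx) (by fun_prop)
    simp (disch := fun_prop) only [sw_sw, sw_tmul] at h
    exact h
  · refine tens_mem (G.delta_mem N hx) (by fun_prop) (by fun_prop) fun v hv m => ?_
    have h := tens_map (X.act_comul_mem hv) (f := fun b => b ⊗ₜ[ℂ] m) (by fun_prop)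
    simp (disch := fun_prop) only [sw_sw, sw_tmul] at h
    exact h
  · have e := tens_congr (G.delta_mem_cotensor N hx)
      (F := fun x b => sw (G.delta N x) fun v' m' => sw v' fun t b' => sw (Δ t) fun t₁ t₂ =>
        (t₁ ⊗ₜ[ℂ] total X.act (t₂ ⊗ₜ b')) ⊗ₜ[ℂ] (b ⊗ₜ[ℂ] m'))
      (G := fun x b => sw x fun m t => sw (Δ t) fun t₁ t₂ => sw (Y.coact t₂) fun k t₀ =>
        (t₀ ⊗ₜ[ℂ] t₁) ⊗ₜ[ℂ] (b ⊗ₜ[ℂ] total N.module.act (k ⊗ₜ m)))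
      (by fun_prop) (by fun_prop) (by fun_prop) (by fun_prop)
      fun x hx b => G.sw_delta N hx (F := fun t t' m => (t ⊗ₜ[ℂ] t') ⊗ₜ[ℂ] (b ⊗ₜ[ℂ] m))
        (by fun_prop) (by fun_prop) (by fun_prop)
    have e' := congrArg (fun z => sw z fun p q => sw p fun t b => sw q fun t' m =>
      (t ⊗ₜ[ℂ] t') ⊗ₜ[ℂ] (b ⊗ₜ[ℂ] m)) (G.delta_delta_aux N hx)
    simp (disch := fun_prop) only [sw_sw, sw_tmul] at e e' ⊢
    rw [e, e']
    exact sw_congr fun v m => sw_congr fun t b => sw_comm _ _ _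

end EquivariantGalois
end Coassociativity

/-! ### The anti-Yetter-Drinfeld condition -/

section AntiYetterDrinfeld

variable {B C T K M Z : Type*} [AddCommGroup B] [Module ℂ B] [Coalgebra ℂ B]
  [AddCommGroup C] [Module ℂ C] [Coalgebra ℂ C] [AddCommGroup T] [Module ℂ T] [Coalgebra ℂ T]
  [AddCommGroup K] [Module ℂ K] [Coalgebra ℂ K]
  [AddCommGroup M] [Module ℂ M] [AddCommMonoid Z] [Module ℂ Z]
  {𝓑 : RightHopfCoalgebra B C} {X : RightModuleCoalgebra 𝓑.toRightBicoalgebroid T}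
  {𝓚 : LeftHopfCoalgebra K X.Quot} {Y : LeftComoduleCoalgebra 𝓚.toLeftBicoalgebroid T}

namespace EquivariantGalois

/-- For `x ⊗ b ∈ (M □_K T) □_C B` and `m ⊗ t ⊗ b' = δ(x)`, the element `b₂ ⊗ b'` is in the domain of
`ν⁻¹`, by coassociativity of `δ` and compatibility with `β`. -/
theorem delta_nuInv_mem (G : EquivariantGalois 𝓑 X 𝓚 Y) (N : LeftRightSAYD 𝓚 M)
    {z : (M ⊗[ℂ] T) ⊗[ℂ] B} (hz : z ∈ tens (cotensor N.comodule.coact Y.coact) B)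
    (hz' : z ∈ cotensor (X.coactOn M) 𝓑.leftR) :
    (sw z fun x b => sw (G.delta N x) fun v m => sw v fun t b' => sw (Δ b) fun b₁ b₂ =>
      (b₂ ⊗ₜ[ℂ] b') ⊗ₜ[ℂ] ((m ⊗ₜ[ℂ] t) ⊗ₜ[ℂ] b₁)) ∈
      tens (cotensor 𝓑.rightCop 𝓑.leftCop) ((M ⊗[ℂ] T) ⊗[ℂ] B) := by
  rw [mem_tens_cotensor]
  simp (disch := fun_prop) only [sw_sw, sw_tmul, 𝓑.sw_leftCop, 𝓑.sw_rightCop]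
  have e₁ := tens_congr hz
    (F := fun x b => sw (G.delta N x) fun v m => sw v fun t b' => sw (Δ b') fun c₁ c₂ =>
      sw (Δ b) fun b₁ b₂ =>
      b₂ ⊗ₜ[ℂ] (𝓑.β c₁ ⊗ₜ[ℂ] (c₂ ⊗ₜ[ℂ] ((m ⊗ₜ[ℂ] t) ⊗ₜ[ℂ] b₁))))
    (G := fun x b => sw x fun m t => sw (X.coact t) fun t₀ c => sw (G.delta N (m ⊗ₜ t₀)) fun v m =>
      sw v fun t b' => sw (Δ b) fun b₁ b₂ =>
      b₂ ⊗ₜ[ℂ] (c ⊗ₜ[ℂ] (b' ⊗ₜ[ℂ] ((m ⊗ₜ[ℂ] t) ⊗ₜ[ℂ] b₁))))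
    (by fun_prop) (by fun_prop) (by fun_prop) (by fun_prop)
    fun x hx b => by
      have e := congrArg (fun y => sw y fun p q => sw p fun t c₂ => sw q fun c₁ m =>
        sw (Δ b) fun b₁ b₂ =>
        b₂ ⊗ₜ[ℂ] (𝓑.β c₁ ⊗ₜ[ℂ] (c₂ ⊗ₜ[ℂ] ((m ⊗ₜ[ℂ] t) ⊗ₜ[ℂ] b₁)))) (G.delta_delta N hx)
      simp (disch := fun_prop) only [sw_sw, sw_tmul] at e
      exact e.symm.trans (G.sw_delta_β N hx (F := fun m t c => sw (G.delta N (m ⊗ₜ t)) fun v m =>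
        sw v fun t b' => sw (Δ b) fun b₁ b₂ =>
        b₂ ⊗ₜ[ℂ] (c ⊗ₜ[ℂ] (b' ⊗ₜ[ℂ] ((m ⊗ₜ[ℂ] t) ⊗ₜ[ℂ] b₁))))
        (by fun_prop) (by fun_prop) (by fun_prop))
  have e₂ := sw_cotensor hz' (F := fun x c b => sw (G.delta N x) fun v m =>
      sw v fun t b' => sw (Δ b) fun b₁ b₂ =>
      b₂ ⊗ₜ[ℂ] (c ⊗ₜ[ℂ] (b' ⊗ₜ[ℂ] ((m ⊗ₜ[ℂ] t) ⊗ₜ[ℂ] b₁))))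
      (by fun_prop) (by fun_prop) (by fun_prop)
  simp (disch := fun_prop) only [X.sw_coactOn, 𝓑.sw_leftR] at e₂
  calc _ = sw z fun x b => sw (Δ b) fun c₁ c₂ => sw (G.delta N x) fun v m =>
        sw v fun t b' => sw (Δ c₁) fun b₁ b₂ =>
        b₂ ⊗ₜ[ℂ] (𝓑.β c₂ ⊗ₜ[ℂ] (b' ⊗ₜ[ℂ] ((m ⊗ₜ[ℂ] t) ⊗ₜ[ℂ] b₁))) := sw_congr fun x b => by
        rw [sw_comm (Δ b)]
        refine sw_congr fun v m => ?_
        rw [sw_comm (Δ b)]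
        exact sw_congr fun t b' => (sw_coassoc b (F := fun b₁ b₂ b₃ =>
          b₂ ⊗ₜ[ℂ] (𝓑.β b₃ ⊗ₜ[ℂ] (b' ⊗ₜ[ℂ] ((m ⊗ₜ[ℂ] t) ⊗ₜ[ℂ] b₁))))
          (by fun_prop) (by fun_prop) (by fun_prop)).symm
    _ = _ := e₂.symm
    _ = _ := e₁.symm
    _ = _ := sw_congr fun x b => sw_congr fun v m => sw_congr fun t b' => sw_comm _ _ _

/-- `t ◁ ν⁻` is defined for `ν⁻ ⊗ ν⁺ = ν⁻¹(b₂ ⊗ b')`. -/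
theorem delta_act_mem (G : EquivariantGalois 𝓑 X 𝓚 Y) (N : LeftRightSAYD 𝓚 M)
    {z : (M ⊗[ℂ] T) ⊗[ℂ] B} (hz : z ∈ tens (cotensor N.comodule.coact Y.coact) B)
    (hz' : z ∈ cotensor (X.coactOn M) 𝓑.leftR) :
    (sw z fun x b => sw (G.delta N x) fun v m => sw v fun t b' => sw (Δ b) fun b₁ b₂ =>
      sw (total 𝓑.nuInv (b₂ ⊗ₜ b')) fun p q => (t ⊗ₜ[ℂ] p) ⊗ₜ[ℂ] (q ⊗ₜ[ℂ] (b₁ ⊗ₜ[ℂ] m))) ∈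
      tens (cotensor X.coact 𝓑.leftR) (B ⊗[ℂ] (B ⊗[ℂ] M)) := by
  rw [mem_tens_cotensor]
  simp (disch := fun_prop) only [sw_sw, sw_tmul, 𝓑.sw_leftR]
  have e₁ := tens_congr (G.delta_nuInv_mem N hz hz')
    (F := fun y a => sw a fun x b₁ => sw x fun m t => sw (total 𝓑.nuInv y) fun p q =>
      sw (Δ p) fun p₁ p₂ => t ⊗ₜ[ℂ] (𝓑.β p₂ ⊗ₜ[ℂ] (p₁ ⊗ₜ[ℂ] (q ⊗ₜ[ℂ] (b₁ ⊗ₜ[ℂ] m)))))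
    (G := fun y a => sw a fun x b₁ => sw x fun m t => sw y fun b₂ b' => sw (Δ b') fun c₁ c₂ =>
      sw (total 𝓑.nuInv (b₂ ⊗ₜ c₁)) fun p q =>
      t ⊗ₜ[ℂ] (𝓑.β c₂ ⊗ₜ[ℂ] (p ⊗ₜ[ℂ] (q ⊗ₜ[ℂ] (b₁ ⊗ₜ[ℂ] m)))))
    (by fun_prop) (by fun_prop) (by fun_prop) (by fun_prop)
    fun y hy a => sw_congr fun x b₁ => sw_congr fun m t => by
      have e := 𝓑.sw_nuInv_β hy (F := fun w c => sw w fun p q =>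
        t ⊗ₜ[ℂ] (c ⊗ₜ[ℂ] (p ⊗ₜ[ℂ] (q ⊗ₜ[ℂ] (b₁ ⊗ₜ[ℂ] m))))) (by fun_prop) (by fun_prop)
      simp (disch := fun_prop) only [sw_tmul] at e
      exact e
  have e₂ := tens_congr hz
    (F := fun x b => sw (G.delta N x) fun v m => sw v fun t b' => sw (X.coact t) fun t₀ c =>
      sw (Δ b) fun b₁ b₂ => sw (total 𝓑.nuInv (b₂ ⊗ₜ b')) fun p q =>
      t₀ ⊗ₜ[ℂ] (c ⊗ₜ[ℂ] (p ⊗ₜ[ℂ] (q ⊗ₜ[ℂ] (b₁ ⊗ₜ[ℂ] m)))))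
    (G := fun x b => sw (G.delta N x) fun v m => sw v fun t b' => sw (Δ b') fun c₁ c₂ =>
      sw (Δ b) fun b₁ b₂ => sw (total 𝓑.nuInv (b₂ ⊗ₜ c₁)) fun p q =>
      t ⊗ₜ[ℂ] (𝓑.β c₂ ⊗ₜ[ℂ] (p ⊗ₜ[ℂ] (q ⊗ₜ[ℂ] (b₁ ⊗ₜ[ℂ] m)))))
    (by fun_prop) (by fun_prop) (by fun_prop) (by fun_prop)
    fun x hx b => by
      have e := sw_tens_cotensor (G.delta_mem N hx) (F := fun t c b' m => sw (Δ b) fun b₁ b₂ =>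
        sw (total 𝓑.nuInv (b₂ ⊗ₜ b')) fun p q =>
        t ⊗ₜ[ℂ] (c ⊗ₜ[ℂ] (p ⊗ₜ[ℂ] (q ⊗ₜ[ℂ] (b₁ ⊗ₜ[ℂ] m)))))
        (by fun_prop) (by fun_prop) (by fun_prop) (by fun_prop)
      simp (disch := fun_prop) only [𝓑.sw_leftR] at e
      exact e
  simp (disch := fun_prop) only [sw_sw, sw_tmul] at e₁
  rw [e₁]
  refine Eq.trans (sw_congr fun x b => sw_congr fun v m => sw_congr fun t b' => ?_) (e₂.trans
    (sw_congr fun x b => sw_congr fun v m => sw_congr fun t b' => sw_comm _ _ _))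
  rw [sw_comm (X.coact t)]
  exact sw_congr fun b₁ b₂ => sw_comm _ _ _

/-- `(t ◁ ν⁻) ◁ ν⁺` and `t ◁ ν⁻ ν⁺` are defined. -/
theorem delta_act_assocDom (G : EquivariantGalois 𝓑 X 𝓚 Y) (N : LeftRightSAYD 𝓚 M)
    {z : (M ⊗[ℂ] T) ⊗[ℂ] B} (hz : z ∈ tens (cotensor N.comodule.coact Y.coact) B)
    (hz' : z ∈ cotensor (X.coactOn M) 𝓑.leftR) :
    (sw z fun x b => sw (G.delta N x) fun v m => sw v fun t b' => sw (Δ b) fun b₁ b₂ =>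
      sw (total 𝓑.nuInv (b₂ ⊗ₜ b')) fun p q =>
        (t ⊗ₜ[ℂ] (p ⊗ₜ[ℂ] q)) ⊗ₜ[ℂ] (b₁ ⊗ₜ[ℂ] m)) ∈ tens X.assocDom (B ⊗[ℂ] M) := by
  refine X.mem_tens_assocDom ?_ ?_
  · simp (disch := fun_prop) only [sw_sw, sw_tmul]
    exact G.delta_act_mem N hz hz'
  · have h := tens_mem (G.delta_nuInv_mem N hz hz') (F := fun y a => sw a fun x b₁ =>
      sw x fun m t => total 𝓑.nuInv y ⊗ₜ[ℂ] (t ⊗ₜ[ℂ] (b₁ ⊗ₜ[ℂ] m)))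
      (Q := tens (cotensor 𝓑.rightR 𝓑.leftR) (T ⊗[ℂ] (B ⊗[ℂ] M))) (by fun_prop) (by fun_prop)
      fun y hy a => sw_mem fun x b₁ => sw_mem fun m t => tmul_mem_tens (𝓑.nuInv_mem hy) _
    simp (disch := fun_prop) only [sw_sw, sw_tmul] at h ⊢
    convert h using 1
    refine sw_congr fun x b => sw_congr fun v m => sw_congr fun t b' => sw_congr fun b₁ b₂ => ?_
    rw [← sw_tmul', sw_mk]

/-- `ν⁺ b₁ ⊗ m ⊗ t ◁ ν⁻` is defined: colinearity moves the right coaction of `ν⁺` to `b'`, then by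
`α(b) ⊗ m' ⊗ t' = t₋₁ ⊗ m ⊗ t₀` to `t`, by the Takeuchi condition for `T` to `ν⁻`, and to `b₂`. -/
theorem delta_mul_mem (G : EquivariantGalois 𝓑 X 𝓚 Y) (N : LeftRightSAYD 𝓚 M)
    {z : (M ⊗[ℂ] T) ⊗[ℂ] B} (hz : z ∈ tens (cotensor N.comodule.coact Y.coact) B)
    (hz' : z ∈ cotensor (X.coactOn M) 𝓑.leftR) :
    (sw z fun x b => sw (G.delta N x) fun v m => sw v fun t b' => sw (Δ b) fun b₁ b₂ =>
      sw (total 𝓑.nuInv (b₂ ⊗ₜ b')) fun p q =>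
        (q ⊗ₜ[ℂ] b₁) ⊗ₜ[ℂ] (m ⊗ₜ[ℂ] total X.act (t ⊗ₜ p))) ∈
      tens (cotensor 𝓑.rightR 𝓑.leftR) (M ⊗[ℂ] T) := by
  rw [mem_tens_cotensor]
  simp (disch := fun_prop) only [sw_sw, sw_tmul, 𝓑.sw_leftR, 𝓑.sw_rightR]
  have e₁ := tens_congr (G.delta_nuInv_mem N hz hz')
    (F := fun y a => sw a fun x b₁ => sw x fun m t => sw (total 𝓑.nuInv y) fun p q =>
      sw (Δ q) fun q₁ q₂ => q₁ ⊗ₜ[ℂ] (𝓑.α q₂ ⊗ₜ[ℂ] (b₁ ⊗ₜ[ℂ] (m ⊗ₜ[ℂ] total X.act (t ⊗ₜ p)))))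
    (G := fun y a => sw a fun x b₁ => sw x fun m t => sw y fun b₂ b' => sw (Δ b') fun c₁ c₂ =>
      sw (total 𝓑.nuInv (b₂ ⊗ₜ c₁)) fun p q =>
      q ⊗ₜ[ℂ] (𝓑.α c₂ ⊗ₜ[ℂ] (b₁ ⊗ₜ[ℂ] (m ⊗ₜ[ℂ] total X.act (t ⊗ₜ p)))))
    (by fun_prop) (by fun_prop) (by fun_prop) (by fun_prop)
    fun y hy a => sw_congr fun x b₁ => sw_congr fun m t => by
      have e := 𝓑.sw_nuInv_α hy (F := fun w c => sw w fun p q =>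
        q ⊗ₜ[ℂ] (c ⊗ₜ[ℂ] (b₁ ⊗ₜ[ℂ] (m ⊗ₜ[ℂ] total X.act (t ⊗ₜ p)))))
        (by fun_prop) (by fun_prop)
      simp (disch := fun_prop) only [sw_tmul] at e
      exact e
  have e₂ := tens_congr hz
    (F := fun x b => sw (G.delta N x) fun v m => sw v fun t b' => sw (Δ b') fun c₁ c₂ =>
      sw (Δ b) fun b₁ b₂ => sw (total 𝓑.nuInv (b₂ ⊗ₜ c₁)) fun p q =>
      q ⊗ₜ[ℂ] (𝓑.α c₂ ⊗ₜ[ℂ] (b₁ ⊗ₜ[ℂ] (m ⊗ₜ[ℂ] total X.act (t ⊗ₜ p)))))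
    (G := fun x b => sw (G.delta N x) fun v m => sw v fun t b' =>
      sw (X.leftComodule.coact t) fun c t₀ =>
      sw (Δ b) fun b₁ b₂ => sw (total 𝓑.nuInv (b₂ ⊗ₜ b')) fun p q =>
      q ⊗ₜ[ℂ] (c ⊗ₜ[ℂ] (b₁ ⊗ₜ[ℂ] (m ⊗ₜ[ℂ] total X.act (t₀ ⊗ₜ p)))))
    (by fun_prop) (by fun_prop) (by fun_prop) (by fun_prop)
    fun x hx b => by
      have e := congrArg (fun y => sw y fun u w => sw u fun t c₂ => sw w fun c₁ m =>
        sw (Δ b) fun b₁ b₂ => sw (total 𝓑.nuInv (b₂ ⊗ₜ c₁)) fun p q =>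
        q ⊗ₜ[ℂ] (𝓑.α c₂ ⊗ₜ[ℂ] (b₁ ⊗ₜ[ℂ] (m ⊗ₜ[ℂ] total X.act (t ⊗ₜ p)))))
        (G.delta_delta N hx)
      have e' := tens_congr (G.delta_mem_cotensor N hx)
        (F := fun x c₁ => sw (G.delta N x) fun v m => sw v fun t c₂ =>
          sw (Δ b) fun b₁ b₂ => sw (total 𝓑.nuInv (b₂ ⊗ₜ c₁)) fun p q =>
          q ⊗ₜ[ℂ] (𝓑.α c₂ ⊗ₜ[ℂ] (b₁ ⊗ₜ[ℂ] (m ⊗ₜ[ℂ] total X.act (t ⊗ₜ p)))))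
        (G := fun x b' => sw x fun m t => sw (X.leftComodule.coact t) fun c t₀ =>
          sw (Δ b) fun b₁ b₂ => sw (total 𝓑.nuInv (b₂ ⊗ₜ b')) fun p q =>
          q ⊗ₜ[ℂ] (c ⊗ₜ[ℂ] (b₁ ⊗ₜ[ℂ] (m ⊗ₜ[ℂ] total X.act (t₀ ⊗ₜ p)))))
        (by fun_prop) (by fun_prop) (by fun_prop) (by fun_prop)
        fun x hx b' => G.sw_delta_α N hx (F := fun m t c => sw (Δ b) fun b₁ b₂ =>
          sw (total 𝓑.nuInv (b₂ ⊗ₜ b')) fun p q =>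
          q ⊗ₜ[ℂ] (c ⊗ₜ[ℂ] (b₁ ⊗ₜ[ℂ] (m ⊗ₜ[ℂ] total X.act (t ⊗ₜ p)))))
          (by fun_prop) (by fun_prop) (by fun_prop)
      simp (disch := fun_prop) only [sw_sw, sw_tmul] at e e'
      rw [← e', e]
  have e₃ := tens_congr (G.delta_act_mem N hz hz')
    (F := fun u w => sw w fun q w => sw w fun b₁ m => sw u fun t p =>
      sw (X.leftComodule.coact t) fun c t₀ =>
      q ⊗ₜ[ℂ] (c ⊗ₜ[ℂ] (b₁ ⊗ₜ[ℂ] (m ⊗ₜ[ℂ] total X.act (t₀ ⊗ₜ p)))))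
    (G := fun u w => sw w fun q w => sw w fun b₁ m => sw u fun t p => sw (Δ p) fun p₁ p₂ =>
      q ⊗ₜ[ℂ] (𝓑.β p₁ ⊗ₜ[ℂ] (b₁ ⊗ₜ[ℂ] (m ⊗ₜ[ℂ] total X.act (t ⊗ₜ p₂)))))
    (by fun_prop) (by fun_prop) (by fun_prop) (by fun_prop)
    fun u hu w => sw_congr fun q w => sw_congr fun b₁ m => X.sw_takeuchi hu (F := fun c t =>
      q ⊗ₜ[ℂ] (c ⊗ₜ[ℂ] (b₁ ⊗ₜ[ℂ] (m ⊗ₜ[ℂ] t)))) (by fun_prop) (by fun_prop)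
  have e₄ := tens_congr (G.delta_nuInv_mem N hz hz')
    (F := fun y a => sw a fun x b₁ => sw x fun m t => sw (total 𝓑.nuInv y) fun p q =>
      sw (Δ p) fun p₁ p₂ =>
      q ⊗ₜ[ℂ] (𝓑.β p₁ ⊗ₜ[ℂ] (b₁ ⊗ₜ[ℂ] (m ⊗ₜ[ℂ] total X.act (t ⊗ₜ p₂)))))
    (G := fun y a => sw a fun x b₁ => sw x fun m t => sw y fun b₂ b' => sw (Δ b₂) fun c₁ c₂ =>
      sw (total 𝓑.nuInv (c₂ ⊗ₜ b')) fun p q =>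
      q ⊗ₜ[ℂ] (𝓑.β c₁ ⊗ₜ[ℂ] (b₁ ⊗ₜ[ℂ] (m ⊗ₜ[ℂ] total X.act (t ⊗ₜ p)))))
    (by fun_prop) (by fun_prop) (by fun_prop) (by fun_prop)
    fun y hy a => sw_congr fun x b₁ => sw_congr fun m t => by
      have e := 𝓑.sw_nuInv_comul hy (F := fun w c => sw w fun p q =>
        q ⊗ₜ[ℂ] (𝓑.β c ⊗ₜ[ℂ] (b₁ ⊗ₜ[ℂ] (m ⊗ₜ[ℂ] total X.act (t ⊗ₜ p)))))
        (by fun_prop) (by fun_prop)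
      simp (disch := fun_prop) only [sw_tmul] at e
      exact e
  simp (disch := fun_prop) only [sw_sw, sw_tmul] at e₁ e₃ e₄
  calc _ = _ := e₁
    _ = _ := sw_congr fun x b => sw_congr fun v m => sw_congr fun t b' => sw_comm _ _ _
    _ = _ := e₂
    _ = _ := sw_congr fun x b => sw_congr fun v m => sw_congr fun t b' => by
        rw [sw_comm (X.leftComodule.coact t)]
        exact sw_congr fun b₁ b₂ => sw_comm _ _ _
    _ = _ := e₃
    _ = _ := e₄
    _ = _ := sw_congr fun x b => sw_congr fun v m => sw_congr fun t b' => by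
        rw [← sw_coassoc b (F := fun b₁ b₂ b₃ => sw (total 𝓑.nuInv (b₃ ⊗ₜ b')) fun p q =>
          q ⊗ₜ[ℂ] (𝓑.β b₂ ⊗ₜ[ℂ] (b₁ ⊗ₜ[ℂ] (m ⊗ₜ[ℂ] total X.act (t ⊗ₜ p)))))
          (by fun_prop) (by fun_prop) (by fun_prop)]
        exact sw_congr fun b₁ b₂ => sw_comm _ _ _

/-- `(t' ◁ ν⁻)₁ ⊗ (t' ◁ ν⁻)₂ ◁ ν⁺ = t'₁ ◁ b₂ ⊗ t'₂ ◁ b'` for `m' ⊗ t' ⊗ b' = δ(x)` and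
`ν⁻ ⊗ ν⁺ = ν⁻¹(b₂ ⊗ b')`. -/
theorem sw_comul_act_nuInv (G : EquivariantGalois 𝓑 X 𝓚 Y) (N : LeftRightSAYD 𝓚 M)
    {z : (M ⊗[ℂ] T) ⊗[ℂ] B} (hz : z ∈ tens (cotensor N.comodule.coact Y.coact) B)
    (hz' : z ∈ cotensor (X.coactOn M) 𝓑.leftR) {F : T → T → B → M → Z}
    (h₁ : ∀ b c d, Lin fun a => F a b c d) (h₂ : ∀ a c d, Lin fun b => F a b c d)
    (h₃ : ∀ a b d, Lin fun c => F a b c d) (h₄ : ∀ a b c, Lin fun d => F a b c d) :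
    (sw z fun x b => sw (G.delta N x) fun v m => sw v fun t b' => sw (Δ b) fun b₁ b₂ =>
      sw (total 𝓑.nuInv (b₂ ⊗ₜ b')) fun p q => sw (Δ (total X.act (t ⊗ₜ p))) fun s₁ s₂ =>
        F s₁ (total X.act (s₂ ⊗ₜ q)) b₁ m) =
      sw z fun x b => sw (G.delta N x) fun v m => sw v fun t b' => sw (Δ b) fun b₁ b₂ =>
        sw (Δ t) fun t₁ t₂ =>
        F (total X.act (t₁ ⊗ₜ b₂)) (total X.act (t₂ ⊗ₜ b')) b₁ m := by
  have e₁ := tens_congr (G.delta_act_mem N hz hz')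
    (F := fun u w => sw w fun q w => sw w fun b₁ m => sw (Δ (total X.act u)) fun s₁ s₂ =>
      F s₁ (total X.act (s₂ ⊗ₜ q)) b₁ m)
    (G := fun u w => sw w fun q w => sw w fun b₁ m => sw u fun t p => sw (Δ t) fun t₁ t₂ =>
      sw (Δ p) fun p₁ p₂ =>
      F (total X.act (t₁ ⊗ₜ p₁)) (total X.act (total X.act (t₂ ⊗ₜ p₂) ⊗ₜ q)) b₁ m)
    (by fun_prop) (by fun_prop) (by fun_prop) (by fun_prop)
    fun u hu w => sw_congr fun q w => sw_congr fun b₁ m => X.sw_comul_act hu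
      (by fun_prop) (by fun_prop)
  have hm : (sw z fun x b => sw (G.delta N x) fun v m => sw v fun t b' => sw (Δ b) fun b₁ b₂ =>
      sw (total 𝓑.nuInv (b₂ ⊗ₜ b')) fun p q => sw (Δ t) fun t₁ t₂ => sw (Δ p) fun p₁ p₂ =>
        (t₂ ⊗ₜ[ℂ] (p₂ ⊗ₜ[ℂ] q)) ⊗ₜ[ℂ] ((t₁ ⊗ₜ[ℂ] p₁) ⊗ₜ[ℂ] (b₁ ⊗ₜ[ℂ] m))) ∈
      tens X.assocDom ((T ⊗[ℂ] B) ⊗[ℂ] (B ⊗[ℂ] M)) := by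
    refine X.mem_tens_assocDom ?_ ?_
    · have h := tens_mem (G.delta_act_mem N hz hz')
        (F := fun u w => sw w fun q w => sw u fun t p => sw (Δ t) fun t₁ t₂ =>
          sw (Δ p) fun p₁ p₂ => (t₂ ⊗ₜ[ℂ] p₂) ⊗ₜ[ℂ] (q ⊗ₜ[ℂ] ((t₁ ⊗ₜ[ℂ] p₁) ⊗ₜ[ℂ] w)))
        (Q := tens (cotensor X.coact 𝓑.leftR) (B ⊗[ℂ] ((T ⊗[ℂ] B) ⊗[ℂ] (B ⊗[ℂ] M))))
        (by fun_prop) (by fun_prop) fun u hu w => sw_mem fun q w => by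
          have h := tens_map (X.comul_act_mem₂ hu) (f := fun a => q ⊗ₜ[ℂ] (a ⊗ₜ[ℂ] w))
            (by fun_prop)
          simp (disch := fun_prop) only [sw_sw, sw_tmul] at h
          exact h
      simp (disch := fun_prop) only [sw_sw, sw_tmul] at h ⊢
      exact h
    · have h := tens_mem (G.delta_nuInv_mem N hz hz') (F := fun y a => sw a fun x b₁ =>
          sw x fun m t => sw (Δ t) fun t₁ t₂ => sw (total 𝓑.nuInv y) fun p q =>
          sw (Δ p) fun p₁ p₂ =>
          (p₂ ⊗ₜ[ℂ] q) ⊗ₜ[ℂ] (t₂ ⊗ₜ[ℂ] ((t₁ ⊗ₜ[ℂ] p₁) ⊗ₜ[ℂ] (b₁ ⊗ₜ[ℂ] m))))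
        (Q := tens (cotensor 𝓑.rightR 𝓑.leftR) (T ⊗[ℂ] ((T ⊗[ℂ] B) ⊗[ℂ] (B ⊗[ℂ] M))))
        (by fun_prop) (by fun_prop)
        fun y hy a => sw_mem fun x b₁ => sw_mem fun m t => sw_mem fun t₁ t₂ => by
          have h := tens_map (𝓑.takeuchi_mem (𝓑.nuInv_mem hy))
            (f := fun p => t₂ ⊗ₜ[ℂ] ((t₁ ⊗ₜ[ℂ] p) ⊗ₜ[ℂ] (b₁ ⊗ₜ[ℂ] m))) (by fun_prop)
          simp (disch := fun_prop) only [sw_sw, sw_tmul] at h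
          exact h
      simp (disch := fun_prop) only [sw_sw, sw_tmul] at h ⊢
      convert h using 1
      exact sw_congr fun x b => sw_congr fun v m => sw_congr fun t b' => sw_congr fun b₁ b₂ =>
        sw_comm _ _ _
  have e₂ := X.sw_assoc hm (F := fun s a => sw a fun u w => sw u fun t p => sw w fun b m =>
    F (total X.act (t ⊗ₜ p)) s b m) (by fun_prop) (by fun_prop)
  have e₃ := tens_congr (G.delta_nuInv_mem N hz hz')
    (F := fun y a => sw a fun x b₁ => sw x fun m t => sw (Δ t) fun t₁ t₂ =>
      sw (total 𝓑.nuInv y) fun p q => sw (Δ p) fun p₁ p₂ =>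
      F (total X.act (t₁ ⊗ₜ p₁)) (total X.act (t₂ ⊗ₜ total 𝓑.mul (p₂ ⊗ₜ q))) b₁ m)
    (G := fun y a => sw a fun x b₁ => sw x fun m t => sw (Δ t) fun t₁ t₂ =>
      sw y fun b b' => F (total X.act (t₁ ⊗ₜ b)) (total X.act (t₂ ⊗ₜ b')) b₁ m)
    (by fun_prop) (by fun_prop) (by fun_prop) (by fun_prop)
    fun y hy a => sw_congr fun x b₁ => sw_congr fun m t => sw_congr fun t₁ t₂ => by
      conv_rhs => rw [← 𝓑.nu_nuInv hy]
      simp (disch := fun_prop) only [sw_sw, sw_tmul]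
  simp (disch := fun_prop) only [sw_sw, sw_tmul] at e₁ e₂ e₃
  calc _ = _ := e₁
    _ = _ := e₂
    _ = _ := sw_congr fun x b => sw_congr fun v m => sw_congr fun t b' => sw_congr fun b₁ b₂ =>
        sw_comm _ _ _
    _ = _ := e₃

/-- The anti-Yetter-Drinfeld condition: `δ(x ◁ b) = m' ⊗ t' ◁ ν⁻ ⊗ ν⁺ b₁` for
`m' ⊗ t' ⊗ b' = δ(x)` and `ν⁻ ⊗ ν⁺ = ν⁻¹(b₂ ⊗ b')`. -/
theorem delta_actOn (G : EquivariantGalois 𝓑 X 𝓚 Y) (N : LeftRightSAYD 𝓚 M)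
    {z : (M ⊗[ℂ] T) ⊗[ℂ] B} (hz : z ∈ tens (cotensor N.comodule.coact Y.coact) B)
    (hz' : z ∈ cotensor (X.coactOn M) 𝓑.leftR) :
    G.delta N (X.actOn M z) =
      sw z fun x b => sw (G.delta N x) fun v m => sw v fun t b' => sw (Δ b) fun b₁ b₂ =>
      sw (total 𝓑.nuInv (b₂ ⊗ₜ b')) fun p q =>
        (total X.act (t ⊗ₜ p) ⊗ₜ[ℂ] total 𝓑.mul (q ⊗ₜ b₁)) ⊗ₜ[ℂ] m := by
  have hP := G.actOn_mem N.comodule hz hz'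
  have hs := X.act_act_mem (G.delta_act_assocDom N hz hz')
  have hq := G.delta_mul_mem N hz hz'
  have hm : (sw z fun x b => sw (G.delta N x) fun v m => sw v fun t b' => sw (Δ b) fun b₁ b₂ =>
      sw (total 𝓑.nuInv (b₂ ⊗ₜ b')) fun p q =>
        (total X.act (t ⊗ₜ p) ⊗ₜ[ℂ] (q ⊗ₜ[ℂ] b₁)) ⊗ₜ[ℂ] m) ∈ tens X.assocDom M := by
    refine X.mem_tens_assocDom ?_ ?_
    · simp (disch := fun_prop) only [sw_sw, sw_tmul] at hs ⊢
      exact hs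
    · have h := tens_map hq (f := fun v => TensorProduct.comm ℂ M T v) (by fun_prop)
      simp (disch := fun_prop) only [sw_sw, sw_tmul, TensorProduct.comm_tmul] at h ⊢
      exact h
  have hm' : (sw z fun x b => sw (G.delta N x) fun v m => sw v fun t b' => sw (Δ b) fun b₁ b₂ =>
      sw (total 𝓑.nuInv (b₂ ⊗ₜ b')) fun p q => sw (Δ (total X.act (t ⊗ₜ p))) fun s₁ s₂ =>
        (s₂ ⊗ₜ[ℂ] (q ⊗ₜ[ℂ] b₁)) ⊗ₜ[ℂ] (s₁ ⊗ₜ[ℂ] m)) ∈ tens X.assocDom (T ⊗[ℂ] M) := by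
    refine X.mem_tens_assocDom ?_ ?_
    · have h := tens_mem hs (F := fun u a => sw u fun s q => sw a fun b₁ m => sw (Δ s) fun s₁ s₂ =>
          (s₂ ⊗ₜ[ℂ] q) ⊗ₜ[ℂ] (b₁ ⊗ₜ[ℂ] (s₁ ⊗ₜ[ℂ] m)))
        (Q := tens (cotensor X.coact 𝓑.leftR) (B ⊗[ℂ] (T ⊗[ℂ] M))) (by fun_prop) (by fun_prop)
        fun u hu a => by
          rw [sw_comm]
          refine sw_mem fun b₁ m => ?_
          have h := tens_map (G.comul_tmul_mem hu) (f := fun s => b₁ ⊗ₜ[ℂ] (s ⊗ₜ[ℂ] m))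
            (by fun_prop)
          simp (disch := fun_prop) only [sw_sw, sw_tmul] at h
          exact h
      simp (disch := fun_prop) only [sw_sw, sw_tmul] at h ⊢
      exact h
    · have h := tens_map hq (f := fun a => sw a fun m s => sw (Δ s) fun s₁ s₂ =>
        s₂ ⊗ₜ[ℂ] (s₁ ⊗ₜ[ℂ] m)) (by fun_prop)
      simp (disch := fun_prop) only [sw_sw, sw_tmul, tmul_sw] at h ⊢
      exact h
  refine G.can_injective (G.delta_mem N hP) ?_ ?_
  · have h := X.act_mul_mem hm
    simp (disch := fun_prop) only [sw_sw, sw_tmul] at h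
    exact h
  · rw [G.sw_delta N hP (F := fun t t' m => (t ⊗ₜ[ℂ] t') ⊗ₜ[ℂ] m)
      (by fun_prop) (by fun_prop) (by fun_prop)]
    -- both sides after `can` are equal to `m' ⊗ t'₁ ◁ b₂ ⊗ (t'₂ ◁ b') ◁ b₁`
    have e₁ := tens_congr (X.mem_coactOn.1 hz')
      (F := fun u m => sw (Δ (total X.act u)) fun t₁ t₂ => sw (Y.coact t₂) fun k t₀ =>
        (t₀ ⊗ₜ[ℂ] t₁) ⊗ₜ[ℂ] total N.module.act (k ⊗ₜ m))
      (G := fun u m => sw u fun t b => sw (Δ t) fun t₁ t₂ => sw (Δ b) fun b₁ b₂ =>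
        sw (Y.coact t₂) fun k t₀ => (total X.act (t₀ ⊗ₜ b₂) ⊗ₜ[ℂ] total X.act (t₁ ⊗ₜ b₁)) ⊗ₜ[ℂ]
          total N.module.act (k ⊗ₜ m))
      (by fun_prop) (by fun_prop) (by fun_prop) (by fun_prop)
      fun u hu m => by
        rw [X.sw_comul_act hu (by fun_prop) (by fun_prop)]
        have e := tens_congr (X.comul_act_mem₂ hu)
          (F := fun w a => sw a fun t₁ b₁ => sw (Y.coact (total X.act w)) fun k t₀ =>
            (t₀ ⊗ₜ[ℂ] total X.act (t₁ ⊗ₜ b₁)) ⊗ₜ[ℂ] total N.module.act (k ⊗ₜ m))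
          (G := fun w a => sw a fun t₁ b₁ => sw w fun t₂ b₂ => sw (Y.coact t₂) fun k t₀ =>
            (total X.act (t₀ ⊗ₜ b₂) ⊗ₜ[ℂ] total X.act (t₁ ⊗ₜ b₁)) ⊗ₜ[ℂ]
              total N.module.act (k ⊗ₜ m))
          (by fun_prop) (by fun_prop) (by fun_prop) (by fun_prop)
          fun w hw a => sw_congr fun t₁ b₁ => G.sw_coact_act hw (by fun_prop) (by fun_prop)
        simp (disch := fun_prop) only [sw_sw, sw_tmul] at e
        exact e
    have e₂ := X.sw_assoc hm' (F := fun s a => sw a fun s₁ m => (s₁ ⊗ₜ[ℂ] s) ⊗ₜ[ℂ] m)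
      (by fun_prop) (by fun_prop)
    have e₃ := G.sw_comul_act_nuInv N hz hz' (F := fun s₁ s b₁ m =>
      (s₁ ⊗ₜ[ℂ] total X.act (s ⊗ₜ b₁)) ⊗ₜ[ℂ] m)
      (by fun_prop) (by fun_prop) (by fun_prop) (by fun_prop)
    have e₄ := tens_congr hz
      (F := fun x b => sw (G.delta N x) fun v m => sw v fun t b' => sw (Δ t) fun t₁ t₂ =>
        sw (Δ b) fun b₁ b₂ => (total X.act (t₁ ⊗ₜ b₂) ⊗ₜ[ℂ]
          total X.act (total X.act (t₂ ⊗ₜ b') ⊗ₜ b₁)) ⊗ₜ[ℂ] m)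
      (G := fun x b => sw x fun m t => sw (Δ t) fun t₁ t₂ => sw (Y.coact t₂) fun k t₀ =>
        sw (Δ b) fun b₁ b₂ => (total X.act (t₀ ⊗ₜ b₂) ⊗ₜ[ℂ] total X.act (t₁ ⊗ₜ b₁)) ⊗ₜ[ℂ]
          total N.module.act (k ⊗ₜ m))
      (by fun_prop) (by fun_prop) (by fun_prop) (by fun_prop)
      fun x hx b => G.sw_delta N hx (F := fun t t' m => sw (Δ b) fun b₁ b₂ =>
        (total X.act (t ⊗ₜ b₂) ⊗ₜ[ℂ] total X.act (t' ⊗ₜ b₁)) ⊗ₜ[ℂ] m)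
        (by fun_prop) (by fun_prop) (by fun_prop)
    simp (disch := fun_prop) only [sw_sw, sw_tmul, X.sw_actOn] at e₁ e₂ ⊢
    refine e₁.trans (Eq.trans ?_ (e₄.symm.trans (Eq.trans ?_ (e₃.symm.trans e₂))))
    · refine sw_congr fun x b => ?_
      refine sw_congr fun m t => sw_congr fun t₁ t₂ => ?_
      exact sw_comm _ _ _
    · exact sw_congr fun x b => sw_congr fun v m => sw_congr fun t b' => sw_comm _ _ _

end EquivariantGalois
end AntiYetterDrinfeld

/-! ### The coaction in terms of `κ` -/

section Kappa

variable {B C T K M Z : Type*} [AddCommGroup B] [Module ℂ B] [Coalgebra ℂ B]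
  [AddCommGroup C] [Module ℂ C] [Coalgebra ℂ C] [AddCommGroup T] [Module ℂ T] [Coalgebra ℂ T]
  [AddCommGroup K] [Module ℂ K] [Coalgebra ℂ K]
  [AddCommGroup M] [Module ℂ M] [AddCommMonoid Z] [Module ℂ Z]
  {𝓑 : RightHopfCoalgebra B C} {X : RightModuleCoalgebra 𝓑.toRightBicoalgebroid T}
  {𝓚 : LeftHopfCoalgebra K X.Quot} {Y : LeftComoduleCoalgebra 𝓚.toLeftBicoalgebroid T}

/-- `s₂ ⊗ t ⊗ s₁` lies in `(T □_S T) ⊗ T` for `s ⊗ t ∈ T □_S T`. -/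
theorem RightModuleCoalgebra.comul_tmul_mem_quot {y : T ⊗[ℂ] T}
    (hy : y ∈ cotensor X.quotRight X.quotLeft) :
    (sw y fun s t => sw (Δ s) fun s₁ s₂ => (s₂ ⊗ₜ[ℂ] t) ⊗ₜ[ℂ] s₁) ∈
      tens (cotensor X.quotRight X.quotLeft) T := by
  rw [mem_tens_cotensor]
  have e := sw_cotensor hy (F := fun s q t => sw (Δ s) fun s₁ s₂ =>
    s₂ ⊗ₜ[ℂ] (q ⊗ₜ[ℂ] (t ⊗ₜ[ℂ] s₁))) (by fun_prop) (by fun_prop) (by fun_prop)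
  simp (disch := fun_prop) only [sw_sw, sw_tmul, X.sw_quotRight, X.sw_quotLeft] at e ⊢
  refine Eq.trans (sw_congr fun s t => ?_) (e.trans (sw_congr fun s t => sw_comm _ _ _))
  exact (sw_coassoc s (F := fun s₁ s₂ s₃ =>
    s₂ ⊗ₜ[ℂ] (X.augIdeal.mkQ s₃ ⊗ₜ[ℂ] (t ⊗ₜ[ℂ] s₁)))
    (by fun_prop) (by fun_prop) (by fun_prop)).symm

namespace EquivariantGalois

/-- The inverse of the canonical map is left `T`-colinear. -/
theorem comul_canInv (G : EquivariantGalois 𝓑 X 𝓚 Y) {y : T ⊗[ℂ] T}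
    (hy : y ∈ cotensor X.quotRight X.quotLeft) :
    (sw y fun s t => sw (Δ s) fun s₁ s₂ => total G.canInv (s₂ ⊗ₜ t) ⊗ₜ[ℂ] s₁) =
      sw (total G.canInv y) fun t b => sw (Δ t) fun t₁ t₂ => (t₂ ⊗ₜ[ℂ] b) ⊗ₜ[ℂ] t₁ := by
  have hm := X.comul_tmul_mem_quot hy
  refine G.can_injective ?_ (G.comul_tmul_mem (G.canInv_mem hy)) ?_
  · have h := tens_mem hm (F := fun y a => total G.canInv y ⊗ₜ[ℂ] a)
      (Q := tens (cotensor X.coact 𝓑.leftR) T) (by fun_prop) (by fun_prop)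
      fun y hy a => tmul_mem_tens (G.canInv_mem hy) a
    simp (disch := fun_prop) only [sw_sw, sw_tmul] at h
    exact h
  · have e₁ := tens_congr hm
      (F := fun y a => sw (total G.canInv y) fun t b => sw (Δ t) fun t₁ t₂ =>
        (t₁ ⊗ₜ[ℂ] total X.act (t₂ ⊗ₜ b)) ⊗ₜ[ℂ] a)
      (G := fun y a => y ⊗ₜ[ℂ] a) (by fun_prop) (by fun_prop) (by fun_prop) (by fun_prop)
      fun y hy a => by
        conv_rhs => rw [← G.can_canInv hy]
        simp only [sw_tmul']
    have e₂ := congrArg (fun y => sw y fun s t => sw (Δ s) fun s₁ s₂ => (s₂ ⊗ₜ[ℂ] t) ⊗ₜ[ℂ] s₁)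
      (G.can_canInv hy)
    simp (disch := fun_prop) only [sw_sw, sw_tmul] at e₁ e₂ ⊢
    rw [e₁, ← e₂]
    exact sw_congr fun t b => (sw_coassoc t (F := fun t₁ t₂ t₃ =>
      (t₂ ⊗ₜ[ℂ] total X.act (t₃ ⊗ₜ b)) ⊗ₜ[ℂ] t₁) (by fun_prop) (by fun_prop) (by fun_prop))

/-- The map `m ⊗ t ↦ b ⊗ m' ⊗ t'` on `M ⊗ T` with `m' ⊗ t' ⊗ b = δ(m ⊗ t)`, which restricts to
the coaction of `M □_K T`. -/
noncomputable def coaction (G : EquivariantGalois 𝓑 X 𝓚 Y) (N : LeftRightSAYD 𝓚 M) :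
    M ⊗[ℂ] T →ₗ[ℂ] B ⊗[ℂ] (M ⊗[ℂ] T) :=
  Lin.toMap (f := fun x => sw (G.delta N x) fun v m => sw v fun t b => b ⊗ₜ[ℂ] (m ⊗ₜ[ℂ] t))
    (by fun_prop)

theorem coaction_eq (G : EquivariantGalois 𝓑 X 𝓚 Y) (N : LeftRightSAYD 𝓚 M) (x : M ⊗[ℂ] T) :
    G.coaction N x = sw (G.delta N x) fun v m => sw v fun t b => b ⊗ₜ[ℂ] (m ⊗ₜ[ℂ] t) := rfl

theorem sw_coaction (G : EquivariantGalois 𝓑 X 𝓚 Y) (N : LeftRightSAYD 𝓚 M) (x : M ⊗[ℂ] T)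
    {F : B → M ⊗[ℂ] T → Z} (h₁ : ∀ b, Lin fun a => F a b) (h₂ : ∀ a, Lin fun b => F a b) :
    sw (G.coaction N x) F = sw (G.delta N x) fun v m => sw v fun t b => F b (m ⊗ₜ[ℂ] t) := by
  simp (disch := fun_prop) only [coaction_eq, sw_sw, sw_tmul]

/-- The coaction in terms of `κ`, including the assertion that both partial operations in the
formula are defined. -/
theorem coaction_eq_kappa (G : EquivariantGalois 𝓑 X 𝓚 Y) (N : LeftRightSAYD 𝓚 M) {x : M ⊗[ℂ] T}
    (hx : x ∈ cotensor N.comodule.coact Y.coact) :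
    ∃ (y : M ⊗[ℂ] (T ⊗[ℂ] T)) (w : (M ⊗[ℂ] T) ⊗[ℂ] B),
      AppL N.module.act
        (TensorProduct.tensorTensorTensorComm ℂ K T M T
          (TensorProduct.comm ℂ (M ⊗[ℂ] T) (K ⊗[ℂ] T)
            ((TensorProduct.assoc ℂ M T (K ⊗[ℂ] T)).symm
              ((Y.coact.lTensor T ∘ₗ Coalgebra.comul (R := ℂ)).lTensor M x)))) y ∧
      AppR G.kappa
        ((TensorProduct.assoc ℂ M T (T ⊗[ℂ] T)).symm
          (((TensorProduct.assoc ℂ T T T).toLinearMap ∘ₗ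
            (Coalgebra.comul (R := ℂ)).rTensor T).lTensor M y)) w ∧
      G.coaction N x = TensorProduct.comm ℂ (M ⊗[ℂ] T) B w := by
  have e₁ : TensorProduct.tensorTensorTensorComm ℂ K T M T
      (TensorProduct.comm ℂ (M ⊗[ℂ] T) (K ⊗[ℂ] T)
        ((TensorProduct.assoc ℂ M T (K ⊗[ℂ] T)).symm
          ((Y.coact.lTensor T ∘ₗ Coalgebra.comul (R := ℂ)).lTensor M x))) =
      sw x fun m t => sw (Δ t) fun t₁ t₂ => sw (Y.coact t₂) fun k t₀ =>
        (k ⊗ₜ[ℂ] m) ⊗ₜ[ℂ] (t₀ ⊗ₜ[ℂ] t₁) := by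
    rw [map_eq_sw (LinearMap.lTensor M _) x]
    simp only [equiv_sw, LinearMap.lTensor_tmul, LinearMap.comp_apply]
    refine sw_congr fun m t => ?_
    rw [map_eq_sw (LinearMap.lTensor T Y.coact)]
    simp only [tmul_sw, equiv_sw, LinearMap.lTensor_tmul]
    refine sw_congr fun t₁ t₂ => ?_
    conv_lhs => rw [← sw_mk (Y.coact t₂)]
    simp only [tmul_sw, equiv_sw, TensorProduct.assoc_symm_tmul, TensorProduct.comm_tmul,
      TensorProduct.tensorTensorTensorComm_tmul]
  have e₂ : (TensorProduct.assoc ℂ M T (T ⊗[ℂ] T)).symm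
      (((TensorProduct.assoc ℂ T T T).toLinearMap ∘ₗ
        (Coalgebra.comul (R := ℂ)).rTensor T).lTensor M
        (sw x fun m t => sw (Δ t) fun t₁ t₂ => sw (Y.coact t₂) fun k t₀ =>
          total N.module.act (k ⊗ₜ m) ⊗ₜ[ℂ] (t₀ ⊗ₜ[ℂ] t₁))) =
      sw x fun m t => sw (Δ t) fun t₁ t₂ => sw (Y.coact t₂) fun k t₀ => sw (Δ t₀) fun a c =>
        (total N.module.act (k ⊗ₜ m) ⊗ₜ[ℂ] a) ⊗ₜ[ℂ] (c ⊗ₜ[ℂ] t₁) := by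
    simp only [map_sw, equiv_sw, LinearMap.lTensor_tmul, LinearMap.comp_apply,
      LinearMap.rTensor_tmul, LinearEquiv.coe_coe]
    refine sw_congr fun m t => sw_congr fun t₁ t₂ => sw_congr fun k t₀ => ?_
    conv_lhs => rw [← sw_mk (Δ t₀)]
    simp only [sw_tmul', tmul_sw, equiv_sw, TensorProduct.assoc_tmul,
      TensorProduct.assoc_symm_tmul]
  -- the arguments of `κ` and of `can⁻¹` lie in `T □_S T`
  have hm := tens_mem (G.coact_tmul_mem N hx) (F := fun y m => sw y fun s t => sw (Δ s) fun a c =>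
      (c ⊗ₜ[ℂ] t) ⊗ₜ[ℂ] (m ⊗ₜ[ℂ] a))
    (Q := tens (cotensor X.quotRight X.quotLeft) (M ⊗[ℂ] T)) (by fun_prop) (by fun_prop)
    fun y hy m => by
      have h := tens_map (X.comul_tmul_mem_quot hy) (f := fun a => m ⊗ₜ[ℂ] a) (by fun_prop)
      simp (disch := fun_prop) only [sw_sw, sw_tmul] at h
      exact h
  have eκ := tens_congr hm (F := fun y p => total G.kappa y ⊗ₜ[ℂ] p)
    (G := fun y p => sw (total G.canInv y) fun t b => (ε t • b) ⊗ₜ[ℂ] p)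
    (by fun_prop) (by fun_prop) (by fun_prop) (by fun_prop)
    fun y hy p => by rw [G.kappa_eq hy, sw_tmul']
  -- colinearity of `can⁻¹` and the counit identify the value of `κ` with the factor `b` of `δ`
  have eδ := tens_congr (G.coact_tmul_mem N hx)
    (F := fun y m => sw y fun s t => sw (Δ s) fun a c => sw (total G.canInv (c ⊗ₜ t)) fun t b =>
      (ε t • b) ⊗ₜ[ℂ] (m ⊗ₜ[ℂ] a))
    (G := fun y m => sw (total G.canInv y) fun t b => b ⊗ₜ[ℂ] (m ⊗ₜ[ℂ] t))
    (by fun_prop) (by fun_prop) (by fun_prop) (by fun_prop)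
    fun y hy m => by
      have e := congrArg (fun z => sw z fun v a => sw v fun t b => (ε t • b) ⊗ₜ[ℂ] (m ⊗ₜ[ℂ] a))
        (G.comul_canInv hy)
      simp (disch := fun_prop) only [sw_sw, sw_tmul] at e
      rw [e]
      refine sw_congr fun t b => ?_
      simp only [← TensorProduct.smul_tmul']
      exact sw_counit_right t (F := fun t => b ⊗ₜ[ℂ] (m ⊗ₜ[ℂ] t)) (by fun_prop)
  simp (disch := fun_prop) only [sw_sw, sw_tmul] at hm eκ eδ
  refine ⟨sw x fun m t => sw (Δ t) fun t₁ t₂ => sw (Y.coact t₂) fun k t₀ =>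
      total N.module.act (k ⊗ₜ m) ⊗ₜ[ℂ] (t₀ ⊗ₜ[ℂ] t₁),
    sw x fun m t => sw (Δ t) fun t₁ t₂ => sw (Y.coact t₂) fun k t₀ => sw (Δ t₀) fun a c =>
      (total N.module.act (k ⊗ₜ m) ⊗ₜ[ℂ] a) ⊗ₜ[ℂ] total G.kappa (c ⊗ₜ t₁), ?_, ?_, ?_⟩
  · rw [appL_iff, e₁]
    refine ⟨G.comul_coact_tmul_mem N hx, ?_⟩
    simp only [map_sw, LinearMap.rTensor_tmul]
  · rw [appR_iff, e₂]
    simp only [map_sw, equiv_sw, LinearMap.lTensor_tmul, TensorProduct.comm_tmul, and_true]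
    exact hm
  · simp only [equiv_sw, TensorProduct.comm_tmul]
    rw [eκ, eδ, coaction_eq, delta_eq]
    simp (disch := fun_prop) only [sw_sw, sw_tmul]

end EquivariantGalois
end Kappa

/-! ### Structures on a subspace -/

section Restrict

variable {V W A A' B C Z : Type*} [AddCommGroup V] [Module ℂ V] [AddCommGroup W] [Module ℂ W]
  [AddCommGroup A] [Module ℂ A] [AddCommGroup A'] [Module ℂ A'] [AddCommGroup B] [Module ℂ B]
  [AddCommGroup C] [Module ℂ C] [AddCommMonoid Z] [Module ℂ Z] (P : Submodule ℂ V)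

theorem rTensor_subtype_injective (A : Type*) [AddCommGroup A] [Module ℂ A] :
    Function.Injective (P.subtype.rTensor A) :=
  Module.Flat.rTensor_preserves_injective_linearMap _ P.injective_subtype

theorem lTensor_subtype_injective (A : Type*) [AddCommGroup A] [Module ℂ A] :
    Function.Injective (P.subtype.lTensor A) :=
  Module.Flat.lTensor_preserves_injective_linearMap _ P.injective_subtype

/-- Membership in `q ⊗ A` can be tested after an injective map on the factor `A`. -/
theorem mem_tens_of_injective {q : Submodule ℂ W} {f : A →ₗ[ℂ] A'} (hf : Function.Injective f)
    {z : W ⊗[ℂ] A} (h : f.lTensor W z ∈ tens q A') : z ∈ tens q A := by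
  obtain ⟨g, hg⟩ := f.exists_leftInverse_of_injective (LinearMap.ker_eq_bot.2 hf)
  have h' := tens_map h (f := fun a => g a) (by fun_prop)
  simp (disch := fun_prop) only [sw_lTensor] at h'
  have e (a : A) : g (f a) = a := LinearMap.congr_fun hg a
  simpa only [e, sw_mk] using h'

theorem mem_of_tmul_one_mem {q : Submodule ℂ W} {w : W} (h : w ⊗ₜ[ℂ] (1 : ℂ) ∈ tens q ℂ) :
    w ∈ q := by
  have h' := tens_mem h (F := fun w (c : ℂ) => c • w) (Q := q) (by fun_prop) (by fun_prop)
    fun w hw c => q.smul_mem c hw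
  simp (disch := fun_prop) only [sw_tmul, one_smul] at h'
  exact h'

/-- The restriction `P → P ⊗ C` of a map `V → V ⊗ C`. -/
noncomputable def restrictR (ρ : V →ₗ[ℂ] V ⊗[ℂ] C) (h : ∀ x ∈ P, ρ x ∈ tens P C) :
    P →ₗ[ℂ] P ⊗[ℂ] C :=
  (LinearEquiv.ofInjective _ (rTensor_subtype_injective P C)).symm.toLinearMap ∘ₗ
    (ρ ∘ₗ P.subtype).codRestrict _ fun x => h x.1 x.2

/-- The restriction `P → B ⊗ P` of a map `V → B ⊗ V`. -/
noncomputable def restrictL (d : V →ₗ[ℂ] B ⊗[ℂ] V)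
    (h : ∀ x ∈ P, TensorProduct.comm ℂ B V (d x) ∈ tens P B) : P →ₗ[ℂ] B ⊗[ℂ] P :=
  (LinearEquiv.ofInjective _ (lTensor_subtype_injective P B)).symm.toLinearMap ∘ₗ
    (d ∘ₗ P.subtype).codRestrict _ fun x => comm_mem_tens.1 (h x.1 x.2)

theorem rTensor_eq_sw (f : V →ₗ[ℂ] W) (w : V ⊗[ℂ] A) :
    f.rTensor A w = sw w fun v a => f v ⊗ₜ[ℂ] a := by
  rw [map_eq_sw (f.rTensor A)]
  simp only [LinearMap.rTensor_tmul]

variable {P}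

theorem rTensor_restrictR {ρ : V →ₗ[ℂ] V ⊗[ℂ] C} (h : ∀ x ∈ P, ρ x ∈ tens P C) (p : P) :
    P.subtype.rTensor C (restrictR P ρ h p) = ρ p.1 :=
  congrArg Subtype.val ((LinearEquiv.ofInjective _
    (rTensor_subtype_injective P C)).apply_symm_apply ⟨ρ p.1, h p.1 p.2⟩)

theorem lTensor_restrictL {d : V →ₗ[ℂ] B ⊗[ℂ] V}
    (h : ∀ x ∈ P, TensorProduct.comm ℂ B V (d x) ∈ tens P B) (p : P) :
    P.subtype.lTensor B (restrictL P d h p) = d p.1 :=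
  congrArg Subtype.val ((LinearEquiv.ofInjective _
    (lTensor_subtype_injective P B)).apply_symm_apply ⟨d p.1, comm_mem_tens.1 (h p.1 p.2)⟩)

theorem sw_restrictR {ρ : V →ₗ[ℂ] V ⊗[ℂ] C} (h : ∀ x ∈ P, ρ x ∈ tens P C) (p : P)
    {F : V → C → Z} (h₁ : ∀ b, Lin fun a => F a b) (h₂ : ∀ a, Lin fun b => F a b) :
    (sw (restrictR P ρ h p) fun q c => F (P.subtype q) c) = sw (ρ p.1) F := by
  rw [← rTensor_restrictR h p, sw_rTensor _ _ h₁ h₂]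

theorem sw_restrictL {d : V →ₗ[ℂ] B ⊗[ℂ] V}
    (h : ∀ x ∈ P, TensorProduct.comm ℂ B V (d x) ∈ tens P B) (p : P)
    {F : B → V → Z} (h₁ : ∀ b, Lin fun a => F a b) (h₂ : ∀ a, Lin fun b => F a b) :
    (sw (restrictL P d h p) fun b q => F b (P.subtype q)) = sw (d p.1) F := by
  rw [← lTensor_restrictL h p, sw_lTensor _ _ h₁ h₂]

theorem mem_tens_cotensor_restrictR {ρ : V →ₗ[ℂ] V ⊗[ℂ] C} (h : ∀ x ∈ P, ρ x ∈ tens P C)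
    {l : B →ₗ[ℂ] C ⊗[ℂ] B} {z : (P ⊗[ℂ] B) ⊗[ℂ] A} :
    z ∈ tens (cotensor (restrictR P ρ h) l) A ↔
      (P.subtype.rTensor B).rTensor A z ∈ tens (cotensor ρ l) A := by
  rw [mem_tens_cotensor, mem_tens_cotensor,
    ← (rTensor_subtype_injective P (C ⊗[ℂ] (B ⊗[ℂ] A))).eq_iff]
  simp (disch := fun_prop) only [sw_rTensor, map_sw, LinearMap.rTensor_tmul]
  have e : (sw z fun v a => sw v fun p b => sw (restrictR P ρ h p) fun q c =>
      P.subtype q ⊗ₜ[ℂ] (c ⊗ₜ[ℂ] (b ⊗ₜ[ℂ] a))) = sw z fun v a => sw v fun p b =>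
      sw (ρ (P.subtype p)) fun q c => q ⊗ₜ[ℂ] (c ⊗ₜ[ℂ] (b ⊗ₜ[ℂ] a)) :=
    sw_congr fun v a => sw_congr fun p b => sw_restrictR h p
      (F := fun q c => q ⊗ₜ[ℂ] (c ⊗ₜ[ℂ] (b ⊗ₜ[ℂ] a))) (by fun_prop) (by fun_prop)
  rw [e]

theorem mem_cotensor_restrictR {ρ : V →ₗ[ℂ] V ⊗[ℂ] C} (h : ∀ x ∈ P, ρ x ∈ tens P C)
    {l : B →ₗ[ℂ] C ⊗[ℂ] B} {z : P ⊗[ℂ] B} :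
    z ∈ cotensor (restrictR P ρ h) l ↔ P.subtype.rTensor B z ∈ cotensor ρ l := by
  constructor
  · intro hz
    exact mem_of_tmul_one_mem ((mem_tens_cotensor_restrictR h).1 (tmul_mem_tens hz 1))
  · intro hz
    exact mem_of_tmul_one_mem ((mem_tens_cotensor_restrictR h).2 (tmul_mem_tens hz 1))

theorem sw_leftComm {U : Type*} [AddCommGroup U] [Module ℂ U]
    (x : V ⊗[ℂ] (W ⊗[ℂ] U)) {F : W → V ⊗[ℂ] U → Z} (h₁ : ∀ b, Lin fun a => F a b)
    (h₂ : ∀ a, Lin fun b => F a b) :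
    sw (TensorProduct.leftComm ℂ V W U x) F = sw x fun a q => sw q fun b c => F b (a ⊗ₜ c) := by
  have h (a : V) : Lin fun q => sw (TensorProduct.leftComm ℂ V W U (a ⊗ₜ q)) F := by fun_prop
  rw [equiv_eq_sw (TensorProduct.leftComm ℂ V W U), sw_sw _ h₁ h₂]
  refine sw_congr fun a q => ?_
  rw [(h a).eq_sw q]
  simp (disch := fun_prop) only [TensorProduct.leftComm_tmul, sw_tmul]

end Restrict

section SAYDOn

variable {V B C : Type*} [AddCommGroup V] [Module ℂ V] [AddCommGroup B] [Module ℂ B]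
  [Coalgebra ℂ B] [AddCommGroup C] [Module ℂ C] [Coalgebra ℂ C]

/-- A right-left SAYD module structure on a subspace `P` of `V` given by linear maps on `V`. The
axioms are those of `RightLeftSAYD`, required for elements of `P` and of `P □_C B` only, where
`P □_C B` is the intersection of `P ⊗ B` and `V □_C B` in `V ⊗ B`. -/
structure SAYDOn (𝓑 : RightHopfCoalgebra B C) (P : Submodule ℂ V) where
  rho : V →ₗ[ℂ] V ⊗[ℂ] C
  act : V ⊗[ℂ] B →ₗ[ℂ] V
  coact : V →ₗ[ℂ] B ⊗[ℂ] V
  rho_mem : ∀ x ∈ P, rho x ∈ tens P C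
  rho_coassoc : ∀ x ∈ P,
    (sw (rho x) fun v c => sw (rho v) fun v₀ v₁ => v₀ ⊗ₜ[ℂ] (v₁ ⊗ₜ[ℂ] c)) =
      sw (rho x) fun v c => sw (Δ c) fun c₁ c₂ => v ⊗ₜ[ℂ] (c₁ ⊗ₜ[ℂ] c₂)
  rho_counit : ∀ x ∈ P, (sw (rho x) fun v c => ε c • v) = x
  act_mem : ∀ z ∈ tens P B, z ∈ cotensor rho 𝓑.leftR → act z ∈ P
  act_right_mem : ∀ z ∈ tens P B, z ∈ cotensor rho 𝓑.leftR →
    (sw z fun v b => sw (Δ b) fun b₁ b₂ => (v ⊗ₜ[ℂ] b₁) ⊗ₜ[ℂ] 𝓑.α b₂) ∈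
      tens (cotensor rho 𝓑.leftR) C
  rho_act : ∀ z ∈ tens P B, z ∈ cotensor rho 𝓑.leftR →
    rho (act z) = sw z fun v b => sw (Δ b) fun b₁ b₂ => act (v ⊗ₜ b₁) ⊗ₜ[ℂ] 𝓑.α b₂
  act_assoc : ∀ w ∈ tens P (B ⊗[ℂ] B),
    (sw w fun v p => sw p fun b b' => (v ⊗ₜ[ℂ] b) ⊗ₜ[ℂ] b') ∈ tens (cotensor rho 𝓑.leftR) B →
    (sw w fun v p => p ⊗ₜ[ℂ] v) ∈ tens (cotensor 𝓑.rightR 𝓑.leftR) V →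
    (sw w fun v p => sw p fun b b' => act (v ⊗ₜ b) ⊗ₜ[ℂ] b') ∈ cotensor rho 𝓑.leftR ∧
    (sw w fun v p => v ⊗ₜ[ℂ] total 𝓑.mul p) ∈ cotensor rho 𝓑.leftR ∧
    (sw w fun v p => sw p fun b b' => act (act (v ⊗ₜ b) ⊗ₜ[ℂ] b')) =
      sw w fun v p => act (v ⊗ₜ[ℂ] total 𝓑.mul p)
  act_unit : ∀ x ∈ P,
    (sw (rho x) fun v c => v ⊗ₜ[ℂ] 𝓑.unit c) ∈ cotensor rho 𝓑.leftR ∧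
    act (sw (rho x) fun v c => v ⊗ₜ[ℂ] 𝓑.unit c) = x
  coact_mem : ∀ x ∈ P, TensorProduct.comm ℂ B V (coact x) ∈ tens P B
  coassoc : ∀ x ∈ P,
    (sw (coact x) fun b v => sw (coact v) fun b' v' => b ⊗ₜ[ℂ] (b' ⊗ₜ[ℂ] v')) =
      sw (coact x) fun b v => sw (Δ b) fun b₁ b₂ => b₁ ⊗ₜ[ℂ] (b₂ ⊗ₜ[ℂ] v)
  counit_coact : ∀ x ∈ P, (sw (coact x) fun b v => ε b • v) = x
  left_coact : ∀ x ∈ P,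
    (sw (rho x) fun v c => sw (Δ (𝓑.unit c)) fun b₁ b₂ => (v ⊗ₜ[ℂ] b₂) ⊗ₜ[ℂ] 𝓑.α b₁) ∈
      tens (cotensor rho 𝓑.leftR) C ∧
    (sw (rho x) fun v c => sw (Δ (𝓑.unit c)) fun b₁ b₂ => 𝓑.α b₁ ⊗ₜ[ℂ] act (v ⊗ₜ b₂)) =
      sw (coact x) fun b v => 𝓑.α b ⊗ₜ[ℂ] v
  right_coact : ∀ x ∈ P, rho x = sw (coact x) fun b v => v ⊗ₜ[ℂ] 𝓑.β b
  nuInv_mem : ∀ z ∈ tens P B, z ∈ cotensor rho 𝓑.leftR →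
    (sw z fun x b => sw (coact x) fun b' v => sw (Δ b) fun b₁ b₂ =>
      (b₂ ⊗ₜ[ℂ] b') ⊗ₜ[ℂ] (v ⊗ₜ[ℂ] b₁)) ∈ tens (cotensor 𝓑.rightCop 𝓑.leftCop) (V ⊗[ℂ] B)
  act_nuInv_mem : ∀ z ∈ tens P B, z ∈ cotensor rho 𝓑.leftR →
    (sw z fun x b => sw (coact x) fun b' v => sw (Δ b) fun b₁ b₂ =>
      sw (total 𝓑.nuInv (b₂ ⊗ₜ b')) fun p q => (v ⊗ₜ[ℂ] p) ⊗ₜ[ℂ] (q ⊗ₜ[ℂ] b₁)) ∈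
      tens (cotensor rho 𝓑.leftR) (B ⊗[ℂ] B)
  mul_nuInv_mem : ∀ z ∈ tens P B, z ∈ cotensor rho 𝓑.leftR →
    (sw z fun x b => sw (coact x) fun b' v => sw (Δ b) fun b₁ b₂ =>
      sw (total 𝓑.nuInv (b₂ ⊗ₜ b')) fun p q => (q ⊗ₜ[ℂ] b₁) ⊗ₜ[ℂ] act (v ⊗ₜ p)) ∈
      tens (cotensor 𝓑.rightR 𝓑.leftR) V
  ayd : ∀ z ∈ tens P B, z ∈ cotensor rho 𝓑.leftR →
    coact (act z) = sw z fun x b => sw (coact x) fun b' v => sw (Δ b) fun b₁ b₂ =>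
      sw (total 𝓑.nuInv (b₂ ⊗ₜ b')) fun p q => total 𝓑.mul (q ⊗ₜ b₁) ⊗ₜ[ℂ] act (v ⊗ₜ p)
  stable : ∀ x ∈ P, (sw (coact x) fun b v => v ⊗ₜ[ℂ] b) ∈ cotensor rho 𝓑.leftR ∧
    act (sw (coact x) fun b v => v ⊗ₜ[ℂ] b) = x

namespace SAYDOn

variable {A Z : Type*} [AddCommGroup A] [Module ℂ A] [AddCommMonoid Z] [Module ℂ Z]
  {𝓑 : RightHopfCoalgebra B C} {P : Submodule ℂ V} (S : SAYDOn 𝓑 P)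

/-- The coaction of `C` on `P`. -/
noncomputable def rhoP : P →ₗ[ℂ] P ⊗[ℂ] C :=
  restrictR P S.rho S.rho_mem

/-- The coaction of `B` on `P`. -/
noncomputable def coactP : P →ₗ[ℂ] B ⊗[ℂ] P :=
  restrictL P S.coact S.coact_mem

theorem rTensor_mem {w : P ⊗[ℂ] B} (hw : w ∈ cotensor S.rhoP 𝓑.leftR) :
    P.subtype.rTensor B w ∈ cotensor S.rho 𝓑.leftR :=
  (mem_cotensor_restrictR S.rho_mem).1 hw

/-- The action of `B` on `P`. -/
noncomputable def actP : cotensor S.rhoP 𝓑.leftR →ₗ[ℂ] P :=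
  (S.act ∘ₗ P.subtype.rTensor B ∘ₗ Submodule.subtype _).codRestrict P fun w =>
    S.act_mem _ ⟨w.1, rfl⟩ (S.rTensor_mem w.2)

theorem actP_coe (w : cotensor S.rhoP 𝓑.leftR) :
    (S.actP w).1 = S.act (P.subtype.rTensor B w.1) := rfl

theorem sw_rhoP (p : P) {F : V → C → Z} (h₁ : ∀ b, Lin fun a => F a b)
    (h₂ : ∀ a, Lin fun b => F a b) :
    (sw (S.rhoP p) fun q c => F (P.subtype q) c) = sw (S.rho p.1) F :=
  sw_restrictR S.rho_mem p h₁ h₂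

theorem sw_coactP (p : P) {F : B → V → Z} (h₁ : ∀ b, Lin fun a => F a b)
    (h₂ : ∀ a, Lin fun b => F a b) :
    (sw (S.coactP p) fun b q => F b (P.subtype q)) = sw (S.coact p.1) F :=
  sw_restrictL S.coact_mem p h₁ h₂

theorem mem_tens_rhoP {z : (P ⊗[ℂ] B) ⊗[ℂ] A} :
    z ∈ tens (cotensor S.rhoP 𝓑.leftR) A ↔
      (sw z fun w a => sw w fun p b => (P.subtype p ⊗ₜ[ℂ] b) ⊗ₜ[ℂ] a) ∈
        tens (cotensor S.rho 𝓑.leftR) A := by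
  refine (mem_tens_cotensor_restrictR S.rho_mem).trans ?_
  simp only [rTensor_eq_sw, sw_tmul']

theorem sw_total_actP {z : (P ⊗[ℂ] B) ⊗[ℂ] A} (hz : z ∈ tens (cotensor S.rhoP 𝓑.leftR) A)
    {F : V → A → Z} (h₁ : ∀ b, Lin fun a => F a b) (h₂ : ∀ a, Lin fun b => F a b) :
    (sw z fun w a => F (P.subtype (total S.actP w)) a) =
      sw z fun w a => sw w fun p b => F (S.act (P.subtype p ⊗ₜ b)) a := by
  refine tens_congr hz (by fun_prop) (by fun_prop) (by fun_prop) (by fun_prop) fun w hw a => ?_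
  rw [total_coe S.actP ⟨w, hw⟩, Submodule.subtype_apply, actP_coe]
  rw [rTensor_eq_sw, map_sw, Lin.apply_sw (f := fun v => F v a) (h₁ a)]

theorem app_actP {w : P ⊗[ℂ] B} {p : P}
    (h : (sw w fun q b => P.subtype q ⊗ₜ[ℂ] b) ∈ cotensor S.rho 𝓑.leftR)
    (h' : (sw w fun q b => S.act (P.subtype q ⊗ₜ b)) = p.1) : App S.actP w p := by
  rw [← rTensor_eq_sw] at h
  refine ⟨(mem_cotensor_restrictR S.rho_mem).2 h, Subtype.ext ?_⟩
  rw [actP_coe, rTensor_eq_sw, map_sw, h']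

/-- The right `B`-module `P`. -/
noncomputable def toModule : RightModule 𝓑.toRightBicoalgebroid P where
  coact := S.rhoP
  coassoc p := by
    refine rTensor_subtype_injective P _ ?_
    rw [← sw_mk (LinearMap.rTensor _ P.subtype (TensorProduct.assoc ℂ P C C _)),
      ← sw_mk (LinearMap.rTensor _ P.subtype (LinearMap.lTensor _ _ _))]
    simp (disch := fun_prop) only [sw_rTensor, sw_assoc, sw_lTensor]
    have e₁ (q : P) (c : C) := S.sw_rhoP q (F := fun v c' => v ⊗ₜ[ℂ] (c' ⊗ₜ[ℂ] c))
      (by fun_prop) (by fun_prop)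
    have e₂ := S.sw_rhoP p (F := fun v c => sw (S.rho v) fun v c' => v ⊗ₜ[ℂ] (c' ⊗ₜ[ℂ] c))
      (by fun_prop) (by fun_prop)
    have e₃ := S.sw_rhoP p (F := fun v c => v ⊗ₜ[ℂ] Coalgebra.comul (R := ℂ) c)
      (by fun_prop) (by fun_prop)
    simp only [e₁]
    refine e₂.trans ((S.rho_coassoc p.1 p.2).trans (Eq.trans ?_ e₃.symm))
    refine sw_congr fun v c => ?_
    rw [← tmul_sw, sw_mk]
  counit_coact p := by
    refine P.injective_subtype ?_
    have e := S.sw_rhoP p (F := fun v c => ε c • v) (by fun_prop) (by fun_prop)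
    rw [map_eq_sw (LinearMap.lTensor P _)]
    simp only [equiv_sw, map_sw, LinearMap.lTensor_tmul, TensorProduct.rid_tmul, map_smul]
    exact e.trans (S.rho_counit p.1 p.2)
  act := S.actP
  act_right w := by
    have hw := S.rTensor_mem w.2
    have e' : (TensorProduct.assoc ℂ P B C).symm (𝓑.rightR.lTensor P w.1) =
        sw w.1 fun p b => sw (Δ b) fun b₁ b₂ => (p ⊗ₜ[ℂ] b₁) ⊗ₜ[ℂ] 𝓑.α b₂ := by
      rw [← sw_mk ((TensorProduct.assoc ℂ P B C).symm _)]
      simp (disch := fun_prop) only [sw_assoc_symm, sw_lTensor, 𝓑.sw_rightR]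
    have h₁ := S.act_right_mem _ ⟨w.1, rfl⟩ hw
    have h₂ := S.rho_act _ ⟨w.1, rfl⟩ hw
    have hm : (sw w.1 fun p b => sw (Δ b) fun b₁ b₂ => (p ⊗ₜ[ℂ] b₁) ⊗ₜ[ℂ] 𝓑.α b₂) ∈
        tens (cotensor S.rhoP 𝓑.leftR) C := by
      rw [S.mem_tens_rhoP]
      simp (disch := fun_prop) only [sw_rTensor, sw_sw, sw_tmul] at h₁ ⊢
      exact h₁
    rw [appL_iff, e']
    refine ⟨hm, rTensor_subtype_injective P _ ?_⟩
    have e₁ := S.sw_total_actP hm (F := fun v c => v ⊗ₜ[ℂ] c) (by fun_prop) (by fun_prop)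
    have e₂ := S.sw_rhoP (S.actP w) (F := fun v c => v ⊗ₜ[ℂ] c) (by fun_prop) (by fun_prop)
    rw [← sw_mk (LinearMap.rTensor _ P.subtype (LinearMap.rTensor _ _ _)),
      ← sw_mk (LinearMap.rTensor _ P.subtype (S.rhoP _))]
    rw [actP_coe, sw_mk, h₂] at e₂
    simp (disch := fun_prop) only [sw_rTensor, sw_sw, sw_tmul] at e₁ e₂ ⊢
    rw [e₁, e₂]
  act_assoc u v huv := by
    set w' := (Submodule.subtype (cotensor 𝓑.rightR 𝓑.leftR)).lTensor P v with hw'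
    have hu : (Submodule.subtype (cotensor S.rhoP 𝓑.leftR)).rTensor B u =
        (TensorProduct.assoc ℂ P B B).symm w' := by
      rw [← huv, LinearEquiv.symm_apply_apply]
    have m₁ : (TensorProduct.assoc ℂ P B B).symm w' ∈ tens (cotensor S.rhoP 𝓑.leftR) B :=
      ⟨u, hu⟩
    have m₂ : TensorProduct.comm ℂ P (B ⊗[ℂ] B) w' ∈ tens (cotensor 𝓑.rightR 𝓑.leftR) P :=
      comm_mem_tens.2 ⟨v, rfl⟩
    have e₁ := S.sw_total_actP m₁ (F := fun v b => v ⊗ₜ[ℂ] b) (by fun_prop) (by fun_prop)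
    have m₁' := S.mem_tens_rhoP.1 m₁
    have m₂' := tens_map m₂ (f := fun p => P.subtype p) (by fun_prop)
    obtain ⟨h₁, h₂, h₃⟩ := S.act_assoc (P.subtype.rTensor (B ⊗[ℂ] B) w') ⟨w', rfl⟩
      (by
        simp (disch := fun_prop) only [sw_rTensor, sw_assoc_symm, sw_tmul] at m₁' ⊢
        exact m₁')
      (by
        simp (disch := fun_prop) only [sw_rTensor, sw_flip] at m₂' ⊢
        exact m₂')
    have q₁ : (sw (S.actP.rTensor B u) fun q b => P.subtype q ⊗ₜ[ℂ] b) =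
        sw w' fun p c => sw c fun b b' => S.act (P.subtype p ⊗ₜ b) ⊗ₜ[ℂ] b' := by
      rw [← rTensor_total, hu]
      simp (disch := fun_prop) only [sw_rTensor, sw_assoc_symm, sw_tmul] at e₁ ⊢
      exact e₁
    have q₂ : (sw (𝓑.mul.lTensor P v) fun q b => P.subtype q ⊗ₜ[ℂ] b) =
        sw w' fun p c => P.subtype p ⊗ₜ[ℂ] total 𝓑.mul c := by
      rw [← lTensor_total]
      simp (disch := fun_prop) only [sw_lTensor, hw']
    simp (disch := fun_prop) only [sw_rTensor] at h₁ h₂ h₃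
    have q₂' := congrArg S.act q₂
    have q₁' := congrArg S.act q₁
    simp only [map_sw] at q₁' q₂'
    have hy : (sw w' fun p c => S.act (P.subtype p ⊗ₜ total 𝓑.mul c)) ∈ P := by
      rw [← q₂', ← map_sw]
      refine S.act_mem _ (sw_mem fun q b => tmul_mem_tens q.2 b) ?_
      rw [q₂]
      exact h₂
    refine ⟨⟨_, hy⟩, S.app_actP ?_ ?_, S.app_actP ?_ ?_⟩
    · rw [q₁]; exact h₁
    · rw [q₁']; exact h₃
    · rw [q₂]; exact h₂
    · rw [q₂']
  act_unit p := by
    obtain ⟨h₁, h₂⟩ := S.act_unit p.1 p.2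
    rw [map_sw] at h₂
    refine S.app_actP ?_ ?_
    · simp (disch := fun_prop) only [sw_lTensor]
      rw [S.sw_rhoP p (F := fun v c => v ⊗ₜ[ℂ] 𝓑.unit c) (by fun_prop) (by fun_prop)]
      exact h₁
    · simp (disch := fun_prop) only [sw_lTensor]
      rw [S.sw_rhoP p (F := fun v c => S.act (v ⊗ₜ[ℂ] 𝓑.unit c)) (by fun_prop) (by fun_prop)]
      exact h₂

end SAYDOn
end SAYDOn

section Shuffles

variable {V₁ V₂ V₃ V₄ V W : Type*}
  [AddCommGroup V₁] [Module ℂ V₁] [AddCommGroup V₂] [Module ℂ V₂]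
  [AddCommGroup V₃] [Module ℂ V₃] [AddCommGroup V₄] [Module ℂ V₄]
  [AddCommGroup V] [Module ℂ V] [AddCommGroup W] [Module ℂ W]

theorem cyc_map (f : V →ₗ[ℂ] V₁ ⊗[ℂ] V₂) (g : W →ₗ[ℂ] V₃ ⊗[ℂ] V₄) (x : V ⊗[ℂ] W) :
    cyc (TensorProduct.map f g x) = sw x fun v w => sw (f v) fun a b => sw (g w) fun c d =>
      (b ⊗ₜ[ℂ] c) ⊗ₜ[ℂ] (d ⊗ₜ[ℂ] a) := by
  rw [← LinearMap.comp_apply, map_eq_sw (cyc ∘ₗ TensorProduct.map f g)]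
  refine sw_congr fun v w => ?_
  rw [LinearMap.comp_apply, TensorProduct.map_tmul]
  conv_lhs => rw [← sw_mk (f v), ← sw_mk (g w)]
  simp only [sw_tmul', tmul_sw, map_sw, cyc_tmul]
  exact sw_comm _ _ _

theorem shuf_tmul_eq_sw (a : V₁) (b : V₂) (x : V₃ ⊗[ℂ] V₄) :
    shuf ((a ⊗ₜ[ℂ] b) ⊗ₜ[ℂ] x) = sw x fun c d => (d ⊗ₜ[ℂ] b) ⊗ₜ[ℂ] (a ⊗ₜ[ℂ] c) := by
  conv_lhs => rw [← sw_mk x]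
  simp only [tmul_sw, map_sw, shuf_tmul]

end Shuffles

section SAYDOn

variable {V B C : Type*} [AddCommGroup V] [Module ℂ V] [AddCommGroup B] [Module ℂ B]
  [Coalgebra ℂ B] [AddCommGroup C] [Module ℂ C] [Coalgebra ℂ C]
  {𝓑 : RightHopfCoalgebra B C} {P : Submodule ℂ V} (S : SAYDOn 𝓑 P)

namespace SAYDOn

/-- The left `B`-comodule `P`. -/
noncomputable def toComodule : LeftComodule B P where
  coact := S.coactP
  coassoc p := by
    refine Module.Flat.lTensor_preserves_injective_linearMap (M := B) _
      (lTensor_subtype_injective P B) ?_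
    rw [← sw_mk (LinearMap.lTensor B (P.subtype.lTensor B) (TensorProduct.assoc ℂ B B P _)),
      ← sw_mk (LinearMap.lTensor B (P.subtype.lTensor B) (S.coactP.lTensor B _))]
    simp (disch := fun_prop) only [sw_lTensor, sw_assoc, sw_rTensor, LinearMap.lTensor_tmul]
    have e₁ := S.sw_coactP p (F := fun b v => sw (Δ b) fun b₁ b₂ => b₁ ⊗ₜ[ℂ] (b₂ ⊗ₜ[ℂ] v))
      (by fun_prop) (by fun_prop)
    have e₂ := S.sw_coactP p (F := fun b v => b ⊗ₜ[ℂ] S.coact v) (by fun_prop) (by fun_prop)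
    have e₃ (q : P) : P.subtype.lTensor B (S.coactP q) = S.coact (P.subtype q) :=
      lTensor_restrictL S.coact_mem q
    simp only [e₃]
    refine e₁.trans ((S.coassoc p.1 p.2).symm.trans (Eq.trans ?_ e₂.symm))
    refine sw_congr fun b v => ?_
    rw [← tmul_sw, sw_mk]
  counit_coact p := by
    refine P.injective_subtype ?_
    have e := S.sw_coactP p (F := fun b v => ε b • v) (by fun_prop) (by fun_prop)
    rw [map_eq_sw (LinearMap.rTensor P _)]
    simp only [equiv_sw, map_sw, LinearMap.rTensor_tmul, TensorProduct.lid_tmul, map_smul]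
    exact e.trans (S.counit_coact p.1 p.2)

/-- The right-left SAYD module `P`. -/
noncomputable def toSAYD : RightLeftSAYD 𝓑 P where
  module := S.toModule
  comodule := S.toComodule
  left_coact p := by
    change AppR S.actP (TensorProduct.leftComm ℂ P C B (((𝓑.α.toLinearMap.rTensor B ∘ₗ
      Coalgebra.comul (R := ℂ) ∘ₗ 𝓑.unit).lTensor P (S.rhoP p))))
      (𝓑.α.toLinearMap.rTensor P (S.coactP p))
    obtain ⟨h₁, h₂⟩ := S.left_coact p.1 p.2
    have e : TensorProduct.comm ℂ C (P ⊗[ℂ] B) (TensorProduct.leftComm ℂ P C B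
        (((𝓑.α.toLinearMap.rTensor B ∘ₗ Coalgebra.comul (R := ℂ) ∘ₗ 𝓑.unit).lTensor P
          (S.rhoP p)))) = sw (S.rhoP p) fun q c => sw (Δ (𝓑.unit c)) fun b₁ b₂ =>
        (q ⊗ₜ[ℂ] b₂) ⊗ₜ[ℂ] 𝓑.α b₁ := by
      rw [← sw_mk (TensorProduct.comm ℂ C (P ⊗[ℂ] B) _)]
      simp (disch := fun_prop) only [sw_flip, sw_leftComm, sw_lTensor, LinearMap.comp_apply,
        sw_rTensor]
      rfl
    have m : TensorProduct.comm ℂ C (P ⊗[ℂ] B) (TensorProduct.leftComm ℂ P C B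
        (((𝓑.α.toLinearMap.rTensor B ∘ₗ Coalgebra.comul (R := ℂ) ∘ₗ 𝓑.unit).lTensor P
          (S.rhoP p)))) ∈ tens (cotensor S.rhoP 𝓑.leftR) C := by
      rw [e, S.mem_tens_rhoP]
      simp (disch := fun_prop) only [sw_sw, sw_tmul]
      rw [S.sw_rhoP p (F := fun v c => sw (Δ (𝓑.unit c)) fun b₁ b₂ =>
        (v ⊗ₜ[ℂ] b₂) ⊗ₜ[ℂ] 𝓑.α b₁) (by fun_prop) (by fun_prop)]
      exact h₁
    refine (appR_iff _ _ _).2 ⟨m, lTensor_subtype_injective P _ ?_⟩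
    have e₁ := S.sw_total_actP m (F := fun v c => c ⊗ₜ[ℂ] v) (by fun_prop) (by fun_prop)
    rw [← sw_mk (P.subtype.lTensor C _), ← sw_mk (P.subtype.lTensor C (LinearMap.rTensor _ _ _))]
    simp (disch := fun_prop) only [sw_flip, sw_lTensor, sw_rTensor] at e₁ ⊢
    have e₂ := S.sw_coactP p (F := fun b v => 𝓑.α b ⊗ₜ[ℂ] v) (by fun_prop) (by fun_prop)
    have e₃ := S.sw_rhoP p (F := fun v c => sw (Δ (𝓑.unit c)) fun b₁ b₂ =>
      𝓑.α b₁ ⊗ₜ[ℂ] S.act (v ⊗ₜ b₂)) (by fun_prop) (by fun_prop)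
    refine e₁.trans (Eq.trans ?_ e₂.symm)
    rw [← h₂, ← e₃]
    simp (disch := fun_prop) only [sw_leftComm, sw_lTensor, LinearMap.comp_apply, sw_rTensor,
      sw_tmul]
    rfl
  right_coact p := by
    refine rTensor_subtype_injective P _ ?_
    have e := S.sw_coactP p (F := fun b v => v ⊗ₜ[ℂ] 𝓑.β b) (by fun_prop) (by fun_prop)
    refine (rTensor_restrictR S.rho_mem p).trans ((S.right_coact p.1 p.2).trans (e.symm.trans ?_))
    rw [← sw_mk (P.subtype.rTensor C _)]
    simp (disch := fun_prop) only [sw_flip, sw_rTensor]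
    rfl
  ayd (x : cotensor S.rhoP 𝓑.leftR) := by
    change ∃ (y : (P ⊗[ℂ] B) ⊗[ℂ] (B ⊗[ℂ] B)) (z : (B ⊗[ℂ] B) ⊗[ℂ] P),
      AppR 𝓑.nuInv (cyc (TensorProduct.map S.coactP (Coalgebra.comul (R := ℂ)) x.1)) y ∧
      AppR S.actP (shuf y) z ∧ AppL 𝓑.mul z (S.coactP (S.actP x))
    have hw := S.rTensor_mem x.2
    have h₁ := S.nuInv_mem _ ⟨x.1, rfl⟩ hw
    have h₂ := S.act_nuInv_mem _ ⟨x.1, rfl⟩ hw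
    have h₃ := S.mul_nuInv_mem _ ⟨x.1, rfl⟩ hw
    have h₄ := S.ayd _ ⟨x.1, rfl⟩ hw
    simp (disch := fun_prop) only [sw_rTensor] at h₁ h₂ h₃ h₄
    have c₁ (p : P) (b : B) := S.sw_coactP p (F := fun b' v => sw (Δ b) fun b₁ b₂ =>
      (b₂ ⊗ₜ[ℂ] b') ⊗ₜ[ℂ] (v ⊗ₜ[ℂ] b₁)) (by fun_prop) (by fun_prop)
    have c₂ (p : P) (b : B) := S.sw_coactP p (F := fun b' v => sw (Δ b) fun b₁ b₂ =>
      sw (total 𝓑.nuInv (b₂ ⊗ₜ b')) fun p q => (v ⊗ₜ[ℂ] p) ⊗ₜ[ℂ] (q ⊗ₜ[ℂ] b₁))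
      (by fun_prop) (by fun_prop)
    have c₃ (p : P) (b : B) := S.sw_coactP p (F := fun b' v => sw (Δ b) fun b₁ b₂ =>
      sw (total 𝓑.nuInv (b₂ ⊗ₜ b')) fun p q => (q ⊗ₜ[ℂ] b₁) ⊗ₜ[ℂ] S.act (v ⊗ₜ p))
      (by fun_prop) (by fun_prop)
    have c₄ (p : P) (b : B) := S.sw_coactP p (F := fun b' v => sw (Δ b) fun b₁ b₂ =>
      sw (total 𝓑.nuInv (b₂ ⊗ₜ b')) fun p q => total 𝓑.mul (q ⊗ₜ b₁) ⊗ₜ[ℂ] S.act (v ⊗ₜ p))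
      (by fun_prop) (by fun_prop)
    -- each domain condition holds in `P` since it holds in `V`
    have m₁ : TensorProduct.comm ℂ (P ⊗[ℂ] B) (B ⊗[ℂ] B)
        (cyc (TensorProduct.map S.coactP (Coalgebra.comul (R := ℂ)) x.1)) ∈
        tens (cotensor 𝓑.rightCop 𝓑.leftCop) (P ⊗[ℂ] B) := by
      refine mem_tens_of_injective (rTensor_subtype_injective P B) ?_
      simp only [cyc_map, equiv_sw, map_sw, TensorProduct.comm_tmul, LinearMap.lTensor_tmul,
        LinearMap.rTensor_tmul, c₁]
      exact h₁
    have e : shuf ((total 𝓑.nuInv).lTensor (P ⊗[ℂ] B)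
        (cyc (TensorProduct.map S.coactP (Coalgebra.comul (R := ℂ)) x.1))) =
        sw x.1 fun p b => sw (S.coactP p) fun b' v => sw (Δ b) fun b₁ b₂ =>
        sw (total 𝓑.nuInv (b₂ ⊗ₜ b')) fun p q => (q ⊗ₜ[ℂ] b₁) ⊗ₜ[ℂ] (v ⊗ₜ[ℂ] p) := by
      simp only [cyc_map, map_sw, LinearMap.lTensor_tmul, shuf_tmul_eq_sw]
    have m₂ : TensorProduct.comm ℂ (B ⊗[ℂ] B) (P ⊗[ℂ] B) (shuf ((total 𝓑.nuInv).lTensor (P ⊗[ℂ] B)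
        (cyc (TensorProduct.map S.coactP (Coalgebra.comul (R := ℂ)) x.1)))) ∈
        tens (cotensor S.rhoP 𝓑.leftR) (B ⊗[ℂ] B) := by
      rw [e, S.mem_tens_rhoP]
      simp (disch := fun_prop) only [equiv_sw, TensorProduct.comm_tmul, sw_sw, sw_tmul, c₂]
      exact h₂
    have e' (Z : Type _) [AddCommGroup Z] [Module ℂ Z] (F : B ⊗[ℂ] B → V → Z)
        (hF₁ : ∀ b, Lin fun a => F a b) (hF₂ : ∀ a, Lin fun b => F a b) :
        (sw ((total S.actP).lTensor (B ⊗[ℂ] B) (shuf ((total 𝓑.nuInv).lTensor (P ⊗[ℂ] B)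
          (cyc (TensorProduct.map S.coactP (Coalgebra.comul (R := ℂ)) x.1)))))
          fun p q => F p (P.subtype q)) =
        sw x.1 fun p b => sw (S.coactP p) fun b' v => sw (Δ b) fun b₁ b₂ =>
        sw (total 𝓑.nuInv (b₂ ⊗ₜ b')) fun p q =>
          F (q ⊗ₜ[ℂ] b₁) (S.act (P.subtype v ⊗ₜ[ℂ] p)) := by
      have h := S.sw_total_actP m₂ (F := fun v p => F p v) (by fun_prop) (by fun_prop)
      rw [sw_flip _ (by fun_prop) (by fun_prop), sw_flip _ (by fun_prop) (by fun_prop)] at h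
      rw [sw_lTensor _ _ (by fun_prop) (by fun_prop), h, e]
      simp (disch := fun_prop) only [sw_sw, sw_tmul]
    refine ⟨_, _, (appR_iff _ _ _).2 ⟨m₁, rfl⟩, (appR_iff _ _ _).2 ⟨m₂, rfl⟩,
      (appL_iff _ _ _).2 ⟨?_, ?_⟩⟩
    · refine mem_tens_of_injective P.injective_subtype ?_
      rw [← sw_mk (LinearMap.lTensor (B ⊗[ℂ] B) P.subtype _)]
      rw [sw_lTensor _ _ (by fun_prop) (by fun_prop), e' _ (fun p v => p ⊗ₜ[ℂ] v) (by fun_prop)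
        (by fun_prop)]
      simp only [c₃]
      exact h₃
    · refine lTensor_subtype_injective P B ?_
      have e₂ : P.subtype.lTensor B (S.coactP (S.actP x)) = S.coact (S.actP x).1 :=
        lTensor_restrictL S.coact_mem _
      refine Eq.trans ?_ e₂.symm
      rw [actP_coe, h₄, ← sw_mk (P.subtype.lTensor B _)]
      rw [sw_lTensor _ _ (by fun_prop) (by fun_prop), sw_rTensor _ _ (by fun_prop) (by fun_prop),
        e' _ (fun p v => total 𝓑.mul p ⊗ₜ[ℂ] v) (by fun_prop) (by fun_prop)]
      simp only [c₄]
      rfl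
  stable p := by
    obtain ⟨h₁, h₂⟩ := S.stable p.1 p.2
    rw [map_sw] at h₂
    refine S.app_actP ?_ ?_
    · rw [sw_flip _ (by fun_prop) (by fun_prop)]
      exact (S.sw_coactP p (F := fun b v => v ⊗ₜ[ℂ] b) (by fun_prop) (by fun_prop)).symm ▸ h₁
    · rw [sw_flip _ (by fun_prop) (by fun_prop)]
      exact (S.sw_coactP p (F := fun b v => S.act (v ⊗ₜ[ℂ] b)) (by fun_prop)
        (by fun_prop)).trans h₂

end SAYDOn
end SAYDOn

/-! ### The cotensor product `M □_K T` -/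

section CotensorSAYD

variable {B C T K M : Type*} [AddCommGroup B] [Module ℂ B] [Coalgebra ℂ B]
  [AddCommGroup C] [Module ℂ C] [Coalgebra ℂ C] [AddCommGroup T] [Module ℂ T] [Coalgebra ℂ T]
  [AddCommGroup K] [Module ℂ K] [Coalgebra ℂ K] [AddCommGroup M] [Module ℂ M]
  {𝓑 : RightHopfCoalgebra B C} {X : RightModuleCoalgebra 𝓑.toRightBicoalgebroid T}
  {𝓚 : LeftHopfCoalgebra K X.Quot} {Y : LeftComoduleCoalgebra 𝓚.toLeftBicoalgebroid T}

/-- The SAYD structure on the subspace `M □_K T` of `M ⊗ T`. -/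
noncomputable def EquivariantGalois.saydOn (G : EquivariantGalois 𝓑 X 𝓚 Y)
    (N : LeftRightSAYD 𝓚 M) : SAYDOn 𝓑 (cotensor N.comodule.coact Y.coact) where
  rho := X.coactOn M
  act := X.actOn M
  coact := G.coaction N
  rho_mem _ hx := G.coactOn_mem N.comodule hx
  rho_coassoc x _ := X.coactOn_coassoc x
  rho_counit x _ := X.coactOn_counit x
  act_mem _ hz hz' := G.actOn_mem N.comodule hz hz'
  act_right_mem _ _ hz' := X.actOn_right_mem hz'
  rho_act _ _ hz' := X.coactOn_actOn hz'
  act_assoc _ _ h₁ h₂ := X.actOn_assoc h₁ h₂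
  act_unit x _ := X.actOn_unit x
  coact_mem x hx := by
    rw [equiv_eq_sw (TensorProduct.comm ℂ B (M ⊗[ℂ] T))]
    simp (disch := fun_prop) only [TensorProduct.comm_tmul, G.sw_coaction]
    exact G.delta_mem_cotensor N hx
  coassoc x hx := by
    have h := congrArg (fun w => sw w fun v u => sw v fun t b' => sw u fun b m =>
      b ⊗ₜ[ℂ] (b' ⊗ₜ[ℂ] (m ⊗ₜ[ℂ] t))) (G.delta_delta N hx)
    simp (disch := fun_prop) only [G.sw_coaction, sw_sw, sw_tmul] at h ⊢
    exact h
  counit_coact x hx := by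
    simp (disch := fun_prop) only [G.sw_coaction]
    rw [G.sw_delta_counit N hx (F := fun m t => m ⊗ₜ[ℂ] t) (by fun_prop) (by fun_prop), sw_mk]
  left_coact x hx := by
    refine ⟨X.unit_mem_coactOn x, ?_⟩
    simp (disch := fun_prop) only [X.sw_coactOn, X.actOn_eq, G.sw_coaction, sw_tmul]
    rw [G.sw_delta_α N hx (F := fun m t c => c ⊗ₜ[ℂ] (m ⊗ₜ[ℂ] t)) (by fun_prop) (by fun_prop)
      (by fun_prop)]
    exact sw_congr fun m t => (X.sw_leftCoact_eq t (F := fun c t => c ⊗ₜ[ℂ] (m ⊗ₜ[ℂ] t))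
      (by fun_prop) (by fun_prop)).symm
  right_coact x hx := by
    simp (disch := fun_prop) only [G.sw_coaction]
    rw [G.sw_delta_β N hx (F := fun m t c => (m ⊗ₜ[ℂ] t) ⊗ₜ[ℂ] c) (by fun_prop) (by fun_prop)
      (by fun_prop), ← X.sw_coactOn x (F := fun v c => v ⊗ₜ[ℂ] c) (by fun_prop) (by fun_prop),
      sw_mk]
  nuInv_mem _ hz hz' := by
    simp (disch := fun_prop) only [G.sw_coaction]
    exact G.delta_nuInv_mem N hz hz'
  act_nuInv_mem _ hz hz' := by
    simp (disch := fun_prop) only [G.sw_coaction]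
    rw [X.mem_tens_coactOn]
    have h := tens_map (G.delta_act_mem N hz hz') (f := fun u => sw u fun q w => sw w fun b m =>
      m ⊗ₜ[ℂ] (q ⊗ₜ[ℂ] b)) (by fun_prop)
    simp (disch := fun_prop) only [sw_sw, sw_tmul] at h ⊢
    exact h
  mul_nuInv_mem _ hz hz' := by
    simp (disch := fun_prop) only [G.sw_coaction, X.actOn_eq, sw_tmul]
    exact G.delta_mul_mem N hz hz'
  ayd z hz hz' := by
    simp (disch := fun_prop) only [G.sw_coaction, X.actOn_eq, sw_tmul]
    rw [G.coaction_eq, G.delta_actOn N hz hz']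
    simp (disch := fun_prop) only [sw_sw, sw_tmul]
  stable x hx := by
    constructor
    · rw [X.mem_coactOn]
      simp (disch := fun_prop) only [G.sw_coaction, sw_sw, sw_tmul]
      have h := G.delta_mem N hx
      rw [← sw_mk (G.delta N x)] at h
      simp (disch := fun_prop) only [← sw_tmul', sw_mk] at h ⊢
      exact h
    · simp (disch := fun_prop) only [map_sw, G.sw_coaction, X.actOn_eq, sw_tmul]
      rw [G.sw_delta_act N hx (F := fun m t => m ⊗ₜ[ℂ] t) (by fun_prop) (by fun_prop), sw_mk]

end CotensorSAYD

end CrossHopf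

theorem mainTheorem1 {B C T K M : Type*}
    [AddCommGroup B] [Module ℂ B] [Coalgebra ℂ B]
    [AddCommGroup C] [Module ℂ C] [Coalgebra ℂ C]
    [AddCommGroup T] [Module ℂ T] [Coalgebra ℂ T]
    [AddCommGroup K] [Module ℂ K] [Coalgebra ℂ K]
    [AddCommGroup M] [Module ℂ M]
    (𝓑 : CrossHopf.RightHopfCoalgebra B C)
    (X : CrossHopf.RightModuleCoalgebra 𝓑.toRightBicoalgebroid T)
    (𝓚 : CrossHopf.LeftHopfCoalgebra K X.Quot)
    (Y : CrossHopf.LeftComoduleCoalgebra 𝓚.toLeftBicoalgebroid T)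
    (G : CrossHopf.EquivariantGalois 𝓑 X 𝓚 Y)
    (N : CrossHopf.LeftRightSAYD 𝓚 M) :
    -- `P` is the cotensor product `M □_K T`, a subspace of `M ⊗ T`
    let P : Submodule ℂ (M ⊗[ℂ] T) := CrossHopf.cotensor N.comodule.coact Y.coact
    ∃ Q : CrossHopf.RightLeftSAYD 𝓑 P,
      -- the right `C`-coaction is `m ⊗ t ↦ m ⊗ t₀ ⊗ t₁`
      (∀ p : P, P.subtype.rTensor C (Q.module.coact p) =
        (TensorProduct.assoc ℂ M T C).symm (X.coact.lTensor M p.1)) ∧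
      -- the action is `(m ⊗ t) ◁ b = m ⊗ t ◁ b`
      (∀ w : CrossHopf.cotensor Q.module.coact 𝓑.leftR,
        CrossHopf.AppR X.act (TensorProduct.assoc ℂ M T B (P.subtype.rTensor B w.1))
          (Q.module.act w).1) ∧
      -- the coaction is `m ⊗ t ↦ κ((t₂₍₀₎)₂ ⊗ t₁) ⊗ t₂₍₋₁₎ ▷ m ⊗ (t₂₍₀₎)₁`
      (∀ p : P, ∃ (y : M ⊗[ℂ] (T ⊗[ℂ] T)) (w : (M ⊗[ℂ] T) ⊗[ℂ] B),
        CrossHopf.AppL N.module.act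
          (TensorProduct.tensorTensorTensorComm ℂ K T M T
            (TensorProduct.comm ℂ (M ⊗[ℂ] T) (K ⊗[ℂ] T)
              ((TensorProduct.assoc ℂ M T (K ⊗[ℂ] T)).symm
                ((Y.coact.lTensor T ∘ₗ Coalgebra.comul (R := ℂ)).lTensor M p.1)))) y ∧
        CrossHopf.AppR G.kappa
          ((TensorProduct.assoc ℂ M T (T ⊗[ℂ] T)).symm
            (((TensorProduct.assoc ℂ T T T).toLinearMap ∘ₗ
              (Coalgebra.comul (R := ℂ)).rTensor T).lTensor M y)) w ∧
        P.subtype.lTensor B (Q.comodule.coact p) =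
          TensorProduct.comm ℂ (M ⊗[ℂ] T) B w) :=
  ⟨(G.saydOn N).toSAYD, fun p => CrossHopf.rTensor_restrictR (G.saydOn N).rho_mem p,
    fun w => X.app_actOn ((G.saydOn N).rTensor_mem w.2),
    fun p => (CrossHopf.lTensor_restrictL (G.saydOn N).coact_mem p).symm ▸
      G.coaction_eq_kappa N p.2⟩
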